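/- Let $(M^7,g,\varphi)$ be a connected smooth $7$-dimensional Riemannian manifold with a smooth $G_2$-structure, i.e. a smooth $3$-form $\varphi$ such that at every point $x$ there is an orthonormal basis $e_1,\dots,e_7$ of $T_xM$ (an adapted frame) in which $$\varphi_x=\varphi_0:=e_{127}+e_{135}-e_{146}-e_{236}-e_{245}+e_{347}+e_{567}.$$ Let $\nabla^c$ be its characteristic connection, i.e. the connection with $\nabla^c g=0$, $\nabla^c\varphi=0$ whose torsion $T^c(X,Y,Z)=g(\nabla^c_XY-\nabla^c_YX-[X,Y],Z)$ is totally skew-symmetric (such a connection is unique when it exists). Suppose that the structure is of pure type $\mathcal W_3$, i.e. $T^c$ lies at every point in $\Lambda^3_{27}$, the orthogonal complement of $\Lambda^3_1\oplus\Lambda^3_7=\mathbb R\varphi\oplus\{X\lrcorner *\varphi\}$ in $\Lambda^3$, and that $\nabla^cT^c=0$. Let $\mathfrak{hol}(\nabla^c)\subset\mathfrak{g}_2=\{A\in\mathfrak{so}(7): A\cdot\varphi_0=0\}$ denote the Lie algebra of the holonomy group of $\nabla^c$ at a point of $M$, expressed in an adapted frame. Suppose that, at some point and for some adapted frame there, $\mathfrak{hol}(\nabla^c)$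 is one of the following subalgebras of $\mathfrak g_2$: * $\mathfrak{su}(3)$, the stabilizer of $e_7$ in $\mathfrak g_2$; * $\mathfrak{su}(2)\subset\mathfrak{su}(3)$, the subalgebra generated by $e_{13}+e_{24}$, $e_{14}-e_{23}$, $e_{12}-e_{34}$; * $\mathfrak{so}_{ir}(3)$, a subalgebra of $\mathfrak g_2$ isomorphic to $\mathfrak{so}(3)$ and acting irreducibly on $\mathbb R^7$. Then $T^c=0$, and $(M^7,g,\varphi)$ is a parallel $G_2$-manifold, i.e. $\nabla^g\varphi=0$ for the Levi-Civita connection $\nabla^g$. -/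

import Mathlib

open Bundle
open scoped Manifold ContDiff

noncomputable section

namespace G2Torsion

attribute [local instance 100] LieRing.ofAssociativeRing

/-! ### Linear algebra on Euclidean 7-space

The orthonormal basis `e₁, …, e₇` is indexed by `Fin 7 = {0, …, 6}`. -/

/-- Euclidean 7-space. -/
abbrev E7 : Type := EuclideanSpace ℝ (Fin 7)

/-- The standard basis vector with index `i : Fin 7`, i.e. `e_{i+1}`. -/
def stdVec (i : Fin 7) : E7 := EuclideanSpace.single i (1 : ℝ)

/-- The elementary 3-form `eᵢ ∧ eⱼ ∧ eₖ`; the indices are the usual ones, shifted by one. -/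
def elem3 (i j k : Fin 7) (u v w : E7) : ℝ :=
  Matrix.det !![u i, u j, u k; v i, v j, v k; w i, w j, w k]

/-- The elementary 4-form `eᵢ ∧ eⱼ ∧ eₖ ∧ eₗ`. -/
def elem4 (i j k l : Fin 7) (u v w x : E7) : ℝ :=
  Matrix.det !![u i, u j, u k, u l; v i, v j, v k, v l; w i, w j, w k, w l; x i, x j, x k, x l]

/-- The standard `G₂`-form
`φ₀ = e₁₂₇ + e₁₃₅ - e₁₄₆ - e₂₃₆ - e₂₄₅ + e₃₄₇ + e₅₆₇`. -/
def phi0 (u v w : E7) : ℝ :=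
  elem3 0 1 6 u v w + elem3 0 2 4 u v w - elem3 0 3 5 u v w - elem3 1 2 5 u v w
    - elem3 1 3 4 u v w + elem3 2 3 6 u v w + elem3 4 5 6 u v w

/-- The Hodge dual of `φ₀` (for the orientation `e₁ ∧ ⋯ ∧ e₇`),
`*φ₀ = e₃₄₅₆ - e₂₄₆₇ + e₂₃₅₇ + e₁₄₅₇ + e₁₃₆₇ + e₁₂₅₆ + e₁₂₃₄`. -/
def starPhi0 (u v w x : E7) : ℝ :=
  elem4 2 3 4 5 u v w x - elem4 1 3 5 6 u v w x + elem4 1 2 4 6 u v w x + elem4 0 3 4 6 u v w x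
    + elem4 0 2 5 6 u v w x + elem4 0 1 4 5 u v w x + elem4 0 1 2 3 u v w x

/-- A 3-form `T` on `ℝ⁷` lies in `Λ³₂₇`: it is orthogonal to `Λ³₁ = ℝ φ₀` and to
`Λ³₇ = {v ⌟ *φ₀}`. -/
def InLambda27 (T : E7 → E7 → E7 → ℝ) : Prop :=
  (∑ i, ∑ j, ∑ k, T (stdVec i) (stdVec j) (stdVec k) *
      phi0 (stdVec i) (stdVec j) (stdVec k) = 0) ∧
  ∀ v : E7, ∑ i, ∑ j, ∑ k, T (stdVec i) (stdVec j) (stdVec k) *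
      starPhi0 v (stdVec i) (stdVec j) (stdVec k) = 0

theorem phi0_add₁ (u u' v w : E7) : phi0 (u + u') v w = phi0 u v w + phi0 u' v w := by
  simp [phi0, elem3, Matrix.det_fin_three]; ring

theorem phi0_add₂ (u v v' w : E7) : phi0 u (v + v') w = phi0 u v w + phi0 u v' w := by
  simp [phi0, elem3, Matrix.det_fin_three]; ring

theorem phi0_add₃ (u v w w' : E7) : phi0 u v (w + w') = phi0 u v w + phi0 u v w' := by
  simp [phi0, elem3, Matrix.det_fin_three]; ring

theorem phi0_smul₁ (c : ℝ) (u v w : E7) : phi0 (c • u) v w = c * phi0 u v w := by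
  simp [phi0, elem3, Matrix.det_fin_three]; ring

theorem phi0_smul₂ (c : ℝ) (u v w : E7) : phi0 u (c • v) w = c * phi0 u v w := by
  simp [phi0, elem3, Matrix.det_fin_three]; ring

theorem phi0_smul₃ (c : ℝ) (u v w : E7) : phi0 u v (c • w) = c * phi0 u v w := by
  simp [phi0, elem3, Matrix.det_fin_three]; ring

theorem phi0_sub₁ (u u' v w : E7) : phi0 (u - u') v w = phi0 u v w - phi0 u' v w := by
  simp [phi0, elem3, Matrix.det_fin_three]; ring

theorem phi0_sub₂ (u v v' w : E7) : phi0 u (v - v') w = phi0 u v w - phi0 u v' w := by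
  simp [phi0, elem3, Matrix.det_fin_three]; ring

theorem phi0_sub₃ (u v w w' : E7) : phi0 u v (w - w') = phi0 u v w - phi0 u v w' := by
  simp [phi0, elem3, Matrix.det_fin_three]; ring

theorem phi0_zero₁ (v w : E7) : phi0 0 v w = 0 := by
  simp [phi0, elem3, Matrix.det_fin_three]

theorem phi0_zero₂ (u w : E7) : phi0 u 0 w = 0 := by
  simp [phi0, elem3, Matrix.det_fin_three]

theorem phi0_zero₃ (u v : E7) : phi0 u v 0 = 0 := by
  simp [phi0, elem3, Matrix.det_fin_three]

/-- The Lie algebra `𝔤₂ ⊂ 𝔰𝔬(7)`: skew-symmetric endomorphisms of `ℝ⁷` annihilating `φ₀`. -/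
def g2 : LieSubalgebra ℝ (E7 →L[ℝ] E7) where
  carrier := {A | (∀ u v, inner ℝ (A u) v = - inner ℝ u (A v)) ∧
    ∀ u v w, phi0 (A u) v w + phi0 u (A v) w + phi0 u v (A w) = 0}
  zero_mem' := by
    refine ⟨fun u v => by simp, fun u v w => ?_⟩
    simp [phi0_zero₁, phi0_zero₂, phi0_zero₃]
  add_mem' := by
    rintro A B ⟨hA, hA'⟩ ⟨hB, hB'⟩
    refine ⟨fun u v => ?_, fun u v w => ?_⟩
    · simp only [add_apply, inner_add_left, inner_add_right, hA, hB]; ring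
    · simp only [add_apply, phi0_add₁, phi0_add₂, phi0_add₃]
      linear_combination hA' u v w + hB' u v w
  smul_mem' := by
    rintro c A ⟨hA, hA'⟩
    refine ⟨fun u v => ?_, fun u v w => ?_⟩
    · simp only [smul_apply, real_inner_smul_left, real_inner_smul_right, hA]
      ring
    · simp only [smul_apply, phi0_smul₁, phi0_smul₂, phi0_smul₃]
      linear_combination c * hA' u v w
  lie_mem' := by
    rintro A B ⟨hA, hA'⟩ ⟨hB, hB'⟩
    refine ⟨fun u v => ?_, fun u v w => ?_⟩
    · simp only [Ring.lie_def, sub_apply, mul_apply_eq_comp,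
        inner_sub_left, inner_sub_right, hA, hB]
      ring
    · simp only [Ring.lie_def, sub_apply, mul_apply_eq_comp,
        phi0_sub₁, phi0_sub₂, phi0_sub₃]
      linear_combination hA' (B u) v w + hA' u (B v) w + hA' u v (B w)
        - hB' (A u) v w - hB' u (A v) w - hB' u v (A w)

/-- The subalgebra `𝔰𝔲(3) ⊂ 𝔤₂`: the stabilizer in `𝔤₂` of `e₇`; it acts on
`ℝ⁷ = ℂ³ ⊕ ℝ e₇` and is the stabilizer of the two spinors `ψ₁` and `ψ₂ = ± e₇ · ψ₁`. -/
def su3 : LieSubalgebra ℝ (E7 →L[ℝ] E7) where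
  carrier := {A | A ∈ g2 ∧ A (stdVec 6) = 0}
  zero_mem' := ⟨g2.zero_mem, rfl⟩
  add_mem' := by
    rintro A B ⟨hA, hA'⟩ ⟨hB, hB'⟩
    exact ⟨g2.add_mem hA hB, by simp [hA', hB']⟩
  smul_mem' := by
    rintro c A ⟨hA, hA'⟩
    exact ⟨g2.smul_mem c hA, by simp [hA']⟩
  lie_mem' := by
    rintro A B ⟨hA, hA'⟩ ⟨hB, hB'⟩
    exact ⟨g2.lie_mem hA hB, by
      simp [Ring.lie_def, hA', hB']⟩

/-- The 2-form `eᵢ ∧ eⱼ` as a skew-symmetric endomorphism, `u ↦ uᵢ eⱼ - uⱼ eᵢ`. -/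
def wedge (i j : Fin 7) : E7 →L[ℝ] E7 :=
  (EuclideanSpace.proj i : E7 →L[ℝ] ℝ).smulRight (stdVec j) -
    (EuclideanSpace.proj j : E7 →L[ℝ] ℝ).smulRight (stdVec i)

/-- The subalgebra `𝔰𝔲(2) ⊂ 𝔰𝔲(3) ⊂ 𝔤₂` generated by `P₁ = e₁₃ + e₂₄`, `P₂ = e₁₄ - e₂₃` and
`P₃ = e₁₂ - e₃₄`; it acts on `ℝ⁷ = ℂ² ⊕ ℝ ⊕ ℝ ⊕ ℝ`. -/
def su2 : LieSubalgebra ℝ (E7 →L[ℝ] E7) :=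
  LieSubalgebra.lieSpan ℝ _
    {wedge 0 2 + wedge 1 3, wedge 0 3 - wedge 1 2, wedge 0 1 - wedge 2 3}

/-- `h` is a subalgebra `𝔰𝔬_ir(3) ⊂ 𝔤₂`: it is isomorphic to `𝔰𝔬(3)` and acts irreducibly
on `ℝ⁷`. -/
structure IsSoIr3 (h : LieSubalgebra ℝ (E7 →L[ℝ] E7)) : Prop where
  le_g2 : h ≤ g2
  iso : Nonempty (h ≃ₗ⁅ℝ⁆ LieAlgebra.Orthogonal.so (Fin 3) ℝ)
  irreducible : ∀ W : Submodule ℝ E7, (∀ A ∈ h, ∀ w ∈ W, A w ∈ W) → W = ⊥ ∨ W = ⊤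

/-! ### `G₂`-structures, connections and holonomy -/

section Manifold

variable {M : Type*} [TopologicalSpace M] [ChartedSpace (EuclideanSpace ℝ (Fin 7)) M]

/-- A field of 3-forms (no regularity). -/
abbrev ThreeFormField (M : Type*) [TopologicalSpace M] [ChartedSpace (EuclideanSpace ℝ (Fin 7)) M] : Type _ :=
  (x : M) → (TangentSpace (𝓡 7) x) [⋀^Fin 3]→L[ℝ] ℝ

/-- A field of real-valued functions of three tangent vectors, used for covariant 3-tensors. -/
abbrev ThreeTensorField (M : Type*) [TopologicalSpace M] [ChartedSpace (EuclideanSpace ℝ (Fin 7)) M] : Type _ :=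
  (x : M) → TangentSpace (𝓡 7) x → TangentSpace (𝓡 7) x → TangentSpace (𝓡 7) x → ℝ

/-- A field of 3-forms seen as a field of covariant 3-tensors. -/
def ThreeFormField.toTensor (φ : ThreeFormField M) : ThreeTensorField M :=
  fun x u v w => φ x ![u, v, w]

/-- Affine connections on `M`, i.e. covariant derivatives on the tangent bundle. Note Mathlib's
argument order: `cov Y x v` is `(∇_v Y)(x)`. -/
abbrev Connection (M : Type*) [TopologicalSpace M] [ChartedSpace (EuclideanSpace ℝ (Fin 7)) M] [IsManifold (𝓡 7) ∞ M] :
    Type _ :=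
  CovariantDerivative (𝓡 7) E7 (fun x : M => TangentSpace (𝓡 7) x)

variable [IsManifold (𝓡 7) ∞ M]

/-- The vector field `X` is differentiable at `x`. -/
def DiffFieldAt (X : (y : M) → TangentSpace (𝓡 7) y) (x : M) : Prop :=
  MDifferentiableAt (𝓡 7) (𝓡 7).tangent
    (fun y => TotalSpace.mk' E7 (E := fun y : M => TangentSpace (𝓡 7) y) y (X y)) x

/-- The vector field `X` is smooth near `x`. -/
def SmoothFieldAt (X : (y : M) → TangentSpace (𝓡 7) y) (x : M) : Prop :=
  ContMDiffAt (𝓡 7) (𝓡 7).tangent ∞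
    (fun y => TotalSpace.mk' E7 (E := fun y : M => TangentSpace (𝓡 7) y) y (X y)) x

/-- The covariant 3-tensor `S` is parallel, `∇S = 0`: for vector fields `X, Y, Z`
differentiable at `x` and `v ∈ T_xM`,
`v(S(X, Y, Z)) = S(∇_v X, Y, Z) + S(X, ∇_v Y, Z) + S(X, Y, ∇_v Z)`. -/
def IsParallelTensor (cov : Connection M) (S : ThreeTensorField M) : Prop :=
  ∀ (x : M) (X Y Z : (y : M) → TangentSpace (𝓡 7) y),
    DiffFieldAt X x → DiffFieldAt Y x → DiffFieldAt Z x →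
    ∀ v : TangentSpace (𝓡 7) x,
      mvfderiv (𝓡 7) (fun y => S y (X y) (Y y) (Z y)) x v =
        S x (cov X x v) (Y x) (Z x) + S x (X x) (cov Y x v) (Z x) + S x (X x) (Y x) (cov Z x v)

/-- `HasCovDerivAlong cov γ V t w`: the covariant derivative along the curve `γ` of the vector
field `V` along `γ` exists at time `t` and equals `w`. Writing `V(s) = ∑ fᵢ(s) σᵢ(γ(s))` near
`t` with vector fields `σᵢ` smooth near `γ(t)`, it is
`∑ (fᵢ'(t) σᵢ(γ(t)) + fᵢ(t) (∇_{γ'(t)} σᵢ)(γ(t)))`. -/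
def HasCovDerivAlong (cov : Connection M) (γ : ℝ → M)
    (V : (t : ℝ) → TangentSpace (𝓡 7) (γ t)) (t : ℝ) (w : TangentSpace (𝓡 7) (γ t)) : Prop :=
  ∃ (n : ℕ) (σ : Fin n → (x : M) → TangentSpace (𝓡 7) x) (f : Fin n → ℝ → ℝ) (f' : Fin n → ℝ),
    (∀ i, SmoothFieldAt (σ i) (γ t)) ∧
    (∀ i, HasDerivAt (f i) (f' i) t) ∧
    (∀ᶠ s in nhds t, V s = ∑ i, f i s • σ i (γ s)) ∧
    w = ∑ i, (f' i • σ i (γ t) +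
      f i t • cov (σ i) (γ t) (mfderiv 𝓘(ℝ, ℝ) (𝓡 7) γ t (1 : ℝ)))

/-- `P : T_pM → T_qM` is the parallel transport of `∇` along some piecewise `C¹` curve from
`p` to `q`, i.e. along a concatenation of finitely many `C¹` curves `γ : [0, 1] → M` (which are
given as `C¹` curves on `ℝ`). -/
inductive IsParallelTransport (cov : Connection M) :
    (p q : M) → (TangentSpace (𝓡 7) p →L[ℝ] TangentSpace (𝓡 7) q) → Prop
  | refl (p : M) : IsParallelTransport cov p p (ContinuousLinearMap.id ℝ _)
  | step (p : M) (γ : ℝ → M) (hγ : ContMDiff 𝓘(ℝ, ℝ) (𝓡 7) 1 γ)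
      (Q : TangentSpace (𝓡 7) p →L[ℝ] TangentSpace (𝓡 7) (γ 0))
      (hQ : IsParallelTransport cov p (γ 0) Q)
      (P : TangentSpace (𝓡 7) (γ 0) →L[ℝ] TangentSpace (𝓡 7) (γ 1))
      (hP : ∀ v : TangentSpace (𝓡 7) (γ 0), ∃ V : (t : ℝ) → TangentSpace (𝓡 7) (γ t),
        V 0 = v ∧ V 1 = P v ∧ ∀ t ∈ Set.Icc (0 : ℝ) 1, HasCovDerivAlong cov γ V t 0) :
      IsParallelTransport cov p (γ 1) (P ∘L Q)

/-- The holonomy group of `∇` at `p`: parallel transports along piecewise `C¹` loops at `p`. -/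
def holonomyGroup (cov : Connection M) (p : M) :
    Set (TangentSpace (𝓡 7) p →L[ℝ] TangentSpace (𝓡 7) p) :=
  {P | IsParallelTransport cov p p P}

variable [RiemannianBundle (fun x : M => TangentSpace (𝓡 7) x)]

/-- The holonomy algebra `𝔥𝔬𝔩_p(∇)`: the Lie algebra of the holonomy group at `p`, i.e. the set
of velocities at the identity of `C¹` curves of endomorphisms of `T_pM` which run inside the
holonomy group. -/
def holonomyAlgebra (cov : Connection M) (p : M) :
    Set (TangentSpace (𝓡 7) p →L[ℝ] TangentSpace (𝓡 7) p) :=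
  {A | ∃ c : ℝ → (TangentSpace (𝓡 7) p →L[ℝ] TangentSpace (𝓡 7) p),
    ContDiff ℝ 1 c ∧ c 0 = ContinuousLinearMap.id ℝ _ ∧ (∀ t, c t ∈ holonomyGroup cov p) ∧
    HasDerivAt c A 0}

/-- An adapted frame at `x`: a linear isometry `ℝ⁷ ≃ T_xM` which pulls `φ` back to `φ₀`. -/
def IsAdaptedFrame (φ : ThreeFormField M) (x : M) (b : E7 ≃ₗᵢ[ℝ] TangentSpace (𝓡 7) x) : Prop :=
  ∀ u v w : E7, φ x ![b u, b v, b w] = phi0 u v w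

/-- `φ` is a (smooth) `G₂`-structure compatible with the Riemannian metric of `M`. -/
structure IsG2Structure (φ : ThreeFormField M) : Prop where
  smooth : ∀ (x : M) (X Y Z : (y : M) → TangentSpace (𝓡 7) y),
    SmoothFieldAt X x → SmoothFieldAt Y x → SmoothFieldAt Z x →
    ContMDiffAt (𝓡 7) 𝓘(ℝ, ℝ) ∞ (fun y => φ y ![X y, Y y, Z y]) x
  exists_frame : ∀ x : M, ∃ b : E7 ≃ₗᵢ[ℝ] TangentSpace (𝓡 7) x, IsAdaptedFrame φ x b

/-- The holonomy algebra of `∇` is `h ⊂ 𝔤₂`: in some adapted frame at some point of `M`, the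
endomorphisms belonging to the holonomy algebra are exactly those in `h`. (On a connected
manifold it does not matter at which point.) -/
def HasHolonomyAlgebra (φ : ThreeFormField M) (cov : Connection M)
    (h : LieSubalgebra ℝ (E7 →L[ℝ] E7)) : Prop :=
  ∃ (p : M) (b : E7 ≃ₗᵢ[ℝ] TangentSpace (𝓡 7) p), IsAdaptedFrame φ p b ∧
    ∀ A : TangentSpace (𝓡 7) p →L[ℝ] TangentSpace (𝓡 7) p,
      A ∈ holonomyAlgebra cov p ↔
        (b.symm.toContinuousLinearEquiv : TangentSpace (𝓡 7) p →L[ℝ] E7) ∘L A ∘L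
          (b.toContinuousLinearEquiv : E7 →L[ℝ] TangentSpace (𝓡 7) p) ∈ h

/-- The torsion of `∇` as a covariant 3-tensor, `T(X, Y, Z) = g(∇_X Y - ∇_Y X - [X, Y], Z)`. -/
def torsionTensor (cov : Connection M) : ThreeTensorField M :=
  fun x u v w => inner ℝ (cov.torsion x u v) w

/-- The characteristic torsion lies in `Λ³₂₇` at every point. -/
def TorsionInLambda27 (φ : ThreeFormField M) (cov : Connection M) : Prop :=
  ∀ (x : M) (b : E7 ≃ₗᵢ[ℝ] TangentSpace (𝓡 7) x), IsAdaptedFrame φ x b →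
    InLambda27 (fun u v w => torsionTensor cov x (b u) (b v) (b w))

variable [IsContMDiffRiemannianBundle (𝓡 7) ∞ E7 (fun x : M => TangentSpace (𝓡 7) x)]

/-- The smooth Riemannian metric is in particular of class `C¹`. -/
instance instRiemannianBundleOne :
    IsContMDiffRiemannianBundle (𝓡 7) 1 E7 (fun x : M => TangentSpace (𝓡 7) x) :=
  IsContMDiffRiemannianBundle.of_le (n := ∞) (by simp)

/-- `∇` is the characteristic connection of the `G₂`-structure: a smooth connection preserving
the metric and `φ`, with totally skew-symmetric torsion. -/
structure IsCharacteristicConnection (φ : ThreeFormField M) (cov : Connection M) : Prop where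
  smooth : CovariantDerivative.ContMDiffCovariantDerivative cov ∞
  metric : cov.IsMetricCompatible
  parallel : IsParallelTensor cov φ.toTensor
  skew : ∀ (x : M) (u v w : TangentSpace (𝓡 7) x),
    torsionTensor cov x u v w = - torsionTensor cov x v u w ∧
    torsionTensor cov x u v w = - torsionTensor cov x u w v

/-- `∇` is the Levi-Civita connection of the Riemannian metric. -/
structure IsLeviCivita (cov : Connection M) : Prop where
  smooth : CovariantDerivative.ContMDiffCovariantDerivative cov ∞
  metric : cov.IsMetricCompatible
  torsionFree : cov.torsion = 0

/-- The `G₂`-structure is parallel: `φ` is parallel for the Levi-Civita connection. -/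
def IsParallelG2Structure (φ : ThreeFormField M) : Prop :=
  ∃ covg : Connection M, IsLeviCivita covg ∧ IsParallelTensor covg φ.toTensor

end Manifold

end G2Torsion

end

/-! The characteristic torsion T is parallel, so parallel transport preserves it. Differentiating
along curves in the holonomy group at a point p shows that T at p is annihilated by the holonomy
algebra (`torsionTensor_holonomyAlgebra`). Algebra then forces T = 0 at p, in each of the three
cases. Parallelism and connectedness give T = 0 everywhere (`torsionTensor_eq_zero_of_point`), so
the characteristic connection is torsion-free and metric, hence Levi-Civita, and it preserves φ.

In the irreducible case, contraction with φ₀ over two indices maps 3-forms equivariantly to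
symmetric matrices. An invariant form gives a symmetric matrix commuting with an irreducible
algebra, that is, a scalar. On Λ³₂₇ the contraction is trace-free and injective, so the form
vanishes (`comp_eq_zero_of_irreducible`).

For 𝔰𝔲(2) and 𝔰𝔲(3) invariance alone does not suffice: it leaves a family of forms in Λ³₂₇ with six
parameters, respectively one. But these algebras annihilate some vector e, and this yields the
quadratic identity that the cyclic sum of T(T(u,v),w,e) vanishes (`bianchi`). On the remaining
family suitable components of this identity are definite, so all parameters are zero
(`comp_eq_zero_of_su2`, `comp_eq_zero_of_su3`).

The identity is the first Bianchi identity with the curvature term killed by e. Here it is obtained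
without curvature: e extends to a local parallel field X, the dual 1-form of X has differential
T(·,·,X), and d² = 0 together with ∇T = 0 gives the claim (`bianchi_frame`).

The extension needs trivial transport of e around small loops. The holonomy algebra consists of
velocities of C¹ curves in the holonomy group, and a vector killed by all of them is fixed along any
such curve that starts at the identity and has a C¹ inverse in the group (`apply_eq_of_velocities`).
Shrinking a triangle in a chart to its vertex gives such a curve (`LocalTransport.triangle`), so
radial transport of e agrees with transport along every short segment and defines a parallel field.
For this, transport must depend in a C¹ way on the segment. The transport equation is therefore
solved by inverting 1 minus a Volterra operator on continuous functions on [0, 1], inversion being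
smooth on the units of a Banach algebra. -/

noncomputable section

namespace G2Torsion

/-! ### Smooth dependence of the solution of y = x + V A y on A. -/

section InverseOneSub

variable {X Y : Type*} [NormedAddCommGroup X] [NormedSpace ℝ X] [NormedAddCommGroup Y]
  [NormedSpace ℝ Y]

/-- `1 - V A` is invertible, for a linear family `V` of bounded operators. -/
def OneSubInvertible (V : Y →L[ℝ] X →L[ℝ] X) (A : Y) : Prop := IsUnit (1 - V A)

/-- The solution `y` of `y = x + V A y`. -/
def inverseOneSub (V : Y →L[ℝ] X →L[ℝ] X) (x : X) (A : Y) : X := Ring.inverse (1 - V A) x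

variable (V : Y →L[ℝ] X →L[ℝ] X) (x : X)

variable {V} in
theorem OneSubInvertible.inverseOneSub_eq {A : Y} (hA : OneSubInvertible V A) :
    inverseOneSub V x A = x + V A (inverseOneSub V x A) := by
  have h := congrArg (fun L : X →L[ℝ] X => L x) (Ring.mul_inverse_cancel _ hA)
  have h2 : inverseOneSub V x A - V A (inverseOneSub V x A) = x := h
  nth_rewrite 2 [← h2]; abel

theorem inverseOneSub_zero : inverseOneSub V x 0 = x := by
  simp [inverseOneSub]

theorem oneSubInvertible_zero : OneSubInvertible V 0 := by
  simp [OneSubInvertible]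

theorem isOpen_oneSubInvertible [CompleteSpace X] : IsOpen {A | OneSubInvertible V A} :=
  Units.isOpen.preimage (continuous_const.sub V.continuous)

variable {V} in
theorem OneSubInvertible.contDiffAt [CompleteSpace X] {A : Y} (hA : OneSubInvertible V A)
    {n : WithTop ℕ∞} : ContDiffAt ℝ n (inverseOneSub V x) A := by
  obtain ⟨u, hu⟩ := hA
  have h1 : ContDiffAt ℝ n (fun A => Ring.inverse (1 - V A)) A := by
    refine ContDiffAt.comp A (g := Ring.inverse) ?_ (contDiffAt_const.sub V.contDiff.contDiffAt)
    rw [← hu]; exact contDiffAt_ringInverse ℝ u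
  exact h1.clm_apply contDiffAt_const

/-- Differentiate the fixed-point equation y(A) = x + V A y(A) at A = 0: the factor V 0 kills the
derivative of y, and only V · x remains. -/
theorem hasFDerivAt_inverseOneSub_zero [CompleteSpace X] :
    HasFDerivAt (inverseOneSub V x) (V.flip x) 0 := by
  have h1 : DifferentiableAt ℝ (inverseOneSub V x) 0 :=
    ((oneSubInvertible_zero V).contDiffAt x (n := 1)).differentiableAt one_ne_zero
  have h2 := (V.hasFDerivAt.clm_apply h1.hasFDerivAt).const_add x
  rw [map_zero, ContinuousLinearMap.zero_comp, zero_add, inverseOneSub_zero] at h2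
  refine h2.congr_of_eventuallyEq ?_
  filter_upwards [(isOpen_oneSubInvertible V).mem_nhds (oneSubInvertible_zero V)] with A hA
  exact hA.inverseOneSub_eq x

end InverseOneSub

/-! ### Linear differential equations on the unit interval by the Volterra operator. -/

section LinearODE

open unitInterval

variable {F : Type*} [NormedAddCommGroup F]

/-- Extension of a function on the unit interval to the line, constant outside the interval. -/
def extendUnit (f : C(I, F)) (t : ℝ) : F := f (Set.projIcc 0 1 zero_le_one t)

theorem continuous_extendUnit (f : C(I, F)) : Continuous (extendUnit f) :=
  f.continuous.comp continuous_projIcc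

theorem extendUnit_of_mem (f : C(I, F)) {t : ℝ} (ht : t ∈ Set.Icc (0 : ℝ) 1) :
    extendUnit f t = f ⟨t, ht⟩ := by
  simp [extendUnit, Set.projIcc_of_mem zero_le_one ht]

theorem norm_extendUnit_le (f : C(I, F)) (t : ℝ) : ‖extendUnit f t‖ ≤ ‖f‖ :=
  f.norm_coe_le_norm _

variable [NormedSpace ℝ F]

/-- The primitive of `f` vanishing at `0`, as a function on the line. -/
def primitive (f : C(I, F)) (t : ℝ) : F := ∫ s in (0 : ℝ)..t, extendUnit f s

theorem hasDerivAt_primitive [CompleteSpace F] (f : C(I, F)) (t : ℝ) :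
    HasDerivAt (primitive f) (extendUnit f t) t :=
  (continuous_extendUnit f).integral_hasStrictDerivAt 0 t |>.hasDerivAt

/-- Integration from `0` on continuous functions on the unit interval. -/
def integOp [CompleteSpace F] : C(I, F) →L[ℝ] C(I, F) :=
  LinearMap.mkContinuous
    { toFun := fun f => ⟨fun t => primitive f t, by
        have : Continuous (primitive f) :=
          continuous_iff_continuousAt.2 fun t => (hasDerivAt_primitive f t).continuousAt
        exact this.comp continuous_subtype_val⟩
      map_add' := fun f g => by
        ext t
        exact intervalIntegral.integral_add ((continuous_extendUnit f).intervalIntegrable _ _)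
          ((continuous_extendUnit g).intervalIntegrable _ _)
      map_smul' := fun c f => by
        ext t
        exact intervalIntegral.integral_smul c (extendUnit f) }
    1 fun f => by
      rw [one_mul]
      refine (ContinuousMap.norm_le _ (norm_nonneg f)).2 fun t => ?_
      refine (intervalIntegral.norm_integral_le_of_norm_le_const
        fun s _ => norm_extendUnit_le f s).trans ?_
      have h0 := t.2.1
      have h1 := t.2.2
      rw [sub_zero, abs_of_nonneg h0]
      exact mul_le_of_le_one_right (norm_nonneg f) h1

variable {𝔸 : Type*} [NormedRing 𝔸] [NormedAlgebra ℝ 𝔸] [CompleteSpace 𝔸]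

/-- The Volterra operator `f ↦ ∫₀ᵗ A f`, depending linearly on `A`. -/
def volterra : C(I, 𝔸) →L[ℝ] C(I, 𝔸) →L[ℝ] C(I, 𝔸) :=
  (ContinuousLinearMap.compL ℝ C(I, 𝔸) C(I, 𝔸) C(I, 𝔸) integOp) ∘L
    ContinuousLinearMap.mul ℝ C(I, 𝔸)

theorem volterra_apply (A f : C(I, 𝔸)) : volterra A f = integOp (A * f) := rfl

/-- The solution of `Φ' = A Φ`, `Φ(0) = 1` (for small `A`). -/
def odeSol (A : C(I, 𝔸)) : C(I, 𝔸) := inverseOneSub volterra 1 A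

/-- The solution extended to the line. -/
def odeSolExt (A : C(I, 𝔸)) (t : ℝ) : 𝔸 := 1 + primitive (A * odeSol A) t

theorem odeSolExt_zero (A : C(I, 𝔸)) : odeSolExt A 0 = 1 := by
  simp [odeSolExt, primitive]

theorem odeSolExt_coe {A : C(I, 𝔸)} (hA : OneSubInvertible volterra A) (t : I) :
    odeSolExt A t = odeSol A t :=
  (congrArg (fun f : C(I, 𝔸) => f t) (hA.inverseOneSub_eq 1)).symm

/-- The solution is extended to the line so that the derivative is two-sided at the endpoints too,
as covariant derivatives along curves require. -/
theorem hasDerivAt_odeSolExt {A : C(I, 𝔸)} (hA : OneSubInvertible volterra A) {t : ℝ}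
    (ht : t ∈ Set.Icc (0 : ℝ) 1) :
    HasDerivAt (odeSolExt A) (A ⟨t, ht⟩ * odeSolExt A t) t := by
  have h := (hasDerivAt_primitive (A * odeSol A) t).const_add 1
  rw [extendUnit_of_mem _ ht, ContinuousMap.mul_apply, ← odeSolExt_coe hA] at h
  exact h

theorem odeSol_zero : odeSol (0 : C(I, 𝔸)) = 1 := inverseOneSub_zero _ _

theorem hasFDerivAt_odeSol_zero :
    HasFDerivAt (odeSol (𝔸 := 𝔸)) (integOp : C(I, 𝔸) →L[ℝ] C(I, 𝔸)) 0 := by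
  refine (hasFDerivAt_inverseOneSub_zero (volterra (𝔸 := 𝔸)) 1).congr_fderiv ?_
  ext f : 1
  rw [ContinuousLinearMap.flip_apply, volterra_apply, mul_one]

end LinearODE

/-! ### Parameter dependence of functions on the unit interval in the sup norm. -/

section Curry

set_option synthInstance.maxHeartbeats 200000

open unitInterval

variable {Z F : Type*} [NormedAddCommGroup Z] [NormedSpace ℝ Z]
  [NormedAddCommGroup F] [NormedSpace ℝ F]

/-- A continuous family of linear maps, as a linear map into continuous functions. -/
def clmOfContinuousMap : C(I, Z →L[ℝ] F) →L[ℝ] Z →L[ℝ] C(I, F) :=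
  LinearMap.mkContinuous₂
    (LinearMap.mk₂ ℝ (fun (k : C(I, Z →L[ℝ] F)) (z : Z) =>
        (⟨fun t => k t z, by fun_prop⟩ : C(I, F)))
      (fun _ _ _ => by ext; simp) (fun _ _ _ => by ext; simp)
      (fun _ _ _ => by ext; simp) (fun _ _ _ => by ext; simp)) 1
    fun k z => by
      rw [one_mul]
      refine (ContinuousMap.norm_le _ (by positivity)).2 fun t => ?_
      exact (k t).le_of_opNorm_le (k.norm_coe_le_norm t) z

/-- The currying of K' is continuous into the sup norm, so K' varies by less than ε near z uniformly
in t. The mean value inequality then bounds the remainder uniformly in t. -/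
theorem hasFDerivAt_curry (K : C(Z × I, F)) (K' : C(Z × I, Z →L[ℝ] F))
    (h : ∀ z t, HasFDerivAt (fun z => K (z, t)) (K' (z, t)) z) (z : Z) :
    HasFDerivAt (fun z => K.curry z) (clmOfContinuousMap (K'.curry z)) z := by
  rw [hasFDerivAt_iff_isLittleO, Asymptotics.isLittleO_iff]
  intro ε hε
  obtain ⟨δ, hδ, hball⟩ := (Metric.continuousAt_iff (α := Z) (β := C(I, Z →L[ℝ] F))
    (f := K'.curry) (a := z)).1 K'.curry.continuous.continuousAt ε hε
  filter_upwards [Metric.ball_mem_nhds z hδ] with y hy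
  refine (ContinuousMap.norm_le _ (by positivity)).2 fun t => ?_
  refine (convex_ball z δ).norm_image_sub_le_of_norm_hasFDerivWithin_le'
    (f := fun z => K (z, t)) (f' := fun z => K' (z, t)) (φ := K' (z, t))
    (fun x _ => (h x t).hasFDerivWithinAt) (fun x hx => ?_) (Metric.mem_ball_self hδ) hy
  have h1 := (ContinuousMap.dist_apply_le_dist (f := K'.curry x) (g := K'.curry z) t).trans
    (hball hx).le
  rwa [dist_eq_norm] at h1

theorem contDiff_one_curry (K : C(Z × I, F)) (K' : C(Z × I, Z →L[ℝ] F))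
    (h : ∀ z t, HasFDerivAt (fun z => K (z, t)) (K' (z, t)) z) :
    ContDiff ℝ 1 (fun z => K.curry z) := by
  rw [contDiff_one_iff_fderiv]
  refine ⟨fun z => (hasFDerivAt_curry K K' h z).differentiableAt, ?_⟩
  rw [funext fun z => (hasFDerivAt_curry K K' h z).fderiv]
  exact clmOfContinuousMap.continuous.comp K'.curry.continuous

end Curry

end G2Torsion

end

noncomputable section

namespace G2Torsion

/-! ### Transport along segments in a vector space with a matrix-valued 1-form. -/

section Segment

open unitInterval

variable {Z F : Type*} [NormedAddCommGroup Z] [NormedSpace ℝ Z]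
  [NormedAddCommGroup F] [NormedSpace ℝ F]

/-- A `C¹` function of a parameter and a real variable, restricted to the unit interval. -/
def curryUnit (G : Z × ℝ → F) (hG : ContDiff ℝ 1 G) (z : Z) : C(I, F) :=
  ⟨fun t => G (z, t), hG.continuous.comp (by fun_prop)⟩

theorem contDiff_curryUnit {G : Z × ℝ → F} (hG : ContDiff ℝ 1 G) :
    ContDiff ℝ 1 (curryUnit G hG) := by
  have hc : Continuous fun p : Z × I => (p.1, (p.2 : ℝ)) := by fun_prop
  refine contDiff_one_curry (⟨fun p : Z × I => G (p.1, (p.2 : ℝ)), hG.continuous.comp hc⟩)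
    (⟨fun p : Z × I => (fderiv ℝ G (p.1, (p.2 : ℝ))).comp (ContinuousLinearMap.inl ℝ Z ℝ), ?_⟩)
    fun z t => ?_
  · exact ((hG.continuous_fderiv one_ne_zero).comp hc).clm_comp continuous_const
  · exact ((hG.differentiable one_ne_zero) (z, (t : ℝ))).hasFDerivAt.comp z
      (hasFDerivAt_prodMk_left (𝕜 := ℝ) z (t : ℝ))

/-- Segments are parametrized by `Real.smoothTransition`, which is constant outside [0, 1]: the
curves are then defined on all of ℝ without leaving the segment. The speed enters the equation as a
coefficient and must itself be C¹. -/
theorem contDiff_deriv_smoothTransition : ContDiff ℝ 1 (deriv Real.smoothTransition) :=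
  (Real.smoothTransition.contDiff (n := 2)).deriv' (n := 1)

variable {E 𝔸 : Type*} [NormedAddCommGroup E] [NormedSpace ℝ E] [NormedRing 𝔸]
  [NormedAlgebra ℝ 𝔸]

/-- The connection form `a` along the segment from `x` to `x + v`. -/
def segForm (a : E → E →L[ℝ] 𝔸) (p : (E × E) × ℝ) : 𝔸 :=
  deriv Real.smoothTransition p.2 • a (p.1.1 + Real.smoothTransition p.2 • p.1.2) p.1.2

theorem contDiff_segForm {a : E → E →L[ℝ] 𝔸} (ha : ContDiff ℝ 1 a) :
    ContDiff ℝ 1 (segForm a) := by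
  have h1 : ContDiff ℝ 1 Real.smoothTransition := Real.smoothTransition.contDiff (n := 1)
  have h2 : ContDiff ℝ 1 fun p : (E × E) × ℝ =>
      a (p.1.1 + Real.smoothTransition p.2 • p.1.2) := ha.comp (by fun_prop)
  exact (contDiff_deriv_smoothTransition.comp contDiff_snd).smul
    (h2.clm_apply (by fun_prop))

variable {a : E → E →L[ℝ] 𝔸} (ha : ContDiff ℝ 1 a)

theorem curryUnit_segForm_zero (x : E) :
    curryUnit (segForm a) (contDiff_segForm ha) (x, 0) = 0 := by
  ext t
  simp [curryUnit, segForm]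

variable [CompleteSpace 𝔸]

/-- Transport along the segment from `x` to `x + v` for the equation `Φ' = a(c') Φ`. -/
def segTransport (z : E × E) : 𝔸 :=
  odeSol (curryUnit (segForm a) (contDiff_segForm ha) z) 1

/-- The segment is short enough for the transport to be given by the Neumann series. -/
def ShortSegment (z : E × E) : Prop :=
  OneSubInvertible volterra (curryUnit (segForm a) (contDiff_segForm ha) z)

theorem segTransport_zero (x : E) : segTransport ha (x, 0) = 1 := by
  rw [segTransport, curryUnit_segForm_zero ha, odeSol_zero]; rfl

theorem shortSegment_zero (x : E) : ShortSegment ha (x, 0) := by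
  rw [ShortSegment, curryUnit_segForm_zero ha]; exact oneSubInvertible_zero _

theorem isOpen_shortSegment : IsOpen {z | ShortSegment ha z} :=
  (isOpen_oneSubInvertible (volterra (𝔸 := 𝔸))).preimage
    (contDiff_curryUnit (contDiff_segForm ha)).continuous

variable {ha} in
theorem ShortSegment.contDiffAt {z : E × E} (hz : ShortSegment ha z) :
    ContDiffAt ℝ 1 (segTransport ha) z := by
  have h1 : ContDiffAt ℝ 1
      (fun z => odeSol (curryUnit (segForm a) (contDiff_segForm ha) z)) z :=
    ContDiffAt.comp z (OneSubInvertible.contDiffAt 1 hz) (contDiff_curryUnit (contDiff_segForm ha)).contDiffAt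
  exact (ContinuousMap.evalCLM ℝ (1 : I) : C(I, 𝔸) →L[ℝ] 𝔸).contDiff.contDiffAt.comp z h1

theorem exists_short_radius (x₀ : E) : ∃ r > 0, ∀ x v, ‖x - x₀‖ < r → ‖v‖ < r →
    ShortSegment ha (x, v) ∧ IsUnit (segTransport ha (x, v)) := by
  have h1 : ∀ᶠ z in nhds (x₀, (0 : E)), ShortSegment ha z :=
    (isOpen_shortSegment ha).mem_nhds (shortSegment_zero ha x₀)
  have h2 : ∀ᶠ z in nhds (x₀, (0 : E)), IsUnit (segTransport ha z) := by
    have hc := (shortSegment_zero ha x₀).contDiffAt.continuousAt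
    refine hc.eventually ?_
    rw [segTransport_zero]
    exact Units.isOpen.mem_nhds isUnit_one
  obtain ⟨r, hr, h⟩ := Metric.eventually_nhds_iff.1 (h1.and h2)
  refine ⟨r, hr, fun x v hx hv => h ?_⟩
  rw [Prod.dist_eq, dist_eq_norm, dist_eq_norm, sub_zero]
  exact max_lt hx hv

variable {ha} in
/-- The transport is the time-one value of a solution of the linear equation. -/
theorem ShortSegment.exists_solution {x v : E} (hz : ShortSegment ha (x, v)) :
    ∃ Φ : ℝ → 𝔸, Φ 0 = 1 ∧ Φ 1 = segTransport ha (x, v) ∧ ∀ t ∈ Set.Icc (0 : ℝ) 1,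
      HasDerivAt Φ (a (x + Real.smoothTransition t • v)
        (deriv Real.smoothTransition t • v) * Φ t) t := by
  refine ⟨odeSolExt (curryUnit (segForm a) (contDiff_segForm ha) (x, v)), odeSolExt_zero _,
    odeSolExt_coe hz 1, fun t ht => ?_⟩
  rw [map_smul]
  exact hasDerivAt_odeSolExt hz ht

theorem integral_deriv_smoothTransition :
    ∫ s in (0 : ℝ)..1, deriv Real.smoothTransition s = 1 := by
  have hd : Differentiable ℝ Real.smoothTransition :=
    (Real.smoothTransition.contDiff (n := 1)).differentiable one_ne_zero
  rw [intervalIntegral.integral_deriv_eq_sub (fun x _ => hd x)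
    (contDiff_deriv_smoothTransition.continuous.intervalIntegrable _ _)]
  simp

/-- To first order at the zero coefficient, the solution of Φ' = AΦ at time 1 is 1 + ∫A. The
coefficient along a short segment v is to first order the speed times a(x) v, and the speed
integrates to 1. This is what recovers the connection from its transport. -/
theorem hasFDerivAt_segTransport (x : E) :
    HasFDerivAt (fun v => segTransport ha (x, v)) (a x) 0 := by
  set S : E × E → C(I, 𝔸) := curryUnit (segForm a) (contDiff_segForm ha) with hS
  have hS1 : Differentiable ℝ fun v => S (x, v) :=
    ((contDiff_curryUnit (contDiff_segForm ha)).comp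
      (contDiff_const.prodMk contDiff_id)).differentiable one_ne_zero
  set D := fderiv ℝ (fun v => S (x, v)) 0 with hD
  have hSD : HasFDerivAt (fun v => S (x, v)) D 0 := (hS1 0).hasFDerivAt
  -- The derivative D in the sup norm is known only abstractly; evaluation at t identifies it. The
  -- derivative of a drops out, because it is paired with the direction v = 0.
  have hDt : ∀ (t : I) (v : E), D v t = deriv Real.smoothTransition t • a x v := by
    intro t v
    have h1 : HasFDerivAt (fun v => S (x, v) t)
        ((ContinuousMap.evalCLM ℝ t : C(I, 𝔸) →L[ℝ] 𝔸).comp D) 0 :=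
      (ContinuousMap.evalCLM ℝ t : C(I, 𝔸) →L[ℝ] 𝔸).hasFDerivAt.comp 0 hSD
    have h2 : HasFDerivAt (fun v => S (x, v) t) (deriv Real.smoothTransition t • a x) 0 := by
      have h3 : HasFDerivAt (fun v : E => a (x + Real.smoothTransition t • v)) _ 0 :=
        (((ha.differentiable one_ne_zero).comp (by fun_prop :
          Differentiable ℝ fun v : E => x + Real.smoothTransition t • v)) 0).hasFDerivAt
      have h4 := (h3.clm_apply (hasFDerivAt_id (0 : E))).const_smul
        (deriv Real.smoothTransition (t : ℝ))
      refine h4.congr_fderiv ?_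
      ext w
      simp
    exact congrArg (fun L : E →L[ℝ] 𝔸 => L v) (h1.unique h2)
  have h0 : S (x, 0) = 0 := curryUnit_segForm_zero ha x
  have h5 : HasFDerivAt (fun v => odeSol (S (x, v))) (integOp.comp D) 0 := by
    have := hasFDerivAt_odeSol_zero (𝔸 := 𝔸)
    rw [← h0] at this
    exact this.comp 0 hSD
  have h6 := (ContinuousMap.evalCLM ℝ (1 : I) : C(I, 𝔸) →L[ℝ] 𝔸).hasFDerivAt.comp 0 h5
  refine h6.congr_fderiv ?_
  ext v
  change primitive (D v) ((1 : I) : ℝ) = a x v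
  rw [primitive, Set.Icc.coe_one]
  have : ∫ s in (0 : ℝ)..1, extendUnit (D v) s =
      ∫ s in (0 : ℝ)..1, deriv Real.smoothTransition s • a x v := by
    refine intervalIntegral.integral_congr fun s hs => ?_
    rw [Set.uIcc_of_le zero_le_one] at hs
    simp only [extendUnit_of_mem _ hs, hDt]
  rw [this, intervalIntegral.integral_smul_const, integral_deriv_smoothTransition, one_smul]

end Segment

end G2Torsion

end

noncomputable section

namespace G2Torsion

/-! ### Coordinate frames and the connection form in a chart. -/

section LocalFrame

variable {M : Type*} [TopologicalSpace M] [ChartedSpace (EuclideanSpace ℝ (Fin 7)) M]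
  [IsManifold (𝓡 7) ∞ M]

/-- The linear map sending coordinates in the chart at `q` to tangent vectors at `y`. -/
def coordVec (q y : M) : E7 →L[ℝ] TangentSpace (𝓡 7) y :=
  (trivializationAt E7 (fun x : M => TangentSpace (𝓡 7) x) q).symmL ℝ y

/-- The coordinates of a tangent vector at `y` in the chart at `q`. -/
def coordInv (q y : M) : TangentSpace (𝓡 7) y →L[ℝ] E7 :=
  (trivializationAt E7 (fun x : M => TangentSpace (𝓡 7) x) q).continuousLinearMapAt ℝ y

theorem coordInv_coordVec {q y : M} (hy : y ∈ (chartAt E7 q).source) (w : E7) :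
    coordInv q y (coordVec q y w) = w :=
  (trivializationAt E7 (fun x : M => TangentSpace (𝓡 7) x) q).continuousLinearMapAt_symmL
    (R := ℝ) (by simpa using hy) w

theorem coordVec_coordInv {q y : M} (hy : y ∈ (chartAt E7 q).source) (u : TangentSpace (𝓡 7) y) :
    coordVec q y (coordInv q y u) = u :=
  (trivializationAt E7 (fun x : M => TangentSpace (𝓡 7) x) q).symmL_continuousLinearMapAt
    (R := ℝ) (by simpa using hy) u

theorem contMDiffOn_coordVec (q : M) (w : E7) :
    ContMDiffOn (𝓡 7) (𝓡 7).tangent ∞ (fun y => TotalSpace.mk' E7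
      (E := fun y : M => TangentSpace (𝓡 7) y) y (coordVec q y w)) (chartAt E7 q).source := by
  set t := trivializationAt E7 (fun x : M => TangentSpace (𝓡 7) x) q with ht
  have hb : t.baseSet = (chartAt E7 q).source := by simp [ht]
  rw [← hb]
  refine (t.contMDiffOn_section_baseSet_iff (IB := 𝓡 7) (s := fun y => coordVec q y w)).2 ?_
  refine (contMDiffOn_const (c := w)).congr fun y hy => ?_
  have h := coordInv_coordVec (hb ▸ hy) w
  rw [coordInv, Trivialization.continuousLinearMapAt_apply, Trivialization.coe_linearMapAt_of_mem _ hy] at h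
  exact h

variable {q : M} (f : SmoothBumpFunction (𝓡 7) q)

/-- The coordinate vector fields of the chart at `q`, cut off to global fields. -/
def frameField (i : Fin 7) (y : M) : TangentSpace (𝓡 7) y := f y • coordVec q y (stdVec i)

theorem contMDiff_frameField [T2Space M] (i : Fin 7) :
    ContMDiff (𝓡 7) (𝓡 7).tangent ∞ (fun y => TotalSpace.mk' E7
      (E := fun y : M => TangentSpace (𝓡 7) y) y (frameField f i y)) :=
  ContMDiffOn.smul_section_of_tsupport (s := fun y => coordVec q y (stdVec i))
    f.contMDiff.contMDiffOn (chartAt E7 q).open_source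
    f.tsupport_subset_chartAt_source (contMDiffOn_coordVec q (stdVec i))

/-- The coefficients of a connection with respect to the frame fields. -/
def connCoeff (cov : Connection M) (i : Fin 7) (y : M) : E7 →L[ℝ] E7 :=
  coordInv q y ∘L cov (frameField f i) y ∘L coordVec q y

/-- The cut-off makes the frame field globally smooth, so the smooth connection turns it into a
smooth section of Hom(TM, TM), which is then read in the trivialization at q. -/
theorem contMDiffAt_connCoeff [T2Space M] {cov : Connection M}
    (hcov : CovariantDerivative.ContMDiffCovariantDerivative cov ∞) (i : Fin 7) :
    ContMDiffAt (𝓡 7) 𝓘(ℝ, E7 →L[ℝ] E7) ∞ (connCoeff f cov i) q := by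
  have h := (hcov.contMDiff.contMDiff (contMDiff_frameField f i).contMDiffOn).contMDiffAt
    (Filter.univ_mem (f := nhds q))
  exact ((contMDiffAt_hom_bundle _).1 h).2

/-- The connection form in the chart at `q`, with the sign of the transport equation. -/
def connForm (cov : Connection M) (x : E7) : E7 →L[ℝ] E7 →L[ℝ] E7 :=
  -∑ i : Fin 7, (ContinuousLinearMap.smulRightL ℝ E7 E7 (EuclideanSpace.proj i)) ∘L
    connCoeff f cov i ((extChartAt (𝓡 7) q).symm x)

theorem connForm_apply (cov : Connection M) (x v z : E7) :
    connForm f cov x v z =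
      -∑ i : Fin 7, z i • connCoeff f cov i ((extChartAt (𝓡 7) q).symm x) v := by
  simp [connForm]

theorem contDiffAt_connForm [T2Space M] {cov : Connection M}
    (hcov : CovariantDerivative.ContMDiffCovariantDerivative cov ∞) :
    ContDiffAt ℝ ∞ (connForm f cov) (extChartAt (𝓡 7) q q) := by
  refine (ContDiffAt.sum fun i _ => ?_).neg
  refine contDiffAt_const.clm_comp ?_
  have h1 : ContMDiffAt 𝓘(ℝ, E7) (𝓡 7) ∞ (extChartAt (𝓡 7) q).symm (extChartAt (𝓡 7) q q) :=
    (contMDiffOn_extChartAt_symm q).contMDiffAt (extChartAt_target_mem_nhds q)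
  have h2 : ContMDiffAt (𝓡 7) 𝓘(ℝ, E7 →L[ℝ] E7) ∞ (connCoeff f cov i)
      ((extChartAt (𝓡 7) q).symm (extChartAt (𝓡 7) q q)) := by
    rw [extChartAt_to_inv]
    exact contMDiffAt_connCoeff f hcov i
  exact contMDiffAt_iff_contDiffAt.1 (h2.comp _ h1)

/-- A point near which the frame fields are the coordinate fields. -/
def IsFramePoint (y : M) : Prop := y ∈ (chartAt E7 q).source ∧ f =ᶠ[nhds y] 1

omit [IsManifold (𝓡 7) ∞ M] in
theorem eventually_isFramePoint : ∀ᶠ y in nhds q, IsFramePoint f y :=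
  Filter.Eventually.and ((chartAt E7 q).open_source.mem_nhds (mem_chart_source E7 q))
    f.eventuallyEq_one.eventuallyEq_nhds

variable {f}

theorem IsFramePoint.frameField {y : M} (hy : IsFramePoint f y) (i : Fin 7) :
    frameField f i y = coordVec q y (stdVec i) := by
  rw [G2Torsion.frameField, hy.2.eq_of_nhds, Pi.one_apply, one_smul]

theorem sum_smul_stdVec (z : E7) : ∑ i, z i • stdVec i = z := by
  ext j
  simp [stdVec, Pi.single_apply]

theorem IsFramePoint.sum_smul {y : M} (hy : IsFramePoint f y) (z : E7) :
    ∑ i, z i • G2Torsion.frameField f i y = coordVec q y z := by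
  simp_rw [hy.frameField, ← map_smul, ← map_sum, sum_smul_stdVec]

/-- The connection form computes covariant derivatives of frame fields. -/
theorem IsFramePoint.sum_cov {x : E7} (hy : IsFramePoint f ((extChartAt (𝓡 7) q).symm x))
    (cov : Connection M) (u : TangentSpace (𝓡 7) ((extChartAt (𝓡 7) q).symm x)) (z : E7) :
    ∑ i, z i • cov (G2Torsion.frameField f i) ((extChartAt (𝓡 7) q).symm x) u =
      -coordVec q _ (connForm f cov x (coordInv q _ u) z) := by
  rw [connForm_apply, map_neg, neg_neg, map_sum]
  refine Finset.sum_congr rfl fun i _ => ?_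
  rw [map_smul, connCoeff]
  simp only [ContinuousLinearMap.comp_apply]
  rw [coordVec_coordInv hy.1, coordVec_coordInv hy.1]

end LocalFrame

end G2Torsion

end

noncomputable section

namespace G2Torsion

/-- A function smooth near a point agrees there with a globally `C¹` function. -/
theorem exists_contDiff_extension {E F : Type*} [NormedAddCommGroup E] [NormedSpace ℝ E]
    [FiniteDimensional ℝ E] [NormedAddCommGroup F] [NormedSpace ℝ F] {a : E → F} {x₀ : E}
    (ha : ContDiffAt ℝ ∞ a x₀) : ∃ b : E → F, ContDiff ℝ 1 b ∧ b =ᶠ[nhds x₀] a := by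
  have hev := (ha.of_le (m := 1) (by simp)).eventually (by simp)
  obtain ⟨ε, hε, hball⟩ := Metric.eventually_nhds_iff_ball.1 hev
  let χ : ContDiffBump x₀ := ⟨ε / 4, ε / 2, by positivity, by linarith⟩
  refine ⟨fun x => χ x • a x, ?_, ?_⟩
  · rw [contDiff_iff_contDiffAt]
    intro x
    by_cases hx : x ∈ Metric.ball x₀ ε
    · exact χ.contDiff.contDiffAt.smul (hball x hx)
    · have h0 : (fun x => χ x • a x) =ᶠ[nhds x] fun _ => 0 := by
        have hx' : x ∈ (Metric.closedBall x₀ (ε / 2))ᶜ := fun h =>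
          hx (Metric.closedBall_subset_ball (by linarith) h)
        filter_upwards [Metric.isClosed_closedBall.isOpen_compl.mem_nhds hx'] with y hy
        rw [χ.zero_of_le_dist (not_le.1 fun h => hy (Metric.mem_closedBall.2 h)).le, zero_smul]
      exact contDiffAt_const.congr_of_eventuallyEq h0
  · filter_upwards [χ.eventuallyEq_one] with x hx
    rw [hx, Pi.one_apply, one_smul]

/-! ### Derivatives, curves and vector fields read in a chart. -/

section Chart

variable {M : Type*} [TopologicalSpace M] [ChartedSpace (EuclideanSpace ℝ (Fin 7)) M]
  [IsManifold (𝓡 7) ∞ M] {q : M}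

theorem coordInv_eq_mfderiv {y : M} (hy : y ∈ (chartAt E7 q).source) :
    coordInv q y = mfderiv (𝓡 7) 𝓘(ℝ, E7) (extChartAt (𝓡 7) q) y :=
  TangentBundle.continuousLinearMapAt_trivializationAt hy

omit [IsManifold (𝓡 7) ∞ M] in
theorem symm_mem_source {x : E7} (hx : x ∈ (extChartAt (𝓡 7) q).target) :
    (extChartAt (𝓡 7) q).symm x ∈ (chartAt E7 q).source := by
  simpa using (extChartAt (𝓡 7) q).map_target hx

theorem hasMFDerivAt_chart_symm {x : E7} (hx : x ∈ (extChartAt (𝓡 7) q).target) :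
    HasMFDerivAt 𝓘(ℝ, E7) (𝓡 7) (extChartAt (𝓡 7) q).symm x
      (coordVec q ((extChartAt (𝓡 7) q).symm x)) := by
  have h := (mdifferentiableWithinAt_extChartAt_symm (I := 𝓡 7) hx).hasMFDerivWithinAt
  have h2 := TangentBundle.symmL_trivializationAt (I := 𝓡 7) (symm_mem_source hx)
  rw [(extChartAt (𝓡 7) q).right_inv hx] at h2
  rw [← h2] at h
  exact h.hasMFDerivAt (by simp)

theorem mfderiv_chart_curve {c : ℝ → E7} {c' : E7} {t : ℝ} (hc : HasDerivAt c c' t)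
    (hx : c t ∈ (extChartAt (𝓡 7) q).target) :
    mfderiv 𝓘(ℝ, ℝ) (𝓡 7) (fun s => (extChartAt (𝓡 7) q).symm (c s)) t (1 : ℝ) =
      coordVec q ((extChartAt (𝓡 7) q).symm (c t)) c' := by
  have h := (hasMFDerivAt_chart_symm hx).comp t hc.hasFDerivAt.hasMFDerivAt
  have h2 := h.mfderiv
  change mfderiv 𝓘(ℝ, ℝ) (𝓡 7) ((extChartAt (𝓡 7) q).symm ∘ c) t (1 : ℝ) = _
  rw [h2]
  change coordVec q ((extChartAt (𝓡 7) q).symm (c t)) ((1 : ℝ) • c') = _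
  rw [one_smul]

theorem mdifferentiableAt_comp_chart {F : Type*} [NormedAddCommGroup F] [NormedSpace ℝ F]
    {g : E7 → F} {y : M} (hy : y ∈ (chartAt E7 q).source)
    (hg : DifferentiableAt ℝ g (extChartAt (𝓡 7) q y)) :
    MDifferentiableAt (𝓡 7) 𝓘(ℝ, F) (fun y => g (extChartAt (𝓡 7) q y)) y :=
  hg.mdifferentiableAt.comp y (mdifferentiableAt_extChartAt hy)

theorem mvfderiv_comp_chart {F : Type*} [NormedAddCommGroup F] [NormedSpace ℝ F]
    {g : E7 → F} {g' : E7 →L[ℝ] F} {y : M} (hy : y ∈ (chartAt E7 q).source)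
    (hg : HasFDerivAt g g' (extChartAt (𝓡 7) q y)) (u : TangentSpace (𝓡 7) y) :
    mvfderiv (𝓡 7) (fun y => g (extChartAt (𝓡 7) q y)) y u = g' (coordInv q y u) := by
  have h := hg.hasMFDerivAt.comp y (mdifferentiableAt_extChartAt (I := 𝓡 7) hy).hasMFDerivAt
  rw [mvfderiv]
  change NormedSpace.fromTangentSpace _ (mfderiv (𝓡 7) 𝓘(ℝ, F) (g ∘ extChartAt (𝓡 7) q) y u) = _
  rw [h.mfderiv, coordInv_eq_mfderiv hy]
  rfl

theorem contMDiff_chart_curve {c : ℝ → E7} (hc : ContDiff ℝ 1 c)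
    (hx : ∀ t, c t ∈ (extChartAt (𝓡 7) q).target) :
    ContMDiff 𝓘(ℝ, ℝ) (𝓡 7) 1 (fun s => (extChartAt (𝓡 7) q).symm (c s)) :=
  (contMDiffOn_extChartAt_symm (n := 1) q).comp_contMDiff hc.contMDiff hx

theorem diffFieldAt_coordVec {y : M} (hy : y ∈ (chartAt E7 q).source) {g : M → E7}
    (hg : MDifferentiableAt (𝓡 7) 𝓘(ℝ, E7) g y) : DiffFieldAt (fun y => coordVec q y (g y)) y := by
  set t := trivializationAt E7 (fun x : M => TangentSpace (𝓡 7) x) q with ht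
  have hb : t.baseSet = (chartAt E7 q).source := by simp [ht]
  refine (t.mdifferentiableAt_section_iff (𝓡 7) (fun y => coordVec q y (g y)) (hb ▸ hy)).2 ?_
  refine hg.congr_of_eventuallyEq ?_
  filter_upwards [(chartAt E7 q).open_source.mem_nhds hy] with z hz
  have h := coordInv_coordVec hz (g z)
  rw [coordInv, Trivialization.continuousLinearMapAt_apply,
    Trivialization.coe_linearMapAt_of_mem _ (hb ▸ hz)] at h
  exact h

theorem DiffFieldAt.add {X Y : (y : M) → TangentSpace (𝓡 7) y} {y : M} (hX : DiffFieldAt X y)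
    (hY : DiffFieldAt Y y) : DiffFieldAt (X + Y) y :=
  mdifferentiableAt_add_section hX hY

theorem DiffFieldAt.smul {X : (y : M) → TangentSpace (𝓡 7) y} {y : M} {g : M → ℝ}
    (hg : MDifferentiableAt (𝓡 7) 𝓘(ℝ, ℝ) g y) (hX : DiffFieldAt X y) : DiffFieldAt (g • X) y :=
  hg.smul_section hX

theorem cov_sum_smul (cov : Connection M) {y : M} {ι : Type*} (s : Finset ι) (g : ι → M → ℝ)
    (X : ι → (y : M) → TangentSpace (𝓡 7) y)
    (hg : ∀ i, MDifferentiableAt (𝓡 7) 𝓘(ℝ, ℝ) (g i) y) (hX : ∀ i, DiffFieldAt (X i) y)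
    (u : TangentSpace (𝓡 7) y) :
    DiffFieldAt (∑ i ∈ s, g i • X i) y ∧ cov (∑ i ∈ s, g i • X i) y u =
      ∑ i ∈ s, (mvfderiv (𝓡 7) (g i) y u • X i y + g i y • cov (X i) y u) := by
  classical
  induction s using Finset.induction_on with
  | empty =>
    refine ⟨mdifferentiableAt_zeroSection _ _, ?_⟩
    simp
  | insert a s ha ih =>
    rw [Finset.sum_insert ha, Finset.sum_insert ha]
    have h1 := (hX a).smul (hg a)
    refine ⟨h1.add ih.1, ?_⟩
    rw [cov.isCovariantDerivativeOnUniv.add h1 ih.1, add_apply, ih.2,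
      cov.isCovariantDerivativeOnUniv.leibniz (hX a) (hg a)]
    simp [add_comm]

end Chart

end G2Torsion

end

noncomputable section

namespace G2Torsion

/-! ### Parallel transport along short segments in a chart. -/

section LocalTransport

variable {M : Type*} [TopologicalSpace M] [ChartedSpace (EuclideanSpace ℝ (Fin 7)) M]
  [IsManifold (𝓡 7) ∞ M] {q : M} {f : SmoothBumpFunction (𝓡 7) q}

theorem smoothFieldAt_frameField [T2Space M] (i : Fin 7) (y : M) :
    SmoothFieldAt (frameField f i) y :=
  (contMDiff_frameField f i).contMDiffAt

theorem diffFieldAt_frameField [T2Space M] (i : Fin 7) (y : M) : DiffFieldAt (frameField f i) y :=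
  (smoothFieldAt_frameField i y).mdifferentiableAt (by simp)

/-- A solution of the transport equation in the chart is parallel along the curve. -/
theorem hasCovDerivAlong_of_solution [T2Space M] (cov : Connection M) {c z : ℝ → E7} {c' : E7}
    {t : ℝ} (hc : HasDerivAt c c' t) (hx : ∀ s, c s ∈ (extChartAt (𝓡 7) q).target)
    (hfr : ∀ s, IsFramePoint f ((extChartAt (𝓡 7) q).symm (c s)))
    (hz : HasDerivAt z (connForm f cov (c t) c' (z t)) t) :
    HasCovDerivAlong cov (fun s => (extChartAt (𝓡 7) q).symm (c s))
      (fun s => coordVec q _ (z s)) t 0 := by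
  refine ⟨7, frameField f, fun i s => z s i, fun i => connForm f cov (c t) c' (z t) i,
    fun i => smoothFieldAt_frameField i _, fun i => ?_, Filter.Eventually.of_forall fun s => ?_, ?_⟩
  · exact (EuclideanSpace.proj i : E7 →L[ℝ] ℝ).hasFDerivAt.comp_hasDerivAt t hz
  · exact ((hfr s).sum_smul (z s)).symm
  · rw [mfderiv_chart_curve hc (hx t), Finset.sum_add_distrib, (hfr t).sum_smul,
      (hfr t).sum_cov cov, coordInv_coordVec (hfr t).1, add_neg_cancel]

/-- Appending to a parallel transport the transport along a curve in the chart, given by a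
fundamental solution of the transport equation. -/
theorem IsParallelTransport.append_solution [T2Space M] {cov : Connection M} {c c' : ℝ → E7}
    (hc1 : ContDiff ℝ 1 c) (hc : ∀ t, HasDerivAt c (c' t) t)
    (hx : ∀ s, c s ∈ (extChartAt (𝓡 7) q).target)
    (hfr : ∀ s, IsFramePoint f ((extChartAt (𝓡 7) q).symm (c s)))
    {Φ : ℝ → E7 →L[ℝ] E7} (hΦ : ∀ t ∈ Set.Icc (0 : ℝ) 1,
      HasDerivAt Φ (connForm f cov (c t) (c' t) * Φ t) t)
    {Ψ : E7 →L[ℝ] E7} (hΨ : Φ 0 * Ψ = 1) {p : M} {x y : E7} (h0 : c 0 = x) (h1 : c 1 = y)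
    {P : TangentSpace (𝓡 7) p →L[ℝ] TangentSpace (𝓡 7) ((extChartAt (𝓡 7) q).symm x)}
    (hP : IsParallelTransport cov p _ P) :
    IsParallelTransport cov p ((extChartAt (𝓡 7) q).symm y)
      ((coordVec q _ ∘L (Φ 1 * Ψ) ∘L coordInv q _) ∘L P) := by
  subst h0 h1
  refine IsParallelTransport.step p (fun s => (extChartAt (𝓡 7) q).symm (c s))
    (contMDiff_chart_curve hc1 hx) P hP _ fun v => ?_
  refine ⟨fun s => coordVec q _ (Φ s (Ψ (coordInv q _ v))), ?_, rfl, fun t ht => ?_⟩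
  · have h2 := congrArg (fun L : E7 →L[ℝ] E7 => L (coordInv q _ v)) hΨ
    have h3 : Φ 0 (Ψ (coordInv q _ v)) = coordInv q _ v := h2
    simp only [h3]
    exact coordVec_coordInv (hfr 0).1 v
  · refine hasCovDerivAlong_of_solution (f := f) cov (hc t) hx hfr ?_
    exact (hΦ t ht).clm_apply (hasDerivAt_const t (Ψ (coordInv q _ v))) |>.congr_deriv (by simp)

/-- Parallel transport along short segments in the chart at `q`, as a family `τ (x, v)` of
endomorphisms of the model space; `τ (x, v)` is the transport from `x` to `x + v`. -/
structure LocalTransport (cov : Connection M) (q : M) where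
  /-- the radius of the ball in the chart -/
  r : ℝ
  r_pos : 0 < r
  ball_subset : Metric.ball (extChartAt (𝓡 7) q q) r ⊆ (extChartAt (𝓡 7) q).target
  /-- the transport along a segment -/
  τ : E7 × E7 → E7 →L[ℝ] E7
  τ_zero : ∀ x, τ (x, 0) = 1
  contDiffAt : ∀ x v, x ∈ Metric.ball (extChartAt (𝓡 7) q q) r →
    x + v ∈ Metric.ball (extChartAt (𝓡 7) q q) r → ContDiffAt ℝ 1 τ (x, v)
  isUnit : ∀ x v, x ∈ Metric.ball (extChartAt (𝓡 7) q q) r →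
    x + v ∈ Metric.ball (extChartAt (𝓡 7) q q) r → IsUnit (τ (x, v))
  forward : ∀ x v, x ∈ Metric.ball (extChartAt (𝓡 7) q q) r →
    x + v ∈ Metric.ball (extChartAt (𝓡 7) q q) r →
    ∀ (p : M) (P : TangentSpace (𝓡 7) p →L[ℝ] TangentSpace (𝓡 7) ((extChartAt (𝓡 7) q).symm x)),
    IsParallelTransport cov p _ P →
    IsParallelTransport cov p ((extChartAt (𝓡 7) q).symm (x + v))
      ((coordVec q _ ∘L τ (x, v) ∘L coordInv q _) ∘L P)
  backward : ∀ x v, x ∈ Metric.ball (extChartAt (𝓡 7) q q) r →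
    x + v ∈ Metric.ball (extChartAt (𝓡 7) q q) r → ∀ (p : M)
    (P : TangentSpace (𝓡 7) p →L[ℝ] TangentSpace (𝓡 7) ((extChartAt (𝓡 7) q).symm (x + v))),
    IsParallelTransport cov p _ P →
    IsParallelTransport cov p ((extChartAt (𝓡 7) q).symm x)
      ((coordVec q _ ∘L Ring.inverse (τ (x, v)) ∘L coordInv q _) ∘L P)
  parallelField : ∀ x ∈ Metric.ball (extChartAt (𝓡 7) q q) r, ∀ z : E7 → E7,
    (∀ᶠ v in nhds 0, z (x + v) = τ (x, v) (z x)) →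
    DiffFieldAt (fun y => coordVec q y (z (extChartAt (𝓡 7) q y))) ((extChartAt (𝓡 7) q).symm x) ∧
    ∀ u, cov (fun y => coordVec q y (z (extChartAt (𝓡 7) q y))) ((extChartAt (𝓡 7) q).symm x) u = 0

/-- Expand the field in the coordinate frame and use the Leibniz rule: the derivatives of the
coefficients are given by the connection form, which cancels the covariant derivatives of the frame.
-/
theorem parallelField_of_hasFDerivAt [T2Space M] (cov : Connection M) {x : E7}
    (hx : x ∈ (extChartAt (𝓡 7) q).target) (hfr : IsFramePoint f ((extChartAt (𝓡 7) q).symm x))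
    {z : E7 → E7} (hz : HasFDerivAt z ((connForm f cov x).flip (z x)) x) :
    DiffFieldAt (fun y => coordVec q y (z (extChartAt (𝓡 7) q y))) ((extChartAt (𝓡 7) q).symm x) ∧
    ∀ u, cov (fun y => coordVec q y (z (extChartAt (𝓡 7) q y)))
      ((extChartAt (𝓡 7) q).symm x) u = 0 := by
  have hr : extChartAt (𝓡 7) q ((extChartAt (𝓡 7) q).symm x) = x :=
    (extChartAt (𝓡 7) q).right_inv hx
  have hd : DiffFieldAt (fun y => coordVec q y (z (extChartAt (𝓡 7) q y)))
      ((extChartAt (𝓡 7) q).symm x) := by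
    refine diffFieldAt_coordVec hfr.1 (mdifferentiableAt_comp_chart hfr.1 ?_)
    rw [hr]; exact hz.differentiableAt
  refine ⟨hd, fun u => ?_⟩
  have hzi : ∀ i : Fin 7, HasFDerivAt (fun x => z x i)
      ((EuclideanSpace.proj i : E7 →L[ℝ] ℝ) ∘L (connForm f cov x).flip (z x))
      (extChartAt (𝓡 7) q ((extChartAt (𝓡 7) q).symm x)) := by
    intro i
    rw [hr]
    exact (EuclideanSpace.proj i : E7 →L[ℝ] ℝ).hasFDerivAt.comp x hz
  have hs := cov_sum_smul cov Finset.univ (fun i y => z (extChartAt (𝓡 7) q y) i) (frameField f)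
    (fun i => mdifferentiableAt_comp_chart hfr.1 (hzi i).differentiableAt)
    (fun i => diffFieldAt_frameField i _) u
  have hev : ∀ᶠ y in nhds ((extChartAt (𝓡 7) q).symm x),
      coordVec q y (z (extChartAt (𝓡 7) q y)) =
        (∑ i, (fun y => z (extChartAt (𝓡 7) q y) i) • frameField f i) y := by
    filter_upwards [(chartAt E7 q).open_source.mem_nhds hfr.1, hfr.2.eventuallyEq_nhds]
      with y hy1 hy2
    rw [Finset.sum_apply, ← IsFramePoint.sum_smul ⟨hy1, hy2⟩]
    rfl
  rw [cov.isCovariantDerivativeOnUniv.congr_of_eventuallyEq hd hs.1 Filter.univ_mem hev, hs.2,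
    Finset.sum_add_distrib]
  simp_rw [fun i => mvfderiv_comp_chart hfr.1 (hzi i) u]
  simp only [hr]
  rw [hfr.sum_cov cov]
  have := hfr.sum_smul (connForm f cov x (coordInv q _ u) (z x))
  rw [← this]
  exact add_neg_cancel _

/-- Every point has a ball in which the parallel transport along segments is available. -/
theorem nonempty_localTransport [T2Space M] {cov : Connection M}
    (hcov : CovariantDerivative.ContMDiffCovariantDerivative cov ∞) (q : M) :
    Nonempty (LocalTransport cov q) := by
  obtain ⟨f⟩ : Nonempty (SmoothBumpFunction (𝓡 7) q) := inferInstance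
  set x₀ := extChartAt (𝓡 7) q q with hx₀
  obtain ⟨a, ha, hae⟩ := exists_contDiff_extension (contDiffAt_connForm f hcov)
  obtain ⟨R, hR, hshort⟩ := exists_short_radius ha x₀
  have h1 : ∀ᶠ x in nhds x₀, x ∈ (extChartAt (𝓡 7) q).target := extChartAt_target_mem_nhds q
  have h2 : ∀ᶠ x in nhds x₀, IsFramePoint f ((extChartAt (𝓡 7) q).symm x) := by
    have hc : ContinuousAt (extChartAt (𝓡 7) q).symm x₀ := continuousAt_extChartAt_symm q
    refine hc.eventually ?_
    rw [hx₀, extChartAt_to_inv]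
    exact eventually_isFramePoint f
  obtain ⟨ε, hε, hall⟩ := Metric.eventually_nhds_iff_ball.1 (hae.and (h1.and h2))
  -- Half of R, since the difference v of two points of the ball of radius r is only bounded by 2r.
  set r := min ε (R / 2) with hr
  have hrε : Metric.ball x₀ r ⊆ Metric.ball x₀ ε := Metric.ball_subset_ball (min_le_left _ _)
  have hsh : ∀ x v, x ∈ Metric.ball x₀ r → x + v ∈ Metric.ball x₀ r →
      ShortSegment ha (x, v) ∧ IsUnit (segTransport ha (x, v)) := by
    intro x v hx hv
    rw [mem_ball_iff_norm] at hx hv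
    have hrR : r ≤ R / 2 := min_le_right _ _
    refine hshort x v (by linarith) ?_
    have h3 := norm_sub_le (x + v - x₀) (x - x₀)
    rw [sub_sub_sub_cancel_right, add_sub_cancel_left] at h3
    linarith
  have hseg : ∀ x v, x ∈ Metric.ball x₀ r → x + v ∈ Metric.ball x₀ r → ∀ t : ℝ,
      x + Real.smoothTransition t • v ∈ Metric.ball x₀ r := by
    intro x v hx hv t
    exact (convex_ball x₀ r).add_smul_mem hx hv
      ⟨Real.smoothTransition.nonneg t, Real.smoothTransition.le_one t⟩
  have hρ : ∀ t, HasDerivAt Real.smoothTransition (deriv Real.smoothTransition t) t := fun t =>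
    ((Real.smoothTransition.contDiff (n := 1)).differentiable one_ne_zero t).hasDerivAt
  have hρ1 : ContDiff ℝ 1 Real.smoothTransition := Real.smoothTransition.contDiff (n := 1)
  refine ⟨{ r := r, r_pos := lt_min hε (by linarith),
            ball_subset := fun x hx => (hall x (hrε hx)).2.1
            τ := segTransport ha
            τ_zero := segTransport_zero ha
            contDiffAt := fun x v hx hv => (hsh x v hx hv).1.contDiffAt
            isUnit := fun x v hx hv => (hsh x v hx hv).2
            forward := ?_, backward := ?_, parallelField := ?_ }⟩
  · intro x v hx hv p P hP
    obtain ⟨Φ, h0, h1, hd⟩ := (hsh x v hx hv).1.exists_solution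
    have := IsParallelTransport.append_solution (f := f) (q := q) (cov := cov)
      (c := fun t => x + Real.smoothTransition t • v)
      (c' := fun t => deriv Real.smoothTransition t • v) (by fun_prop)
      (fun t => ((hρ t).smul_const v).const_add x)
      (fun s => (hall _ (hrε (hseg x v hx hv s))).2.1)
      (fun s => (hall _ (hrε (hseg x v hx hv s))).2.2) (Φ := Φ)
      (fun t ht => by
        rw [← (hall _ (hrε (hseg x v hx hv t))).1]
        exact hd t ht)
      (Ψ := 1) (by rw [h0, one_mul]) (x := x) (y := x + v) (by simp) (by simp) hP
    rwa [mul_one, h1] at this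
  · intro x v hx hv p P hP
    obtain ⟨Φ, h0, h1, hd⟩ := (hsh x v hx hv).1.exists_solution
    -- The segment is run backwards: t ↦ Φ(1 - t) solves the reversed equation with initial value
    -- Φ(1), and Ψ normalizes it to the identity.
    have := IsParallelTransport.append_solution (f := f) (q := q) (cov := cov)
      (c := fun t => x + Real.smoothTransition (1 - t) • v)
      (c' := fun t => (-deriv Real.smoothTransition (1 - t)) • v) (by fun_prop)
      (fun t => by
        have h3 := (hρ (1 - t)).scomp t ((hasDerivAt_id t).const_sub 1)
        have h4 := (h3.smul_const v).const_add x
        refine h4.congr_deriv ?_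
        simp)
      (fun s => (hall _ (hrε (hseg x v hx hv (1 - s)))).2.1)
      (fun s => (hall _ (hrε (hseg x v hx hv (1 - s)))).2.2) (Φ := fun t => Φ (1 - t))
      (fun t ht => by
        rw [← (hall _ (hrε (hseg x v hx hv (1 - t)))).1]
        have h3 := (hd (1 - t) ⟨by linarith [ht.2], by linarith [ht.1]⟩).scomp t
          ((hasDerivAt_id t).const_sub 1)
        refine h3.congr_deriv ?_
        ext w : 1
        simp)
      (Ψ := Ring.inverse (segTransport ha (x, v)))
      (by rw [sub_zero, h1, Ring.mul_inverse_cancel _ (hsh x v hx hv).2]) (x := x + v) (y := x)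
      (by simp) (by simp) hP
    rwa [sub_self, h0, one_mul] at this
  · intro x hx z hz
    have hax := (hall _ (hrε hx)).1
    refine parallelField_of_hasFDerivAt (f := f) cov (hall _ (hrε hx)).2.1 (hall _ (hrε hx)).2.2 ?_
    rw [← hax]
    -- Near x the field z is the transport of its value at x, so its derivative there is the
    -- derivative of the transport at the zero segment, namely the connection form.
    have h3 := (hasFDerivAt_segTransport ha x).clm_apply (hasFDerivAt_const (z x) (0 : E7))
    have h4 : HasFDerivAt (fun v => z (x + v)) ((a x).flip (z x)) 0 := by
      refine (h3.congr_fderiv ?_).congr_of_eventuallyEq hz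
      ext v
      simp
    rw [hasFDerivAt_comp_add_left x, add_zero] at h4
    exact h4

end LocalTransport

end G2Torsion

end

noncomputable section

namespace G2Torsion

/-! ### Torsion in the coordinate frame. -/

section FrameTorsion

variable {M : Type*} [TopologicalSpace M] [ChartedSpace (EuclideanSpace ℝ (Fin 7)) M]
  [IsManifold (𝓡 7) ∞ M] {q : M} {f : SmoothBumpFunction (𝓡 7) q}

theorem IsParallelTransport.trans {cov : Connection M} {p q r : M}
    {P : TangentSpace (𝓡 7) p →L[ℝ] TangentSpace (𝓡 7) q}
    {Q : TangentSpace (𝓡 7) q →L[ℝ] TangentSpace (𝓡 7) r}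
    (hP : IsParallelTransport cov p q P) (hQ : IsParallelTransport cov q r Q) :
    IsParallelTransport cov p r (Q ∘L P) := by
  induction hQ with
  | refl => exact hP
  | step γ hγ Q hQ R hR ih =>
    rw [ContinuousLinearMap.comp_assoc]
    exact IsParallelTransport.step _ γ hγ _ ih R hR

theorem mlieBracket_const (v w x : E7) :
    VectorField.mlieBracket 𝓘(ℝ, E7) (fun _ : E7 => v) (fun _ : E7 => w) x = 0 := by
  have h := VectorField.mlieBracketWithin_eq_lieBracketWithin (𝕜 := ℝ) (E := E7)
    (V := fun _ => v) (W := fun _ => w) (s := Set.univ)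
  refine (congrFun h x).trans ?_
  simp [VectorField.lieBracketWithin]
  rfl

theorem mpullback_chart_const {y : M} (hy : y ∈ (chartAt E7 q).source) (w : E7) :
    VectorField.mpullback (𝓡 7) 𝓘(ℝ, E7) (extChartAt (𝓡 7) q) (fun _ => w) y =
      coordVec q y w := by
  change (mfderiv (𝓡 7) 𝓘(ℝ, E7) (extChartAt (𝓡 7) q) y).inverse w = _
  rw [← coordInv_eq_mfderiv hy]
  let e : TangentSpace (𝓡 7) y ≃L[ℝ] E7 :=
    ContinuousLinearEquiv.equivOfInverse (coordInv q y) (coordVec q y)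
      (coordVec_coordInv hy) (coordInv_coordVec hy)
  change (e : TangentSpace (𝓡 7) y →L[ℝ] E7).inverse w = _
  rw [ContinuousLinearMap.inverse_equiv]
  rfl

theorem IsFramePoint.eventually_frameField {y : M} (hy : IsFramePoint f y) (i : Fin 7) :
    ∀ᶠ z in nhds y, IsFramePoint f z ∧ G2Torsion.frameField f i z = coordVec q z (stdVec i) := by
  filter_upwards [(chartAt E7 q).open_source.mem_nhds hy.1, hy.2.eventuallyEq_nhds] with z h1 h2
  exact ⟨⟨h1, h2⟩, IsFramePoint.frameField ⟨h1, h2⟩ i⟩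

/-- Near y the frame fields are pullbacks of constant fields by the chart, and pullback commutes
with the bracket. -/
theorem IsFramePoint.mlieBracket_eq_zero {y : M} (hy : IsFramePoint f y) (i j : Fin 7) :
    VectorField.mlieBracket (𝓡 7) (G2Torsion.frameField f i) (G2Torsion.frameField f j) y = 0 := by
  have h : ∀ i, G2Torsion.frameField f i =ᶠ[nhds y]
      VectorField.mpullback (𝓡 7) 𝓘(ℝ, E7) (extChartAt (𝓡 7) q) (fun _ => stdVec i) := by
    intro i
    filter_upwards [hy.eventually_frameField i] with z hz
    rw [hz.2]
    exact (mpullback_chart_const hz.1.1 _).symm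
  rw [(h i).mlieBracket_vectorField_eq (h j)]
  have hc : ∀ w : E7, MDifferentiableAt 𝓘(ℝ, E7) 𝓘(ℝ, E7).tangent
      (fun x => TotalSpace.mk' E7 (E := fun x : E7 => TangentSpace 𝓘(ℝ, E7) x) x w)
      (extChartAt (𝓡 7) q y) := fun w =>
    ((contMDiffAt_vectorSpace_iff_contDiffAt (V := fun _ => w)).2
      (contDiffAt_const (n := 1))).mdifferentiableAt one_ne_zero
  have : IsManifold (𝓡 7) (minSmoothness ℝ 2) M := by
    rw [minSmoothness_of_isRCLikeNormedField]; infer_instance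
  rw [← VectorField.mpullback_mlieBracket (n := 2) (hc _) (hc _)
    (contMDiffAt_extChartAt' hy.1) (by simp)]
  change (mfderiv (𝓡 7) 𝓘(ℝ, E7) (extChartAt (𝓡 7) q) y).inverse _ = _
  refine (congrArg _ (mlieBracket_const (stdVec i) (stdVec j) _)).trans ?_
  exact map_zero _

theorem mdifferentiableAt_cov_frameField [T2Space M] {cov : Connection M}
    (hcov : CovariantDerivative.ContMDiffCovariantDerivative cov ∞) (i : Fin 7) {y : M}
    {X : (y : M) → TangentSpace (𝓡 7) y} (hX : DiffFieldAt X y) :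
    DiffFieldAt (fun y => cov (frameField f i) y (X y)) y := by
  have h := (hcov.contMDiff.contMDiff (contMDiff_frameField f i).contMDiffOn).contMDiffAt
    (Filter.univ_mem (f := nhds y))
  exact MDifferentiableAt.clm_bundle_apply (h.mdifferentiableAt (by simp)) hX

theorem IsFramePoint.torsion_frameField [T2Space M] (cov : Connection M) {y : M}
    (hy : IsFramePoint f y) (i j : Fin 7) :
    cov.torsion y (G2Torsion.frameField f i y) (G2Torsion.frameField f j y) =
      cov (G2Torsion.frameField f j) y (G2Torsion.frameField f i y) -
      cov (G2Torsion.frameField f i) y (G2Torsion.frameField f j y) := by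
  rw [cov.torsion_apply (diffFieldAt_frameField i y) (diffFieldAt_frameField j y),
    hy.mlieBracket_eq_zero, sub_zero]

theorem mdifferentiableAt_coord {X : (y : M) → TangentSpace (𝓡 7) y} {y : M}
    (hy : y ∈ (chartAt E7 q).source) (hX : DiffFieldAt X y) :
    MDifferentiableAt (𝓡 7) 𝓘(ℝ, E7) (fun y => coordInv q y (X y)) y := by
  set t := trivializationAt E7 (fun x : M => TangentSpace (𝓡 7) x) q with ht
  have hb : t.baseSet = (chartAt E7 q).source := by simp [ht]
  refine ((t.mdifferentiableAt_section_iff (𝓡 7) X (hb ▸ hy)).1 hX).congr_of_eventuallyEq ?_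
  filter_upwards [(chartAt E7 q).open_source.mem_nhds hy] with z hz
  rw [coordInv, Trivialization.continuousLinearMapAt_apply,
    Trivialization.coe_linearMapAt_of_mem _ (hb ▸ hz)]

omit [IsManifold (𝓡 7) ∞ M] in
theorem mdifferentiableAt_fun_sum {ι : Type} [Fintype ι] {g : ι → M → ℝ} {y : M}
    (hg : ∀ i, MDifferentiableAt (𝓡 7) 𝓘(ℝ, ℝ) (g i) y) :
    MDifferentiableAt (𝓡 7) 𝓘(ℝ, ℝ) (fun z => ∑ i, g i z) y := by
  have e : (fun z => ∑ i, g i z) = ∑ i, g i := by ext z; simp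
  rw [e]
  exact MDifferentiableAt.sum fun i _ => hg i

end FrameTorsion

/-! ### Differentiability of the torsion tensor. -/

section Metric

variable {M : Type*} [TopologicalSpace M] [ChartedSpace (EuclideanSpace ℝ (Fin 7)) M]
  [IsManifold (𝓡 7) ∞ M] [RiemannianBundle (fun x : M => TangentSpace (𝓡 7) x)]
  {q : M} {f : SmoothBumpFunction (𝓡 7) q}

theorem torsionTensor_sum (cov : Connection M) (y : M) (ξ η ζ : Fin 7 → ℝ)
    (σ : Fin 7 → TangentSpace (𝓡 7) y) :
    torsionTensor cov y (∑ i, ξ i • σ i) (∑ j, η j • σ j) (∑ k, ζ k • σ k) =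
      ∑ i, ∑ j, ∑ k, ξ i * η j * ζ k * torsionTensor cov y (σ i) (σ j) (σ k) := by
  simp only [torsionTensor, map_sum, map_smul, sum_apply, smul_apply,
    sum_inner, inner_sum, real_inner_smul_left, real_inner_smul_right, Finset.mul_sum]
  rw [Finset.sum_comm, Finset.sum_congr rfl fun j _ => Finset.sum_comm, Finset.sum_comm]
  refine Finset.sum_congr rfl fun i _ => Finset.sum_congr rfl fun j _ =>
    Finset.sum_congr rfl fun k _ => ?_
  ring

variable [IsContMDiffRiemannianBundle (𝓡 7) ∞ E7 (fun x : M => TangentSpace (𝓡 7) x)]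

theorem DiffFieldAt.inner {X Y : (y : M) → TangentSpace (𝓡 7) y} {y : M} (hX : DiffFieldAt X y)
    (hY : DiffFieldAt Y y) :
    MDifferentiableAt (𝓡 7) 𝓘(ℝ, ℝ) (fun y => inner ℝ (X y) (Y y)) y :=
  MDifferentiableAt.inner_bundle hX hY

/-- Parallelism only fixes the value of `mvfderiv`, which is zero by default where a function is not
differentiable, so the product rule along curves needs this separately. In the frame the brackets
vanish, and the torsion is a polynomial in coefficients and in metric products of frame fields with
their covariant derivatives. -/
theorem mdifferentiableAt_torsionTensor [T2Space M] {cov : Connection M}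
    (hcov : CovariantDerivative.ContMDiffCovariantDerivative cov ∞) {y : M}
    {X Y Z : (y : M) → TangentSpace (𝓡 7) y} (hX : DiffFieldAt X y) (hY : DiffFieldAt Y y)
    (hZ : DiffFieldAt Z y) :
    MDifferentiableAt (𝓡 7) 𝓘(ℝ, ℝ) (fun y => torsionTensor cov y (X y) (Y y) (Z y)) y := by
  obtain ⟨f⟩ : Nonempty (SmoothBumpFunction (𝓡 7) y) := inferInstance
  have hs := mem_chart_source E7 y
  have hc : ∀ {X : (y : M) → TangentSpace (𝓡 7) y}, DiffFieldAt X y → ∀ i : Fin 7,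
      MDifferentiableAt (𝓡 7) 𝓘(ℝ, ℝ) (fun z => coordInv y z (X z) i) y := fun hX i =>
    (EuclideanSpace.proj i : E7 →L[ℝ] ℝ).differentiableAt.mdifferentiableAt.comp y
      (mdifferentiableAt_coord hs hX)
  have hd : ∀ i j k, MDifferentiableAt (𝓡 7) 𝓘(ℝ, ℝ) (fun z => inner ℝ
      (cov (frameField f j) z (frameField f i z) - cov (frameField f i) z (frameField f j z))
      (frameField f k z)) y := fun i j k =>
    DiffFieldAt.inner (mdifferentiableAt_sub_section
      (mdifferentiableAt_cov_frameField hcov j (diffFieldAt_frameField i y))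
      (mdifferentiableAt_cov_frameField hcov i (diffFieldAt_frameField j y)))
      (diffFieldAt_frameField k y)
  have hsum : MDifferentiableAt (𝓡 7) 𝓘(ℝ, ℝ) (fun z => ∑ i, ∑ j, ∑ k,
      coordInv y z (X z) i * coordInv y z (Y z) j * coordInv y z (Z z) k * inner ℝ
      (cov (frameField f j) z (frameField f i z) - cov (frameField f i) z (frameField f j z))
      (frameField f k z)) y :=
    mdifferentiableAt_fun_sum fun i => mdifferentiableAt_fun_sum fun j =>
      mdifferentiableAt_fun_sum fun k => (((hc hX i).mul (hc hY j)).mul (hc hZ k)).mul (hd i j k)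
  refine hsum.congr_of_eventuallyEq ?_
  filter_upwards [eventually_isFramePoint f] with z hz
  have e : ∀ X : (y : M) → TangentSpace (𝓡 7) y,
      X z = ∑ i, coordInv y z (X z) i • frameField f i z := fun X => by
    rw [hz.sum_smul, coordVec_coordInv hz.1]
  conv_lhs => rw [e X, e Y, e Z, torsionTensor_sum]
  simp only [torsionTensor, hz.torsion_frameField]

end Metric

end G2Torsion

end

noncomputable section

namespace G2Torsion

/-! ### Curves in groups of endomorphisms. -/

section Curves

variable {V : Type*} [NormedAddCommGroup V]

theorem trilinear_invariant_of_hasDerivAt [InnerProductSpace ℝ V] (B : V →L[ℝ] V →L[ℝ] V)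
    {c : ℝ → V →L[ℝ] V} {A : V →L[ℝ] V} (hc0 : c 0 = ContinuousLinearMap.id ℝ V)
    (hd : HasDerivAt c A 0) {u v w : V}
    (h : ∀ t, inner ℝ (B (c t u) (c t v)) (c t w) = inner ℝ (B u v) w) :
    inner ℝ (B (A u) v) w + inner ℝ (B u (A v)) w + inner ℝ (B u v) (A w) = 0 := by
  have hu : ∀ u, HasDerivAt (fun t => c t u) (A u) 0 := fun u =>
    (hd.clm_apply (hasDerivAt_const 0 u)).congr_deriv (by simp)
  have h0 : ∀ u, c 0 u = u := fun u => by rw [hc0]; rfl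
  have h1 : HasDerivAt (fun t => inner ℝ (B (c t u) (c t v)) (c t w)) _ 0 :=
    HasDerivAt.inner ℝ ((B.hasFDerivAt.comp_hasDerivAt (0 : ℝ) (hu u)).clm_apply (hu v)) (hu w)
  have h2 : HasDerivAt (fun t => inner ℝ (B (c t u) (c t v)) (c t w)) 0 0 := by
    simp_rw [h]
    exact hasDerivAt_const _ _
  have h3 := h1.unique h2
  simp only [h0, Function.comp_apply] at h3
  rw [← h3]
  simp only [inner_add_left]
  ring

variable [NormedSpace ℝ V]

/-- A vector annihilated by the velocities of the curves in a monoid `G` of endomorphisms is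
fixed by the elements of `G` which are joined to the identity by a `C¹` curve in `G`. -/
theorem apply_eq_of_velocities {G : Set (V →L[ℝ] V)} (hG : ∀ P ∈ G, ∀ Q ∈ G, P ∘L Q ∈ G) {e : V}
    (he : ∀ (c : ℝ → V →L[ℝ] V) (A : V →L[ℝ] V), ContDiff ℝ 1 c →
      c 0 = ContinuousLinearMap.id ℝ V → (∀ t, c t ∈ G) → HasDerivAt c A 0 → A e = 0)
    {c d : ℝ → V →L[ℝ] V} (hc : ContDiff ℝ 1 c)
    (hd : ContDiff ℝ 1 d) (hc0 : c 0 = ContinuousLinearMap.id ℝ V)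
    (hcG : ∀ s, c s ∈ G) (hdG : ∀ s, d s ∈ G)
    (hcd : ∀ s, c s ∘L d s = ContinuousLinearMap.id ℝ V)
    (hdc : ∀ s, d s ∘L c s = ContinuousLinearMap.id ℝ V) (s : ℝ) : c s e = e := by
  have hc' : ∀ s, HasDerivAt c (deriv c s) s := fun s =>
    (hc.differentiable one_ne_zero s).hasDerivAt
  have hd' : ∀ s, HasDerivAt d (deriv d s) s := fun s =>
    (hd.differentiable one_ne_zero s).hasDerivAt
  -- For fixed s the curve r ↦ c(s + r) d(s) lies in G and is the identity at r = 0, so its velocity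
  -- c'(s) d(s) kills e.
  have h1 : ∀ s, deriv c s (d s e) = 0 := by
    intro s
    refine he (fun r => c (s + r) ∘L d s) (deriv c s ∘L d s) ?_ ?_ (fun r => ?_) ?_
    · exact (hc.comp (by fun_prop : ContDiff ℝ 1 fun r => s + r)).clm_comp contDiff_const
    · simp only [add_zero, hcd]
    · exact hG _ (hcG (s + r)) _ (hdG s)
    · have h2 : HasDerivAt (fun r => c (s + r)) (deriv c s) 0 := by
        have := (hc' (s + 0)).comp_const_add s 0
        simpa using this
      exact (h2.clm_comp (hasDerivAt_const 0 (d s))).congr_deriv (by simp)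
  -- Differentiating c d e = e gives c d' e = -c' d e = 0, and c is invertible. Hence d e is
  -- constant, equal to its initial value e.
  have h2 : ∀ s, deriv d s e = 0 := by
    intro s
    have h3 : HasDerivAt (fun s => c s (d s e)) (deriv c s (d s e) + c s (deriv d s e)) s := by
      have := (hc' s).clm_apply ((hd' s).clm_apply (hasDerivAt_const s e))
      simpa using this
    have h4 : (fun s => c s (d s e)) = fun _ => e := by
      ext s
      exact congrArg (fun L : V →L[ℝ] V => L e) (hcd s)
    rw [h4] at h3
    have h5 := h3.unique (hasDerivAt_const s e)
    rw [h1, zero_add] at h5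
    have h7 : d s (c s (deriv d s e)) = deriv d s e :=
      congrArg (fun L : V →L[ℝ] V => L (deriv d s e)) (hdc s)
    rw [← h7, h5, map_zero]
  have h3 : ∀ s, d s e = d 0 e := fun s =>
    is_const_of_deriv_eq_zero (f := fun s => d s e)
      (fun s => ((hd' s).clm_apply (hasDerivAt_const s e)).differentiableAt)
      (fun s => by
        rw [((hd' s).clm_apply (hasDerivAt_const s e)).deriv]
        simp [h2]) s 0
  have h4 : d 0 = ContinuousLinearMap.id ℝ V := by
    have := hcd 0
    rwa [hc0, ContinuousLinearMap.id_comp] at this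
  have h6 : c s (d s e) = e := congrArg (fun L : V →L[ℝ] V => L e) (hcd s)
  rwa [h3, h4] at h6

end Curves

/-! ### Invariance of a parallel torsion tensor under transport and holonomy. -/

section Invariance

variable {M : Type*} [TopologicalSpace M] [ChartedSpace (EuclideanSpace ℝ (Fin 7)) M]
  [IsManifold (𝓡 7) ∞ M] [RiemannianBundle (fun x : M => TangentSpace (𝓡 7) x)]

omit [RiemannianBundle (fun x : M => TangentSpace (𝓡 7) x)] [IsManifold (𝓡 7) ∞ M] in
theorem hasDerivAt_comp_curve {h : M → ℝ} {γ : ℝ → M} {t : ℝ}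
    (hh : MDifferentiableAt (𝓡 7) 𝓘(ℝ, ℝ) h (γ t)) (hγ : MDifferentiableAt 𝓘(ℝ, ℝ) (𝓡 7) γ t) :
    HasDerivAt (fun s => h (γ s))
      (mvfderiv (𝓡 7) h (γ t) (mfderiv 𝓘(ℝ, ℝ) (𝓡 7) γ t (1 : ℝ))) t := by
  have h1 : HasFDerivAt (fun s => h (γ s)) ((mfderiv (𝓡 7) 𝓘(ℝ, ℝ) h (γ t) ∘L
      mfderiv 𝓘(ℝ, ℝ) (𝓡 7) γ t : ℝ →L[ℝ] ℝ)) t :=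
    (hh.hasMFDerivAt.comp t hγ.hasMFDerivAt).hasFDerivAt
  exact h1.hasDerivAt

theorem torsionTensor_fun_sum (cov : Connection M) (y : M) {ι κ l : Type*} [Fintype ι]
    [Fintype κ] [Fintype l] (X : ι → TangentSpace (𝓡 7) y) (Y : κ → TangentSpace (𝓡 7) y)
    (Z : l → TangentSpace (𝓡 7) y) :
    torsionTensor cov y (∑ i, X i) (∑ j, Y j) (∑ k, Z k) =
      ∑ i, ∑ j, ∑ k, torsionTensor cov y (X i) (Y j) (Z k) := by
  simp only [torsionTensor, map_sum, sum_apply, sum_inner, inner_sum]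
  rw [Finset.sum_comm, Finset.sum_congr rfl fun j _ => Finset.sum_comm, Finset.sum_comm]

theorem torsionTensor_zero₁ (cov : Connection M) (y : M) (u v : TangentSpace (𝓡 7) y) :
    torsionTensor cov y 0 u v = 0 := by simp [torsionTensor]

theorem torsionTensor_zero₂ (cov : Connection M) (y : M) (u v : TangentSpace (𝓡 7) y) :
    torsionTensor cov y u 0 v = 0 := by simp [torsionTensor]

theorem torsionTensor_zero₃ (cov : Connection M) (y : M) (u v : TangentSpace (𝓡 7) y) :
    torsionTensor cov y u v 0 = 0 := by simp [torsionTensor]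

variable [IsContMDiffRiemannianBundle (𝓡 7) ∞ E7 (fun x : M => TangentSpace (𝓡 7) x)]

/-- Write the three fields as combinations of smooth vector fields on M and apply the product rule.
Parallelism of the torsion rewrites the derivative of each coefficient, and the terms regroup into
the covariant derivatives along γ, which vanish. -/
theorem hasDerivAt_torsionTensor_along [T2Space M] {cov : Connection M}
    (hcov : CovariantDerivative.ContMDiffCovariantDerivative cov ∞)
    (hpar : IsParallelTensor cov (torsionTensor cov)) {γ : ℝ → M}
    (hγ : ContMDiff 𝓘(ℝ, ℝ) (𝓡 7) 1 γ) {U V W : (t : ℝ) → TangentSpace (𝓡 7) (γ t)} {t : ℝ}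
    (hU : HasCovDerivAlong cov γ U t 0) (hV : HasCovDerivAlong cov γ V t 0)
    (hW : HasCovDerivAlong cov γ W t 0) :
    HasDerivAt (fun s => torsionTensor cov (γ s) (U s) (V s) (W s)) 0 t := by
  obtain ⟨n₁, σ, f, f', hσ, hf, hUs, hU0⟩ := hU
  obtain ⟨n₂, ρ, g, g', hρ, hg, hVs, hV0⟩ := hV
  obtain ⟨n₃, τ, h, h', hτ, hh, hWs, hW0⟩ := hW
  have hd : ∀ {X : (x : M) → TangentSpace (𝓡 7) x}, SmoothFieldAt X (γ t) → DiffFieldAt X (γ t) :=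
    fun hX => ContMDiffAt.mdifferentiableAt hX (by simp)
  have hG : ∀ i j k, HasDerivAt
      (fun s => torsionTensor cov (γ s) (σ i (γ s)) (ρ j (γ s)) (τ k (γ s))) _ t := fun i j k =>
    hasDerivAt_comp_curve
      (mdifferentiableAt_torsionTensor hcov (hd (hσ i)) (hd (hρ j)) (hd (hτ k)))
      (hγ.mdifferentiableAt one_ne_zero)
  set D := mfderiv 𝓘(ℝ, ℝ) (𝓡 7) γ t (1 : ℝ)
  have hF : HasDerivAt (fun s => ∑ i, ∑ j, ∑ k, f i s * g j s * h k s *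
      torsionTensor cov (γ s) (σ i (γ s)) (ρ j (γ s)) (τ k (γ s))) _ t :=
    HasDerivAt.fun_sum fun i _ => HasDerivAt.fun_sum fun j _ => HasDerivAt.fun_sum fun k _ =>
      (((hf i).mul (hg j)).mul (hh k)).mul (hG i j k)
  have hev : (fun s => torsionTensor cov (γ s) (U s) (V s) (W s)) =ᶠ[nhds t]
      fun s => ∑ i, ∑ j, ∑ k, f i s * g j s * h k s *
        torsionTensor cov (γ s) (σ i (γ s)) (ρ j (γ s)) (τ k (γ s)) := by
    filter_upwards [hUs, hVs, hWs] with s h1 h2 h3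
    rw [h1, h2, h3, torsionTensor_fun_sum]
    refine Finset.sum_congr rfl fun i _ => Finset.sum_congr rfl fun j _ =>
      Finset.sum_congr rfl fun k _ => ?_
    simp only [torsionTensor, map_smul, smul_apply, real_inner_smul_left, real_inner_smul_right]
    ring
  refine (hF.congr_of_eventuallyEq hev).congr_deriv ?_
  -- The product rule in the form that the expanded derivative must match: each of the three terms
  -- contains one vanishing covariant derivative.
  have key : torsionTensor cov (γ t) (∑ i, (f' i • σ i (γ t) + f i t • cov (σ i) (γ t) D))
        (∑ j, g j t • ρ j (γ t)) (∑ k, h k t • τ k (γ t)) +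
      torsionTensor cov (γ t) (∑ i, f i t • σ i (γ t))
        (∑ j, (g' j • ρ j (γ t) + g j t • cov (ρ j) (γ t) D)) (∑ k, h k t • τ k (γ t)) +
      torsionTensor cov (γ t) (∑ i, f i t • σ i (γ t)) (∑ j, g j t • ρ j (γ t))
        (∑ k, (h' k • τ k (γ t) + h k t • cov (τ k) (γ t) D)) = 0 := by
    rw [← hU0, ← hV0, ← hW0, torsionTensor_zero₁, torsionTensor_zero₂, torsionTensor_zero₃]
    simp
  rw [← key]
  simp only [torsionTensor_fun_sum, ← Finset.sum_add_distrib]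
  refine Finset.sum_congr rfl fun i _ => Finset.sum_congr rfl fun j _ =>
    Finset.sum_congr rfl fun k _ => ?_
  rw [hpar (γ t) (σ i) (ρ j) (τ k) (hd (hσ i)) (hd (hρ j)) (hd (hτ k)) D]
  simp only [torsionTensor, map_smul, map_add, add_apply, smul_apply, real_inner_smul_left,
    real_inner_smul_right, inner_add_left, inner_add_right, Pi.mul_apply]
  ring

/-- Parallel transport preserves a parallel torsion tensor. -/
theorem IsParallelTransport.torsionTensor_eq [T2Space M] {cov : Connection M}
    (hcov : CovariantDerivative.ContMDiffCovariantDerivative cov ∞)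
    (hpar : IsParallelTensor cov (torsionTensor cov)) {p q : M}
    {P : TangentSpace (𝓡 7) p →L[ℝ] TangentSpace (𝓡 7) q} (hP : IsParallelTransport cov p q P)
    (u v w : TangentSpace (𝓡 7) p) :
    torsionTensor cov q (P u) (P v) (P w) = torsionTensor cov p u v w := by
  induction hP with
  | refl => rfl
  | step γ hγ Q hQ P hP ih =>
    rw [← ih]
    obtain ⟨U, hU0, hU1, hU⟩ := hP (Q u)
    obtain ⟨V, hV0, hV1, hV⟩ := hP (Q v)
    obtain ⟨W, hW0, hW1, hW⟩ := hP (Q w)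
    have hd : ∀ t ∈ Set.Icc (0 : ℝ) 1, HasDerivAt
        (fun s => torsionTensor cov (γ s) (U s) (V s) (W s)) 0 t := fun t ht =>
      hasDerivAt_torsionTensor_along hcov hpar hγ (hU t ht) (hV t ht) (hW t ht)
    have h := constant_of_has_deriv_right_zero
      (fun t ht => (hd t ht).continuousAt.continuousWithinAt)
      (fun t ht => (hd t ⟨ht.1, ht.2.le⟩).hasDerivWithinAt) 1 ⟨zero_le_one, le_rfl⟩
    simp only [hU0, hU1, hV0, hV1, hW0, hW1] at h
    exact h

/-- The torsion tensor is invariant under the holonomy algebra. -/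
theorem torsionTensor_holonomyAlgebra [T2Space M] {cov : Connection M}
    (hcov : CovariantDerivative.ContMDiffCovariantDerivative cov ∞)
    (hpar : IsParallelTensor cov (torsionTensor cov)) {p : M}
    {A : TangentSpace (𝓡 7) p →L[ℝ] TangentSpace (𝓡 7) p} (hA : A ∈ holonomyAlgebra cov p)
    (u v w : TangentSpace (𝓡 7) p) :
    torsionTensor cov p (A u) v w + torsionTensor cov p u (A v) w +
      torsionTensor cov p u v (A w) = 0 := by
  obtain ⟨c, -, hc0, hcH, hd⟩ := hA
  exact trilinear_invariant_of_hasDerivAt (V := TangentSpace (𝓡 7) p) (cov.torsion p) hc0 hd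
    (fun t => IsParallelTransport.torsionTensor_eq hcov hpar (hcH t) u v w)

end Invariance

section Fixed

variable {M : Type*} [TopologicalSpace M] [ChartedSpace (EuclideanSpace ℝ (Fin 7)) M]
  [IsManifold (𝓡 7) ∞ M] [RiemannianBundle (fun x : M => TangentSpace (𝓡 7) x)]

/-- A vector annihilated by the holonomy algebra is fixed by the elements of the holonomy group
which are joined to the identity by a `C¹` curve in the group. -/
theorem apply_eq_of_holonomyAlgebra {cov : Connection M} {p : M} {e : TangentSpace (𝓡 7) p}
    (he : ∀ A ∈ holonomyAlgebra cov p, A e = 0)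
    {c d : ℝ → TangentSpace (𝓡 7) p →L[ℝ] TangentSpace (𝓡 7) p} (hc : ContDiff ℝ 1 c)
    (hd : ContDiff ℝ 1 d) (hc0 : c 0 = ContinuousLinearMap.id ℝ _)
    (hcH : ∀ s, c s ∈ holonomyGroup cov p) (hdH : ∀ s, d s ∈ holonomyGroup cov p)
    (hcd : ∀ s, c s ∘L d s = ContinuousLinearMap.id ℝ _)
    (hdc : ∀ s, d s ∘L c s = ContinuousLinearMap.id ℝ _) (s : ℝ) : c s e = e :=
  apply_eq_of_velocities (V := TangentSpace (𝓡 7) p) (G := holonomyGroup cov p)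
    (fun _ hP _ hQ => IsParallelTransport.trans hQ hP)
    (fun c A h1 h2 h3 h4 => he A ⟨c, h1, h2, h3, h4⟩) hc hd hc0 hcH hdH hcd hdc s

end Fixed

end G2Torsion

end

noncomputable section

namespace G2Torsion

theorem contDiff_conj {E V : Type*} [NormedAddCommGroup E] [NormedSpace ℝ E]
    [NormedAddCommGroup V] [NormedSpace ℝ V] (i : E →L[ℝ] V) (j : V →L[ℝ] E)
    {C : ℝ → E →L[ℝ] E} (hC : ContDiff ℝ 1 C) : ContDiff ℝ 1 fun s => i ∘L C s ∘L j :=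
  contDiff_const.clm_comp (hC.clm_comp contDiff_const)

/-! ### Extension of a vector killed by the holonomy algebra to a parallel field. -/

namespace LocalTransport

variable {M : Type*} [TopologicalSpace M] [ChartedSpace (EuclideanSpace ℝ (Fin 7)) M]
  [IsManifold (𝓡 7) ∞ M] {cov : Connection M} {q : M}

/-- `A`, read in the chart at `q`, is a parallel transport from `q` to the point with
coordinates `x`. -/
def Reaches (cov : Connection M) (q : M) (x : E7) (A : E7 →L[ℝ] E7) : Prop :=
  IsParallelTransport cov q ((extChartAt (𝓡 7) q).symm x)
    (coordVec q ((extChartAt (𝓡 7) q).symm x) ∘L A ∘L coordInv q q)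

theorem reaches_one (cov : Connection M) (q : M) :
    Reaches cov q (extChartAt (𝓡 7) q q) 1 := by
  -- The chart and its inverse return q only up to a propositional equality, which types of tangent
  -- spaces depend on; hence the generalization over y.
  have h : ∀ y, y = q →
      IsParallelTransport cov q y (coordVec q y ∘L (1 : E7 →L[ℝ] E7) ∘L coordInv q q) := by
    rintro y rfl
    convert IsParallelTransport.refl (cov := cov) y
    ext u : 1
    exact coordVec_coordInv (mem_chart_source _ _) u
  exact h _ (extChartAt_to_inv (I := 𝓡 7) q)

theorem Reaches.mem_holonomyGroup {A : E7 →L[ℝ] E7}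
    (h : Reaches cov q (extChartAt (𝓡 7) q q) A) :
    coordVec q q ∘L A ∘L coordInv q q ∈ holonomyGroup cov q := by
  have h' : ∀ y, y = q → IsParallelTransport cov q y (coordVec q y ∘L A ∘L coordInv q q) →
      coordVec q q ∘L A ∘L coordInv q q ∈ holonomyGroup cov q := by
    rintro y rfl hy
    exact hy
  exact h' _ (extChartAt_to_inv (I := 𝓡 7) q) h

variable (L : LocalTransport cov q)

/-- The domain of the local transport, as a subset of the model space. -/
def dom : Set E7 := Metric.ball (extChartAt (𝓡 7) q q) L.r

theorem symm_mem_chart_source {x : E7} (hx : x ∈ L.dom) :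
    (extChartAt (𝓡 7) q).symm x ∈ (chartAt E7 q).source := by
  rw [← extChartAt_source (𝓡 7)]
  exact (extChartAt (𝓡 7) q).map_target (L.ball_subset hx)

theorem reaches_forward {x v : E7} {A : E7 →L[ℝ] E7} (hx : x ∈ L.dom) (hv : x + v ∈ L.dom)
    (h : Reaches cov q x A) : Reaches cov q (x + v) (L.τ (x, v) * A) := by
  have h1 := L.forward x v hx hv q _ h
  unfold Reaches
  convert h1 using 1
  ext u : 1
  simp only [ContinuousLinearMap.comp_apply, mul_apply_eq_comp,
    coordInv_coordVec (L.symm_mem_chart_source hx)]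

theorem reaches_backward {x v : E7} {A : E7 →L[ℝ] E7} (hx : x ∈ L.dom) (hv : x + v ∈ L.dom)
    (h : Reaches cov q (x + v) A) : Reaches cov q x (Ring.inverse (L.τ (x, v)) * A) := by
  have h1 := L.backward x v hx hv q _ h
  unfold Reaches
  convert h1 using 1
  ext u : 1
  simp only [ContinuousLinearMap.comp_apply, mul_apply_eq_comp,
    coordInv_coordVec (L.symm_mem_chart_source hv)]

theorem add_smul_mem_dom {a : E7} (ha : extChartAt (𝓡 7) q q + a ∈ L.dom) {κ : ℝ}
    (hκ : |κ| ≤ 1) : extChartAt (𝓡 7) q q + κ • a ∈ L.dom := by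
  simp only [dom, Metric.mem_ball, dist_self_add_left, norm_smul, Real.norm_eq_abs] at ha ⊢
  exact (mul_le_of_le_one_left (norm_nonneg a) hκ).trans_lt ha

theorem center_mem_dom : extChartAt (𝓡 7) q q ∈ L.dom := Metric.mem_ball_self L.r_pos

theorem contDiff_τ_comp {x v : ℝ → E7} (hx : ContDiff ℝ 1 x) (hv : ContDiff ℝ 1 v)
    (h1 : ∀ s, x s ∈ L.dom) (h2 : ∀ s, x s + v s ∈ L.dom) :
    ContDiff ℝ 1 fun s => L.τ (x s, v s) := by
  rw [contDiff_iff_contDiffAt]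
  intro s
  exact (L.contDiffAt _ _ (h1 s) (h2 s)).comp s (hx.contDiffAt.prodMk hv.contDiffAt)

theorem contDiff_inverse_τ_comp {x v : ℝ → E7} (hx : ContDiff ℝ 1 x) (hv : ContDiff ℝ 1 v)
    (h1 : ∀ s, x s ∈ L.dom) (h2 : ∀ s, x s + v s ∈ L.dom) :
    ContDiff ℝ 1 fun s => Ring.inverse (L.τ (x s, v s)) := by
  rw [contDiff_iff_contDiffAt]
  intro s
  obtain ⟨u, hu⟩ := L.isUnit _ _ (h1 s) (h2 s)
  have h3 := contDiffAt_ringInverse ℝ (n := 1) u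
  rw [hu] at h3
  exact h3.comp s (L.contDiff_τ_comp hx hv h1 h2).contDiffAt

variable [RiemannianBundle (fun x : M => TangentSpace (𝓡 7) x)]

/-- The transport of a vector annihilated by the holonomy algebra around a small triangle. -/
theorem triangle {e : TangentSpace (𝓡 7) q} (he : ∀ A ∈ holonomyAlgebra cov q, A e = 0) {a b : E7}
    (ha : extChartAt (𝓡 7) q q + a ∈ L.dom) (hb : extChartAt (𝓡 7) q q + b ∈ L.dom) :
    L.τ (extChartAt (𝓡 7) q q + a, b - a) (L.τ (extChartAt (𝓡 7) q q, a) (coordInv q q e)) =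
      L.τ (extChartAt (𝓡 7) q q, b) (coordInv q q e) := by
  set x₀ := extChartAt (𝓡 7) q q with hx₀
  have h0 := L.center_mem_dom
  -- The triangle is scaled by sin s: this keeps it inside the ball for every real s, degenerates it
  -- at s = 0 and gives the full triangle at s = π/2. Curves in the holonomy group have to be
  -- defined on all of ℝ.
  have hA : ∀ s : ℝ, x₀ + Real.sin s • a ∈ L.dom := fun s =>
    L.add_smul_mem_dom ha (Real.abs_sin_le_one s)
  have hB : ∀ s : ℝ, x₀ + Real.sin s • b ∈ L.dom := fun s =>
    L.add_smul_mem_dom hb (Real.abs_sin_le_one s)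
  have hAB : ∀ s : ℝ, x₀ + Real.sin s • a + Real.sin s • (b - a) = x₀ + Real.sin s • b :=
    fun s => by rw [add_assoc, ← smul_add, add_sub_cancel]
  have hAB' : ∀ s : ℝ, x₀ + Real.sin s • a + Real.sin s • (b - a) ∈ L.dom := fun s => by
    rw [hAB]; exact hB s
  have hs : ∀ w : E7, ContDiff ℝ 1 fun s : ℝ => Real.sin s • w := fun w =>
    Real.contDiff_sin.smul contDiff_const
  set τ₁ : ℝ → E7 →L[ℝ] E7 := fun s => L.τ (x₀, Real.sin s • a)
  set τ₂ : ℝ → E7 →L[ℝ] E7 := fun s => L.τ (x₀ + Real.sin s • a, Real.sin s • (b - a))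
  set τ₃ : ℝ → E7 →L[ℝ] E7 := fun s => L.τ (x₀, Real.sin s • b)
  have hu₁ : ∀ s, IsUnit (τ₁ s) := fun s => L.isUnit _ _ h0 (hA s)
  have hu₂ : ∀ s, IsUnit (τ₂ s) := fun s => L.isUnit _ _ (hA s) (hAB' s)
  have hu₃ : ∀ s, IsUnit (τ₃ s) := fun s => L.isUnit _ _ h0 (hB s)
  -- C is the transport around the scaled triangle and D the transport around it in the opposite
  -- sense, which is its inverse.
  set C : ℝ → E7 →L[ℝ] E7 := fun s => Ring.inverse (τ₃ s) * (τ₂ s * (τ₁ s * 1)) with hCdef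
  set D : ℝ → E7 →L[ℝ] E7 := fun s =>
    Ring.inverse (τ₁ s) * (Ring.inverse (τ₂ s) * (τ₃ s * 1)) with hDdef
  have hC : ContDiff ℝ 1 C :=
    (L.contDiff_inverse_τ_comp contDiff_const (hs b) (fun _ => h0) hB).clm_comp
      ((L.contDiff_τ_comp (contDiff_const.add (hs a)) (hs (b - a)) hA hAB').clm_comp
        ((L.contDiff_τ_comp contDiff_const (hs a) (fun _ => h0) hA).clm_comp contDiff_const))
  have hD : ContDiff ℝ 1 D :=
    (L.contDiff_inverse_τ_comp contDiff_const (hs a) (fun _ => h0) hA).clm_comp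
      ((L.contDiff_inverse_τ_comp (contDiff_const.add (hs a)) (hs (b - a)) hA hAB').clm_comp
        ((L.contDiff_τ_comp contDiff_const (hs b) (fun _ => h0) hB).clm_comp contDiff_const))
  have hCR : ∀ s, Reaches cov q x₀ (C s) := fun s =>
    L.reaches_backward h0 (hB s) (hAB s ▸ L.reaches_forward (hA s) (hAB' s)
      (L.reaches_forward h0 (hA s) (reaches_one cov q)))
  have hDR : ∀ s, Reaches cov q x₀ (D s) := fun s =>
    L.reaches_backward h0 (hA s) (L.reaches_backward (hA s) (hAB' s)
      ((hAB s).symm ▸ L.reaches_forward h0 (hB s) (reaches_one cov q)))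
  have hCD : ∀ s, C s * D s = 1 := fun s => by
    simp only [C, D, mul_one, mul_assoc]
    rw [Ring.mul_inverse_cancel_left _ _ (hu₁ s), Ring.mul_inverse_cancel_left _ _ (hu₂ s),
      Ring.inverse_mul_cancel _ (hu₃ s)]
  have hDC : ∀ s, D s * C s = 1 := fun s => by
    simp only [C, D, mul_one, mul_assoc]
    rw [Ring.mul_inverse_cancel_left _ _ (hu₃ s), Ring.inverse_mul_cancel_left _ _ (hu₂ s),
      Ring.inverse_mul_cancel _ (hu₁ s)]
  have hq := mem_chart_source E7 q
  have hcomp : ∀ P Q : E7 →L[ℝ] E7, P * Q = 1 →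
      (coordVec q q ∘L P ∘L coordInv q q) ∘L (coordVec q q ∘L Q ∘L coordInv q q) =
        ContinuousLinearMap.id ℝ (TangentSpace (𝓡 7) q) := by
    intro P Q h
    ext u : 1
    have h2 := congrArg (fun R : E7 →L[ℝ] E7 => R (coordInv q q u)) h
    simp only [mul_apply_eq_comp] at h2
    simp only [ContinuousLinearMap.comp_apply, coordInv_coordVec hq]
    rw [h2]
    exact coordVec_coordInv hq u
  have hC0 : C 0 = 1 := by
    simp [C, τ₁, τ₂, τ₃, L.τ_zero]
  have key := apply_eq_of_holonomyAlgebra he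
    (c := fun s => coordVec q q ∘L C s ∘L coordInv q q)
    (d := fun s => coordVec q q ∘L D s ∘L coordInv q q)
    (contDiff_conj (V := TangentSpace (𝓡 7) q) _ _ hC)
    (contDiff_conj (V := TangentSpace (𝓡 7) q) _ _ hD)
    (by
      ext u : 1
      simp only [hC0]
      exact coordVec_coordInv hq u)
    (fun s => (hCR s).mem_holonomyGroup) (fun s => (hDR s).mem_holonomyGroup)
    (fun s => hcomp _ _ (hCD s)) (fun s => hcomp _ _ (hDC s)) (Real.pi / 2)
  have h1 := congrArg (coordInv q q) key
  simp only [ContinuousLinearMap.comp_apply, coordInv_coordVec hq] at h1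
  have h2 := congrArg (τ₃ (Real.pi / 2)) h1
  have h3 : τ₃ (Real.pi / 2) * C (Real.pi / 2) = τ₂ (Real.pi / 2) * τ₁ (Real.pi / 2) := by
    simp only [C, mul_one]
    rw [Ring.mul_inverse_cancel_left _ _ (hu₃ _)]
  have h4 := congrArg (fun R : E7 →L[ℝ] E7 => R (coordInv q q e)) h3
  simp only [mul_apply_eq_comp] at h4
  rw [h4] at h2
  simpa only [τ₁, τ₂, τ₃, Real.sin_pi_div_two, one_smul] using h2

include L in
/-- A vector annihilated by the holonomy algebra extends to a parallel vector field. -/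
theorem exists_parallelField {e : TangentSpace (𝓡 7) q}
    (he : ∀ A ∈ holonomyAlgebra cov q, A e = 0) :
    ∃ X : (y : M) → TangentSpace (𝓡 7) y, X q = e ∧
      ∀ᶠ y in nhds q, DiffFieldAt X y ∧ ∀ u, cov X y u = 0 := by
  set x₀ := extChartAt (𝓡 7) q q with hx₀
  -- Radial transport of e. The triangle with vertices x₀, x and x + v shows that z(x + v) is the
  -- transport of z(x) along v.
  set z : E7 → E7 := fun x => L.τ (x₀, x - x₀) (coordInv q q e) with hz
  refine ⟨fun y => coordVec q y (z (extChartAt (𝓡 7) q y)), ?_, ?_⟩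
  · simp only [hz, ← hx₀, sub_self, L.τ_zero]
    exact coordVec_coordInv (mem_chart_source E7 q) e
  · have h1 : ∀ᶠ y in nhds q, extChartAt (𝓡 7) q y ∈ L.dom :=
      (continuousAt_extChartAt (I := 𝓡 7) q).eventually
        (Metric.isOpen_ball.mem_nhds L.center_mem_dom)
    filter_upwards [h1, extChartAt_source_mem_nhds (I := 𝓡 7) q] with y hy hy'
    have h2 := L.parallelField (extChartAt (𝓡 7) q y) hy z (by
      have h3 : ∀ᶠ v in nhds (0 : E7), extChartAt (𝓡 7) q y + v ∈ L.dom :=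
        (by fun_prop : Continuous fun v : E7 => extChartAt (𝓡 7) q y + v).continuousAt.eventually
          (Metric.isOpen_ball.mem_nhds (by simp only [add_zero]; exact hy))
      filter_upwards [h3] with v hv
      have h4 := L.triangle he (a := extChartAt (𝓡 7) q y - x₀)
        (b := extChartAt (𝓡 7) q y + v - x₀) (by rwa [← hx₀, add_sub_cancel])
        (by rwa [← hx₀, add_sub_cancel])
      rw [← hx₀, add_sub_cancel, sub_sub_sub_cancel_right, add_sub_cancel_left] at h4
      exact h4.symm)
    rwa [(extChartAt (𝓡 7) q).left_inv hy'] at h2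

end LocalTransport

end G2Torsion

end

noncomputable section

namespace G2Torsion

/-! ### The Bianchi identity contracted with a parallel field. -/

section Bianchi

variable {M : Type*} [TopologicalSpace M] [ChartedSpace (EuclideanSpace ℝ (Fin 7)) M]
  [IsManifold (𝓡 7) ∞ M] {q : M} {f : SmoothBumpFunction (𝓡 7) q}

theorem hasFDerivAt_comp_chart_symm {g : M → ℝ} {y : M} (hy : y ∈ (chartAt E7 q).source)
    (hg : MDifferentiableAt (𝓡 7) 𝓘(ℝ, ℝ) g y) :
    HasFDerivAt (fun x => g ((extChartAt (𝓡 7) q).symm x))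
      (mfderiv (𝓡 7) 𝓘(ℝ, ℝ) g y ∘L coordVec q y : E7 →L[ℝ] ℝ) (extChartAt (𝓡 7) q y) := by
  have hy' : y ∈ (extChartAt (𝓡 7) q).source := by rwa [extChartAt_source]
  have e := (extChartAt (𝓡 7) q).left_inv hy'
  have h : ∀ y', y' = y → (extChartAt (𝓡 7) q).symm (extChartAt (𝓡 7) q y) = y' →
      HasMFDerivAt 𝓘(ℝ, E7) (𝓡 7) (extChartAt (𝓡 7) q).symm (extChartAt (𝓡 7) q y)
        (coordVec q y') := by
    rintro _ - rfl
    exact hasMFDerivAt_chart_symm ((extChartAt (𝓡 7) q).map_source hy')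
  rw [← e] at hg
  have h1 := hg.hasMFDerivAt.comp _ (h y rfl e)
  rw [e] at h1
  exact h1.hasFDerivAt

/-- Coordinate derivatives commute. -/
theorem mvfderiv_frame_comm {g : M → ℝ} {F : Fin 7 → M → ℝ}
    (hg : ∀ᶠ y in nhds q, MDifferentiableAt (𝓡 7) 𝓘(ℝ, ℝ) g y ∧
      ∀ i, mvfderiv (𝓡 7) g y (frameField f i y) = F i y)
    (hF : ∀ i, MDifferentiableAt (𝓡 7) 𝓘(ℝ, ℝ) (F i) q) (i k : Fin 7) :
    mvfderiv (𝓡 7) (F i) q (frameField f k q) = mvfderiv (𝓡 7) (F k) q (frameField f i q) := by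
  set e := extChartAt (𝓡 7) q
  have hq := mem_chart_source E7 q
  have hpt : IsFramePoint f q := (eventually_isFramePoint f).self_of_nhds
  have h1 : ∀ᶠ x in nhds (e q), HasFDerivAt (fun x => g (e.symm x))
      (∑ i, F i (e.symm x) • (EuclideanSpace.proj i : E7 →L[ℝ] ℝ)) x := by
    have hc : Filter.Tendsto e.symm (nhds (e q)) (nhds q) := by
      have := continuousAt_extChartAt_symm (I := 𝓡 7) q
      rwa [ContinuousAt, extChartAt_to_inv] at this
    filter_upwards [hc.eventually (hg.and (eventually_isFramePoint f)),
      extChartAt_target_mem_nhds (I := 𝓡 7) q] with x hx hxt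
    obtain ⟨⟨h1, h2⟩, h3⟩ := hx
    have h4 := hasFDerivAt_comp_chart_symm h3.1 h1
    have h5 : extChartAt (𝓡 7) q (e.symm x) = x := e.right_inv hxt
    rw [h5] at h4
    refine h4.congr_fderiv ?_
    ext w
    have h6 : mvfderiv (𝓡 7) g (e.symm x) (coordVec q (e.symm x) w) =
        ∑ i, w i * F i (e.symm x) := by
      rw [← h3.sum_smul, map_sum]
      simp only [map_smul, h2, smul_eq_mul]
    refine h6.trans ?_
    simp [mul_comm]
  have h2 : ∀ i, HasFDerivAt (fun x => F i (e.symm x))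
      (mfderiv (𝓡 7) 𝓘(ℝ, ℝ) (F i) q ∘L coordVec q q : E7 →L[ℝ] ℝ) (e q) := fun i =>
    hasFDerivAt_comp_chart_symm hq (hF i)
  have h3 : HasFDerivAt (fun x => ∑ i, F i (e.symm x) • (EuclideanSpace.proj i : E7 →L[ℝ] ℝ))
      (∑ i, (mfderiv (𝓡 7) 𝓘(ℝ, ℝ) (F i) q ∘L coordVec q q : E7 →L[ℝ] ℝ).smulRight
        (EuclideanSpace.proj i : E7 →L[ℝ] ℝ)) (e q) :=
    HasFDerivAt.fun_sum fun i _ => (h2 i).smul_const (F := E7 →L[ℝ] ℝ) (EuclideanSpace.proj i)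
  have h4 := second_derivative_symmetric_of_eventually h1 h3 (stdVec k) (stdVec i)
  have h5 : ∀ a b : Fin 7, (∑ i, (mfderiv (𝓡 7) 𝓘(ℝ, ℝ) (F i) q ∘L coordVec q q :
      E7 →L[ℝ] ℝ).smulRight (EuclideanSpace.proj i : E7 →L[ℝ] ℝ)) (stdVec a) (stdVec b) =
      mvfderiv (𝓡 7) (F b) q (frameField f a q) := by
    intro a b
    rw [hpt.frameField]
    simp only [sum_apply, ContinuousLinearMap.smulRight_apply, smul_apply]
    rw [Finset.sum_eq_single b]
    · simp [stdVec]
      rfl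
    · intro c _ hc
      simp [stdVec, hc]
    · simp
  rwa [h5, h5] at h4

variable [RiemannianBundle (fun x : M => TangentSpace (𝓡 7) x)]
  [IsContMDiffRiemannianBundle (𝓡 7) ∞ E7 (fun x : M => TangentSpace (𝓡 7) x)]

/-- The derivative of the metric pairing of a parallel field. -/
theorem mvfderiv_inner_parallel {cov : Connection M} (hm : cov.IsMetricCompatible)
    {X Y : (y : M) → TangentSpace (𝓡 7) y} {y : M} (hX : DiffFieldAt X y) (hY : DiffFieldAt Y y)
    (hX0 : ∀ u, cov X y u = 0) (Z : (y : M) → TangentSpace (𝓡 7) y) :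
    mvfderiv (𝓡 7) (fun y => inner ℝ (X y) (Y y)) y (Z y) = inner ℝ (X y) (cov Y y (Z y)) := by
  have h := hm.mvfderiv_inner_eq Z hX hY
  have h0 : inner ℝ (cov X y (Z y)) (Y y) = 0 := by rw [hX0, inner_zero_left]
  exact h.trans (by
    change inner ℝ (cov X y (Z y)) (Y y) + inner ℝ (X y) (cov Y y (Z y)) = _
    rw [h0, zero_add])

/-- For parallel X and frame fields σ, put F i j = ⟨X, ∇_i σ_j⟩ = ∂_i ⟨X, σ_j⟩. Then T(σ_i, σ_j, X)
= F i j - F j i is the differential of the 1-form dual to X, and d² = 0 is the commutation of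
coordinate derivatives. Since T and X are parallel, ∂_k T(σ_i, σ_j, X) is algebraic in the ∇σ, and
its cyclic sum assembles into terms T(T(·,·),·,X). -/
theorem bianchi_frame [T2Space M] {cov : Connection M}
    (hcov : CovariantDerivative.ContMDiffCovariantDerivative cov ∞)
    (hm : cov.IsMetricCompatible) (hpar : IsParallelTensor cov (torsionTensor cov))
    (hsk : ∀ u v w : TangentSpace (𝓡 7) q,
      torsionTensor cov q u v w = -torsionTensor cov q v u w)
    {X : (y : M) → TangentSpace (𝓡 7) y}
    (hX : ∀ᶠ y in nhds q, DiffFieldAt X y ∧ ∀ u, cov X y u = 0) (f : SmoothBumpFunction (𝓡 7) q)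
    (i j k : Fin 7) :
    torsionTensor cov q (cov.torsion q (frameField f k q) (frameField f i q))
        (frameField f j q) (X q) +
      torsionTensor cov q (cov.torsion q (frameField f i q) (frameField f j q))
        (frameField f k q) (X q) +
      torsionTensor cov q (cov.torsion q (frameField f j q) (frameField f k q))
        (frameField f i q) (X q) = 0 := by
  have hσ : ∀ (i : Fin 7) (y : M), DiffFieldAt (frameField f i) y := fun i y =>
    diffFieldAt_frameField i y
  have hpt : IsFramePoint f q := (eventually_isFramePoint f).self_of_nhds
  obtain ⟨hXq, hXq0⟩ := hX.self_of_nhds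
  set F : Fin 7 → Fin 7 → M → ℝ := fun i j y =>
    inner ℝ (X y) (cov (frameField f j) y (frameField f i y)) with hFdef
  have hF : ∀ i j, MDifferentiableAt (𝓡 7) 𝓘(ℝ, ℝ) (F i j) q := fun i j =>
    hXq.inner (mdifferentiableAt_cov_frameField hcov j (hσ i q))
  have hcomm : ∀ i j k, mvfderiv (𝓡 7) (F i j) q (frameField f k q) =
      mvfderiv (𝓡 7) (F k j) q (frameField f i q) := by
    intro i j k
    refine mvfderiv_frame_comm (F := fun i => F i j)
      (g := fun y => inner ℝ (X y) (frameField f j y)) ?_ (fun i => hF i j) i k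
    filter_upwards [hX] with y hy
    exact ⟨hy.1.inner (hσ j y), fun i => mvfderiv_inner_parallel hm hy.1 (hσ j y) hy.2 _⟩
  have hβ : ∀ i j k, mvfderiv (𝓡 7) (F i j) q (frameField f k q) -
      mvfderiv (𝓡 7) (F j i) q (frameField f k q) =
      torsionTensor cov q (cov (frameField f i) q (frameField f k q)) (frameField f j q) (X q) +
      torsionTensor cov q (frameField f i q) (cov (frameField f j) q (frameField f k q))
        (X q) := by
    intro i j k
    have h1 := hpar q (frameField f i) (frameField f j) X (hσ i q) (hσ j q) hXq (frameField f k q)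
    rw [hXq0, torsionTensor_zero₃, add_zero] at h1
    rw [← h1]
    have h2 : (fun y => torsionTensor cov y (frameField f i y) (frameField f j y) (X y))
        =ᶠ[nhds q] F i j - F j i := by
      filter_upwards [eventually_isFramePoint f] with y hy
      simp only [torsionTensor, hy.torsion_frameField, hFdef, Pi.sub_apply]
      rw [real_inner_comm, inner_sub_right]
    have h3 : mvfderiv (𝓡 7) (fun y => torsionTensor cov y (frameField f i y) (frameField f j y)
        (X y)) q = mvfderiv (𝓡 7) (F i j - F j i) q := by
      simp only [mvfderiv]
      rw [h2.mfderiv_eq, h2.eq_of_nhds]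
      rfl
    rw [h3, mvfderiv_sub (hF i j) (hF j i)]
    rfl
  have e : ∀ i j k, torsionTensor cov q (cov.torsion q (frameField f i q) (frameField f j q))
        (frameField f k q) (X q) =
      torsionTensor cov q (cov (frameField f j) q (frameField f i q)) (frameField f k q) (X q) -
      torsionTensor cov q (cov (frameField f i) q (frameField f j q)) (frameField f k q)
        (X q) := by
    intro i j k
    rw [hpt.torsion_frameField]
    simp only [torsionTensor, map_sub, sub_apply, inner_sub_left]
  rw [e, e, e]
  have b1 := hβ i j k
  have b2 := hβ j k i
  have b3 := hβ k i j
  -- This brings the covariant derivatives into the first slot, where they combine into torsions.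
  rw [hsk (frameField f _ q)] at b1 b2 b3
  linear_combination (-1) * b1 - b2 - b3 + hcomm i j k + hcomm j k i + hcomm k i j

/-- The Bianchi identity for a parallel torsion tensor, contracted with a parallel field. -/
theorem bianchi [T2Space M] {cov : Connection M}
    (hcov : CovariantDerivative.ContMDiffCovariantDerivative cov ∞)
    (hm : cov.IsMetricCompatible) (hpar : IsParallelTensor cov (torsionTensor cov))
    (hsk : ∀ u v w : TangentSpace (𝓡 7) q,
      torsionTensor cov q u v w = -torsionTensor cov q v u w)
    {e : TangentSpace (𝓡 7) q} (he : ∀ A ∈ holonomyAlgebra cov q, A e = 0)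
    (u v w : TangentSpace (𝓡 7) q) :
    torsionTensor cov q (cov.torsion q u v) w e + torsionTensor cov q (cov.torsion q v w) u e +
      torsionTensor cov q (cov.torsion q w u) v e = 0 := by
  obtain ⟨L⟩ := nonempty_localTransport hcov q
  obtain ⟨X, rfl, hX⟩ := L.exists_parallelField he
  obtain ⟨f⟩ : Nonempty (SmoothBumpFunction (𝓡 7) q) := inferInstance
  have hpt : IsFramePoint f q := (eventually_isFramePoint f).self_of_nhds
  set Λ : TangentSpace (𝓡 7) q → TangentSpace (𝓡 7) q → TangentSpace (𝓡 7) q → ℝ := fun u v w =>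
    torsionTensor cov q (cov.torsion q u v) w (X q) +
      torsionTensor cov q (cov.torsion q v w) u (X q) +
      torsionTensor cov q (cov.torsion q w u) v (X q) with hΛ
  have hlin : ∀ v w, (∀ i, Λ (frameField f i q) v w = 0) → ∀ u, Λ u v w = 0 := by
    intro v w h u
    have hu : u = ∑ i, coordInv q q u i • frameField f i q := by
      rw [hpt.sum_smul, coordVec_coordInv hpt.1]
    have h2 : Λ u v w = ∑ i, coordInv q q u i * Λ (frameField f i q) v w := by
      conv_lhs => rw [hu]
      simp only [hΛ, torsionTensor, map_sum, map_smul, sum_apply, smul_apply, sum_inner,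
        real_inner_smul_left, mul_add, Finset.sum_add_distrib]
    rw [h2]
    simp [h]
  -- By cyclic symmetry, linearity in the first slot reduces every slot to frame vectors.
  have hcyc : ∀ u v w, Λ u v w = Λ v w u := fun u v w => by simp only [hΛ]; ring
  have h0 : ∀ i j k, Λ (frameField f i q) (frameField f j q) (frameField f k q) = 0 :=
    fun i j k => by
      have := bianchi_frame hcov hm hpar hsk hX f j k i
      simp only [hΛ]
      linear_combination this
  refine hlin v w (fun i => ?_) u
  rw [hcyc]
  refine hlin w _ (fun j => ?_) v
  rw [hcyc]
  refine hlin _ _ (fun k => ?_) w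
  rw [hcyc]
  exact h0 i j k

end Bianchi

/-! ### Propagation of the vanishing of the torsion. -/

section Vanishing

variable {M : Type*} [TopologicalSpace M] [ChartedSpace (EuclideanSpace ℝ (Fin 7)) M]
  [IsManifold (𝓡 7) ∞ M] [RiemannianBundle (fun x : M => TangentSpace (𝓡 7) x)]
  [IsContMDiffRiemannianBundle (𝓡 7) ∞ E7 (fun x : M => TangentSpace (𝓡 7) x)]

/-- Transport along the segment from q to y is invertible and pulls the torsion at y back to the
torsion at q. -/
theorem eventually_torsionTensor_zero_iff [T2Space M] {cov : Connection M}
    (hcov : CovariantDerivative.ContMDiffCovariantDerivative cov ∞)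
    (hpar : IsParallelTensor cov (torsionTensor cov)) (q : M) :
    ∀ᶠ y in nhds q, (torsionTensor cov y = 0 ↔ torsionTensor cov q = 0) := by
  obtain ⟨L⟩ := nonempty_localTransport hcov q
  have h1 : ∀ᶠ y in nhds q, extChartAt (𝓡 7) q y ∈ L.dom :=
    (continuousAt_extChartAt (I := 𝓡 7) q).eventually
      (Metric.isOpen_ball.mem_nhds L.center_mem_dom)
  filter_upwards [h1, extChartAt_source_mem_nhds (I := 𝓡 7) q] with y hy hy'
  set x₀ := extChartAt (𝓡 7) q q
  set v := extChartAt (𝓡 7) q y - x₀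
  have hv : x₀ + v = extChartAt (𝓡 7) q y := add_sub_cancel _ _
  have h2 := L.reaches_forward (v := v) L.center_mem_dom (hv ▸ hy)
    (LocalTransport.reaches_one cov q)
  rw [hv] at h2
  have h3 : ∀ y', y' = y → IsParallelTransport cov q y' (coordVec q y' ∘L (L.τ (x₀, v) * 1) ∘L
      coordInv q q) → IsParallelTransport cov q y (coordVec q y ∘L (L.τ (x₀, v) * 1) ∘L
      coordInv q q) := by
    rintro _ rfl h
    exact h
  have h4 := h3 _ ((extChartAt (𝓡 7) q).left_inv hy') h2
  have h5 := fun u v w => h4.torsionTensor_eq hcov hpar u v w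
  have hyc : y ∈ (chartAt E7 q).source := by rwa [extChartAt_source] at hy'
  have hu := L.isUnit x₀ v L.center_mem_dom (hv ▸ hy)
  have hsurj : ∀ u : TangentSpace (𝓡 7) y, ∃ u', (coordVec q y ∘L (L.τ (x₀, v) * 1) ∘L
      coordInv q q) u' = u := fun u => by
    refine ⟨coordVec q q (Ring.inverse (L.τ (x₀, v)) (coordInv q y u)), ?_⟩
    have h6 := congrArg (fun R : E7 →L[ℝ] E7 => R (coordInv q y u))
      (Ring.mul_inverse_cancel _ hu)
    simp only [mul_apply_eq_comp] at h6
    simp only [ContinuousLinearMap.comp_apply, mul_one,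
      coordInv_coordVec (mem_chart_source E7 q)]
    rw [h6]
    exact coordVec_coordInv hyc u
  constructor
  · intro h
    ext a b c
    rw [← h5, h]
    rfl
  · intro h
    ext a b c
    obtain ⟨a, rfl⟩ := hsurj a
    obtain ⟨b, rfl⟩ := hsurj b
    obtain ⟨c, rfl⟩ := hsurj c
    rw [h5, h]
    rfl

/-- A parallel torsion tensor vanishing at one point of a connected manifold vanishes. -/
theorem torsionTensor_eq_zero_of_point [T2Space M] [ConnectedSpace M] {cov : Connection M}
    (hcov : CovariantDerivative.ContMDiffCovariantDerivative cov ∞)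
    (hpar : IsParallelTensor cov (torsionTensor cov)) {p : M} (hp : torsionTensor cov p = 0)
    (x : M) : torsionTensor cov x = 0 := by
  have h : IsLocallyConstant fun y => torsionTensor cov y = 0 := by
    rw [IsLocallyConstant.iff_eventually_eq]
    intro q
    filter_upwards [eventually_torsionTensor_zero_iff hcov hpar q] with y hy
    exact propext hy
  have h2 := h.apply_eq_of_preconnectedSpace x p
  simp only [eq_iff_iff] at h2
  exact h2.2 hp

end Vanishing

end G2Torsion

end

noncomputable section

namespace G2Torsion

/-! ### 3-forms on ℝ⁷ in components and the equations of Λ³₂₇. -/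

section ThreeForms

theorem stdVec_apply (i a : Fin 7) : stdVec i a = if a = i then 1 else 0 := by
  simp [stdVec]

theorem wedge_stdVec (a b i : Fin 7) :
    wedge a b (stdVec i) = (if a = i then stdVec b else 0) - (if b = i then stdVec a else 0) := by
  simp [wedge, stdVec_apply]

/-- Alternating trilinear forms on `ℝ⁷`. -/
structure IsThreeForm (T : E7 → E7 → E7 → ℝ) : Prop where
  add_left : ∀ u u' v w, T (u + u') v w = T u v w + T u' v w
  smul_left : ∀ (c : ℝ) u v w, T (c • u) v w = c * T u v w
  swap_left : ∀ u v w, T u v w = -T v u w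
  swap_right : ∀ u v w, T u v w = -T u w v

/-- The components of a 3-form. -/
def comp (T : E7 → E7 → E7 → ℝ) (i j k : Fin 7) : ℝ := T (stdVec i) (stdVec j) (stdVec k)

/-- The components of a 3-form are alternating. -/
structure IsAlternating (t : Fin 7 → Fin 7 → Fin 7 → ℝ) : Prop where
  swap_left : ∀ i j k, t i j k = -t j i k
  swap_right : ∀ i j k, t i j k = -t i k j

namespace IsAlternating

variable {t : Fin 7 → Fin 7 → Fin 7 → ℝ} (ht : IsAlternating t)
include ht

/-- The inequality, discharged by `decide`, turns antisymmetry into a terminating rewrite rule that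
sorts indices. -/
theorem sort_left (i j k : Fin 7) (_ : j < i) : t i j k = -t j i k := ht.swap_left i j k

theorem sort_right (i j k : Fin 7) (_ : k < j) : t i j k = -t i k j := ht.swap_right i j k

theorem diag_left (i k : Fin 7) : t i i k = 0 := by linarith [ht.swap_left i i k]

theorem diag_right (i k : Fin 7) : t k i i = 0 := by linarith [ht.swap_right k i i]

theorem eq_zero_of_sorted (key : ∀ i j k : Fin 7, i < j → j < k → t i j k = 0) (i j k : Fin 7) :
    t i j k = 0 := by
  have key2 : ∀ i j k : Fin 7, i < j → t i j k = 0 := by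
    intro i j k hij
    rcases lt_trichotomy j k with h | rfl | h
    · exact key i j k hij h
    · exact ht.diag_right _ _
    · rw [ht.swap_right, neg_eq_zero]
      rcases lt_trichotomy i k with h' | rfl | h'
      · exact key i k j h' h
      · exact ht.diag_left _ _
      · rw [ht.swap_left, key k i j h' hij, neg_zero]
  rcases lt_trichotomy i j with h | rfl | h
  · exact key2 i j k h
  · exact ht.diag_left _ _
  · rw [ht.swap_left, key2 j i k h, neg_zero]

end IsAlternating

theorem IsThreeForm.isAlternating {T : E7 → E7 → E7 → ℝ} (hT : IsThreeForm T) :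
    IsAlternating (comp T) :=
  ⟨fun _ _ _ => hT.swap_left _ _ _, fun _ _ _ => hT.swap_right _ _ _⟩

theorem IsThreeForm.sum_left {T : E7 → E7 → E7 → ℝ} (hT : IsThreeForm T) (u v w : E7) :
    T u v w = ∑ a, u a * T (stdVec a) v w := by
  let L : E7 →ₗ[ℝ] ℝ :=
    { toFun := fun u => T u v w
      map_add' := fun x y => hT.add_left x y v w
      map_smul' := fun c x => hT.smul_left c x v w }
  have h : L u = ∑ a, u a * L (stdVec a) := by
    conv_lhs => rw [← sum_smul_stdVec u]
    simp
  exact h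

theorem IsThreeForm.sum_mid {T : E7 → E7 → E7 → ℝ} (hT : IsThreeForm T) (u v w : E7) :
    T u v w = ∑ a, v a * T u (stdVec a) w := by
  rw [hT.swap_left, hT.sum_left, ← Finset.sum_neg_distrib]
  exact Finset.sum_congr rfl fun a _ => by rw [hT.swap_left (stdVec a)]; ring

theorem IsThreeForm.sum_right {T : E7 → E7 → E7 → ℝ} (hT : IsThreeForm T) (u v w : E7) :
    T u v w = ∑ a, w a * T u v (stdVec a) := by
  rw [hT.swap_right, hT.sum_mid, ← Finset.sum_neg_distrib]
  exact Finset.sum_congr rfl fun a _ => by rw [hT.swap_right u (stdVec a)]; ring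

theorem IsThreeForm.eq_zero {T : E7 → E7 → E7 → ℝ} (hT : IsThreeForm T)
    (h : ∀ i j k, comp T i j k = 0) (u v w : E7) : T u v w = 0 := by
  rw [hT.sum_left]
  refine Finset.sum_eq_zero fun i _ => ?_
  rw [hT.sum_mid, Finset.sum_eq_zero, mul_zero]
  intro j _
  rw [hT.sum_right, Finset.sum_eq_zero, mul_zero]
  intro k _
  rw [show T (stdVec i) (stdVec j) (stdVec k) = 0 from h i j k, mul_zero]

/-- An infinitesimal symmetry of a 3-form, in components. -/
theorem IsThreeForm.invariant_comp {T : E7 → E7 → E7 → ℝ} (hT : IsThreeForm T) {A : E7 →L[ℝ] E7}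
    (hA : ∀ u v w, T (A u) v w + T u (A v) w + T u v (A w) = 0) (i j k : Fin 7) :
    ∑ a, A (stdVec i) a * comp T a j k + ∑ a, A (stdVec j) a * comp T i a k +
      ∑ a, A (stdVec k) a * comp T i j a = 0 := by
  have h := hA (stdVec i) (stdVec j) (stdVec k)
  rwa [hT.sum_left (A _), hT.sum_mid _ (A _), hT.sum_right _ _ (A _)] at h

theorem phi0_isThreeForm : IsThreeForm phi0 where
  add_left := phi0_add₁
  smul_left := phi0_smul₁
  swap_left u v w := by simp only [phi0, elem3, Matrix.det_fin_three]; simp; ring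
  swap_right u v w := by simp only [phi0, elem3, Matrix.det_fin_three]; simp; ring

theorem sum_mul_elem3 (F : Fin 7 → Fin 7 → Fin 7 → ℝ) (a b c : Fin 7) :
    ∑ i, ∑ j, ∑ k, F i j k * elem3 a b c (stdVec i) (stdVec j) (stdVec k) =
      F a b c - F a c b - F b a c + F c a b + F b c a - F c b a := by
  simp only [elem3, Matrix.det_fin_three, stdVec_apply]
  simp [mul_add, mul_sub, Finset.sum_add_distrib, Finset.sum_sub_distrib]
  ring

/-- Expansion of the determinant along the row v leaves elementary 3-forms; 6 = 3! counts the
orderings of each index triple. -/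
theorem sum_mul_elem4 (F : Fin 7 → Fin 7 → Fin 7 → ℝ) (hF : IsAlternating F) (a b c d : Fin 7)
    (v : E7) :
    ∑ i, ∑ j, ∑ k, F i j k * elem4 a b c d v (stdVec i) (stdVec j) (stdVec k) =
      6 * (v a * F b c d - v b * F a c d + v c * F a b d - v d * F a b c) := by
  have h : ∀ x y z, elem4 a b c d v x y z = v a * elem3 b c d x y z - v b * elem3 a c d x y z +
      v c * elem3 a b d x y z - v d * elem3 a b c x y z := by
    intro x y z
    simp only [elem4, elem3, Matrix.det_succ_row_zero]
    simp [Fin.sum_univ_succ, Fin.succAbove]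
    ring
  have h2 : ∀ (s : ℝ) (a b c : Fin 7),
      ∑ i, ∑ j, ∑ k, F i j k * (s * elem3 a b c (stdVec i) (stdVec j) (stdVec k)) =
      6 * (s * F a b c) := by
    intro s a b c
    have e : ∀ i j k, F i j k * (s * elem3 a b c (stdVec i) (stdVec j) (stdVec k)) =
        s * (F i j k * elem3 a b c (stdVec i) (stdVec j) (stdVec k)) := fun _ _ _ => by ring
    simp only [e, ← Finset.mul_sum]
    rw [sum_mul_elem3]
    rw [hF.swap_right a c b, hF.swap_left b a c, hF.swap_left c a b, hF.swap_right a c b,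
      hF.swap_left c b a, hF.swap_right b c a, hF.swap_left b a c]
    ring
  simp only [h, mul_add, mul_sub, Finset.sum_add_distrib, Finset.sum_sub_distrib, h2]

theorem sum_mul_phi0 {T : E7 → E7 → E7 → ℝ} (hT : IsThreeForm T) (h : InLambda27 T) :
    comp T 0 1 6 + comp T 0 2 4 - comp T 0 3 5 - comp T 1 2 5 - comp T 1 3 4 + comp T 2 3 6 +
      comp T 4 5 6 = 0 := by
  have h1 := h.1
  change ∑ i, ∑ j, ∑ k, comp T i j k * _ = 0 at h1
  have ht := hT.isAlternating
  simp only [phi0, mul_add, mul_sub, Finset.sum_add_distrib, Finset.sum_sub_distrib,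
    sum_mul_elem3] at h1
  simp (disch := decide) only [ht.sort_left, ht.sort_right] at h1
  linarith

theorem sum_mul_starPhi0 {T : E7 → E7 → E7 → ℝ} (hT : IsThreeForm T) (h : InLambda27 T) (v : E7) :
    v 0 * (comp T 3 4 6 + comp T 2 5 6 + comp T 1 4 5 + comp T 1 2 3) +
    v 1 * (comp T 2 4 6 - comp T 3 5 6 - comp T 0 4 5 - comp T 0 2 3) +
    v 2 * (comp T 3 4 5 - comp T 1 4 6 - comp T 0 5 6 + comp T 0 1 3) +
    v 3 * (comp T 1 5 6 - comp T 2 4 5 - comp T 0 4 6 - comp T 0 1 2) +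
    v 4 * (comp T 2 3 5 + comp T 1 2 6 + comp T 0 3 6 + comp T 0 1 5) +
    v 5 * (-comp T 2 3 4 - comp T 1 3 6 + comp T 0 2 6 - comp T 0 1 4) +
    v 6 * (comp T 1 3 5 - comp T 1 2 4 - comp T 0 3 4 - comp T 0 2 5) = 0 := by
  have h1 := h.2 v
  change ∑ i, ∑ j, ∑ k, comp T i j k * _ = 0 at h1
  simp only [starPhi0, mul_add, mul_sub, Finset.sum_add_distrib, Finset.sum_sub_distrib,
    sum_mul_elem4 _ hT.isAlternating] at h1
  linarith

end ThreeForms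

end G2Torsion

end

noncomputable section

namespace G2Torsion

/-! ### Invariant forms for 𝔰𝔲(2) and 𝔰𝔲(3) and their elimination by the Bianchi identity. -/

section SpecialUnitary

/-- `T` is invariant under the infinitesimal transformation `A`. -/
def IsInvariant (T : E7 → E7 → E7 → ℝ) (A : E7 →L[ℝ] E7) : Prop :=
  ∀ u v w, T (A u) v w + T u (A v) w + T u v (A w) = 0

/-- The Bianchi identity of a parallel torsion form contracted with the basis vector `m`. -/
def IsBianchi (t : Fin 7 → Fin 7 → Fin 7 → ℝ) (m : Fin 7) : Prop :=
  ∀ i j k, ∑ l, (t i j l * t l k m + t j k l * t l i m + t k i l * t l j m) = 0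

variable {T : E7 → E7 → E7 → ℝ} (hT : IsThreeForm T)
  (h1 : IsInvariant T (wedge 0 2 + wedge 1 3)) (h2 : IsInvariant T (wedge 0 3 - wedge 1 2))

include hT h1

/-- The generator e₁₃ + e₂₄ is invertible on ℝ⁴, so it has no invariants in Λ³ℝ⁴, which is ℝ⁴ up to
duality. -/
theorem comp_eq_zero_of_low :
    comp T 0 1 2 = 0 ∧ comp T 0 1 3 = 0 ∧ comp T 0 2 3 = 0 ∧ comp T 1 2 3 = 0 := by
  have ht := hT.isAlternating
  refine ⟨?_, ?_, ?_, ?_⟩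
  · have e := hT.invariant_comp h1 0 3 2
    simp [wedge_stdVec, stdVec_apply] at e
    simp (disch := decide) only [ht.sort_left, ht.sort_right, ht.diag_left, ht.diag_right] at e
    linarith
  · have e := hT.invariant_comp h1 1 2 3
    simp [wedge_stdVec, stdVec_apply] at e
    simp (disch := decide) only [ht.sort_left, ht.sort_right, ht.diag_left, ht.diag_right] at e
    linarith
  · have e := hT.invariant_comp h1 0 1 2
    simp [wedge_stdVec, stdVec_apply] at e
    simp (disch := decide) only [ht.sort_left, ht.sort_right, ht.diag_left, ht.diag_right] at e
    linarith
  · have e := hT.invariant_comp h1 0 1 3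
    simp [wedge_stdVec, stdVec_apply] at e
    simp (disch := decide) only [ht.sort_left, ht.sort_right, ht.diag_left, ht.diag_right] at e
    linarith

/-- The generator kills e₅, e₆, e₇ and is invertible on ℝ⁴, so no invariant has exactly one leg in
ℝ⁴. -/
theorem comp_eq_zero_of_high {m n : Fin 7} (hm : m = 4 ∨ m = 5 ∨ m = 6)
    (hn : n = 4 ∨ n = 5 ∨ n = 6) :
    comp T 0 m n = 0 ∧ comp T 1 m n = 0 ∧ comp T 2 m n = 0 ∧ comp T 3 m n = 0 := by
  have e2 := hT.invariant_comp h1 0 m n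
  have e3 := hT.invariant_comp h1 1 m n
  have e0 := hT.invariant_comp h1 2 m n
  have e1 := hT.invariant_comp h1 3 m n
  rcases hm with rfl | rfl | rfl <;> rcases hn with rfl | rfl | rfl <;>
    simp [wedge_stdVec, stdVec_apply] at e0 e1 e2 e3 <;> exact ⟨e0, e1, e2, e3⟩

include h2

/-- Contracting T with e_m gives a 2-form on ℝ⁴ invariant under two generators of 𝔰𝔲(2). Such a
2-form is a combination of e₁₂ + e₃₄, e₁₃ - e₂₄ and e₁₄ + e₂₃. -/
theorem comp_selfDual {m : Fin 7} (hm : m = 4 ∨ m = 5 ∨ m = 6) :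
    comp T 2 3 m = comp T 0 1 m ∧ comp T 1 3 m = -comp T 0 2 m ∧
      comp T 1 2 m = comp T 0 3 m := by
  have ht := hT.isAlternating
  have e1 := hT.invariant_comp h1 0 3 m
  have e2 := hT.invariant_comp h2 0 1 m
  have e3 := hT.invariant_comp h1 0 1 m
  rcases hm with rfl | rfl | rfl <;> simp [wedge_stdVec, stdVec_apply] at e1 e2 e3 <;>
    simp (disch := decide) only [ht.sort_left, ht.sort_right, ht.diag_left, ht.diag_right]
      at e1 e2 e3 <;> exact ⟨by linarith, by linarith, by linarith⟩

/-- The symmetry of the nine remaining components. -/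
theorem comp_symm (hΛ : InLambda27 T) :
    comp T 0 3 6 = -comp T 0 1 5 ∧ comp T 0 2 6 = comp T 0 1 4 ∧ comp T 0 2 5 = -comp T 0 3 4 ∧
      comp T 4 5 6 = -2 * (comp T 0 1 6 + comp T 0 2 4 - comp T 0 3 5) := by
  have h0 := sum_mul_phi0 hT hΛ
  have e4 := sum_mul_starPhi0 hT hΛ (stdVec 4)
  have e5 := sum_mul_starPhi0 hT hΛ (stdVec 5)
  have e6 := sum_mul_starPhi0 hT hΛ (stdVec 6)
  simp [stdVec_apply] at e4 e5 e6
  obtain ⟨a1, a2, a3⟩ := comp_selfDual hT h1 h2 (m := 4) (by simp)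
  obtain ⟨b1, b2, b3⟩ := comp_selfDual hT h1 h2 (m := 5) (by simp)
  obtain ⟨c1, c2, c3⟩ := comp_selfDual hT h1 h2 (m := 6) (by simp)
  exact ⟨by linarith, by linarith, by linarith, by linarith⟩

theorem comp_eq_zero_of_nine (hΛ : InLambda27 T)
    (h : ∀ n : Fin 7, n = 4 ∨ n = 5 ∨ n = 6 →
      comp T 0 1 n = 0 ∧ comp T 0 2 n = 0 ∧ comp T 0 3 n = 0) (i j k : Fin 7) :
    comp T i j k = 0 := by
  have ht := hT.isAlternating
  obtain ⟨l1, l2, l3, l4⟩ := comp_eq_zero_of_low hT h1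
  obtain ⟨a1, a2, a3, a4⟩ := comp_eq_zero_of_high hT h1 (m := 4) (n := 5) (by simp) (by simp)
  obtain ⟨b1, b2, b3, b4⟩ := comp_eq_zero_of_high hT h1 (m := 4) (n := 6) (by simp) (by simp)
  obtain ⟨c1, c2, c3, c4⟩ := comp_eq_zero_of_high hT h1 (m := 5) (n := 6) (by simp) (by simp)
  obtain ⟨d1, d2, d3⟩ := h 4 (by simp)
  obtain ⟨e1, e2, e3⟩ := h 5 (by simp)
  obtain ⟨f1, f2, f3⟩ := h 6 (by simp)
  obtain ⟨g1, g2, g3⟩ := comp_selfDual hT h1 h2 (m := 4) (by simp)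
  obtain ⟨h1', h2', h3'⟩ := comp_selfDual hT h1 h2 (m := 5) (by simp)
  obtain ⟨i1, i2, i3⟩ := comp_selfDual hT h1 h2 (m := 6) (by simp)
  -- The remaining component e₅₆₇ is determined by the trace condition. The rewrites below put every
  -- sorted component into the shape `comp T i j k = 0` for `assumption`.
  obtain ⟨-, -, -, s⟩ := comp_symm hT h1 h2 hΛ
  rw [d1] at g1
  rw [d2] at g2
  rw [d3] at g3
  rw [e1] at h1'
  rw [e2] at h2'
  rw [e3] at h3'
  rw [f1] at i1
  rw [f2] at i2
  rw [f3] at i3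
  rw [f1, d2, e3] at s
  norm_num at s g2 h2' i2
  have key : ∀ i j k : Fin 7, i < j → j < k → comp T i j k = 0 := by
    intro i j k hij hjk
    fin_cases i <;> fin_cases j <;> first | (exfalso; revert hij; decide) | skip
    all_goals fin_cases k <;> first | (exfalso; revert hjk; decide) | assumption
  exact ht.eq_zero_of_sorted key i j k

/-- An `𝔰𝔲(2)`-invariant form in `Λ³₂₇` which satisfies the Bianchi identity contracted with the
fixed vectors vanishes. -/
theorem comp_eq_zero_of_su2 (hΛ : InLambda27 T)
    (hB : ∀ m : Fin 7, m = 4 ∨ m = 5 ∨ m = 6 → IsBianchi (comp T) m) (i j k : Fin 7) :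
    comp T i j k = 0 := by
  have ht := hT.isAlternating
  obtain ⟨l1, l2, l3, l4⟩ := comp_eq_zero_of_low hT h1
  obtain ⟨a1, a2, a3, a4⟩ := comp_eq_zero_of_high hT h1 (m := 4) (n := 5) (by simp) (by simp)
  obtain ⟨b1, b2, b3, b4⟩ := comp_eq_zero_of_high hT h1 (m := 4) (n := 6) (by simp) (by simp)
  obtain ⟨c1, c2, c3, c4⟩ := comp_eq_zero_of_high hT h1 (m := 5) (n := 6) (by simp) (by simp)
  obtain ⟨g1, g2, g3⟩ := comp_selfDual hT h1 h2 (m := 4) (by simp)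
  obtain ⟨h1', h2', h3'⟩ := comp_selfDual hT h1 h2 (m := 5) (by simp)
  obtain ⟨i1, i2, i3⟩ := comp_selfDual hT h1 h2 (m := 6) (by simp)
  obtain ⟨s1, s2, s3, s4⟩ := comp_symm hT h1 h2 hΛ
  -- The invariant form is now a symmetric 3 × 3 matrix S, pairing (e₁₂ + e₃₄, e₁₃ - e₂₄, -(e₁₄ +
  -- e₂₃)) with (e₇, e₅, e₆): its diagonal is x, y, -z and its off-diagonal entries are a, b, -d.
  -- These three components of the Bianchi identity add up to -(|S|² + (tr S)²).
  have q1 := hB 5 (by simp) 0 1 4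
  have q2 := hB 6 (by simp) 0 2 5
  have q3 := hB 6 (by simp) 0 3 4
  simp [Fin.sum_univ_succ, Fin.succ] at q1 q2 q3
  simp (disch := decide) only [ht.sort_left, ht.sort_right, ht.diag_left, ht.diag_right,
    l1, l2, l3, a1, a2, a3, a4, b1, b2, b3, b4, c1, c2, c3, c4, g1, g2, g3, h1', h2', h3',
    i1, i2, i3, s1, s2, s3, s4] at q1 q2 q3
  set x := comp T 0 1 6
  set y := comp T 0 2 4
  set z := comp T 0 3 5
  set a := comp T 0 1 4
  set b := comp T 0 1 5
  set d := comp T 0 3 4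
  have key : x ^ 2 + y ^ 2 + z ^ 2 + (x + y - z) ^ 2 + 2 * (a ^ 2 + b ^ 2 + d ^ 2) = 0 := by
    linear_combination (-1) * q1 - q2 - q3
  have hz : ∀ r : ℝ, r ^ 2 ≤ 0 → r = 0 := fun r hr => pow_eq_zero_iff two_ne_zero |>.1
    (le_antisymm hr (sq_nonneg r))
  have hx := sq_nonneg x
  have hy := sq_nonneg y
  have hz' := sq_nonneg z
  have hp := sq_nonneg (x + y - z)
  have ha := sq_nonneg a
  have hb := sq_nonneg b
  have hd := sq_nonneg d
  have x0 : x = 0 := hz x (by linarith)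
  have y0 : y = 0 := hz y (by linarith)
  have z0 : z = 0 := hz z (by linarith)
  have a0 : a = 0 := hz a (by linarith)
  have b0 : b = 0 := hz b (by linarith)
  have d0 : d = 0 := hz d (by linarith)
  refine comp_eq_zero_of_nine hT h1 h2 hΛ ?_ i j k
  rintro n (rfl | rfl | rfl)
  · exact ⟨a0, y0, d0⟩
  · exact ⟨b0, by rw [s3]; linarith, z0⟩
  · exact ⟨x0, by rw [s2]; exact a0, by rw [s1]; linarith⟩

/-- An `𝔰𝔲(3)`-invariant form in `Λ³₂₇` which satisfies the Bianchi identity contracted with the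
fixed vector vanishes. -/
theorem comp_eq_zero_of_su3 (h3 : IsInvariant T (wedge 0 1 - wedge 4 5))
    (h4 : IsInvariant T (wedge 2 4 + wedge 3 5)) (hΛ : InLambda27 T)
    (hB : IsBianchi (comp T) 6) (i j k : Fin 7) : comp T i j k = 0 := by
  have ht := hT.isAlternating
  obtain ⟨l1, l2, l3, l4⟩ := comp_eq_zero_of_low hT h1
  obtain ⟨a1, a2, a3, a4⟩ := comp_eq_zero_of_high hT h1 (m := 4) (n := 5) (by simp) (by simp)
  obtain ⟨b1, b2, b3, b4⟩ := comp_eq_zero_of_high hT h1 (m := 4) (n := 6) (by simp) (by simp)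
  obtain ⟨c1, c2, c3, c4⟩ := comp_eq_zero_of_high hT h1 (m := 5) (n := 6) (by simp) (by simp)
  obtain ⟨g1, g2, g3⟩ := comp_selfDual hT h1 h2 (m := 4) (by simp)
  obtain ⟨h1', h2', h3'⟩ := comp_selfDual hT h1 h2 (m := 5) (by simp)
  obtain ⟨i1, i2, i3⟩ := comp_selfDual hT h1 h2 (m := 6) (by simp)
  obtain ⟨s1, s2, s3, s4⟩ := comp_symm hT h1 h2 hΛ
  -- The two further elements of 𝔰𝔲(3) cut the 𝔰𝔲(2)-invariant family down to the single parameter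
  -- y, with a = b = d = 0, z = -y and 3x = -4y. One Bianchi component then is a multiple of y².
  have e1 := hT.invariant_comp h3 0 2 4
  have e2 := hT.invariant_comp h3 0 2 5
  have e3 := hT.invariant_comp h3 0 1 4
  have e4 := hT.invariant_comp h3 0 1 5
  have e5 := hT.invariant_comp h4 2 5 6
  have q2 := hB 0 2 5
  simp [wedge_stdVec, stdVec_apply] at e1 e2 e3 e4 e5
  simp [Fin.sum_univ_succ, Fin.succ] at q2
  simp (disch := decide) only [ht.sort_left, ht.sort_right, ht.diag_left, ht.diag_right,
    l1, l2, l3, a1, a2, a3, a4, b1, b2, b3, b4, c1, c2, c3, c4, g1, g2, g3, h1', h2', h3',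
    i1, i2, i3, s1, s2, s3, s4] at e1 e2 e3 e4 e5 q2
  set x := comp T 0 1 6
  set y := comp T 0 2 4
  set z := comp T 0 3 5
  set a := comp T 0 1 4
  set b := comp T 0 1 5
  set d := comp T 0 3 4
  have a0 : a = 0 := by linarith
  have b0 : b = 0 := by linarith
  have d0 : d = 0 := by linarith
  have hz : z = -y := by linarith
  have hx : 3 * x = -4 * y := by linarith
  have hy : y ^ 2 = 0 := by
    rw [b0, hz] at q2
    linear_combination (-1 / 4) * q2
  have y0 : y = 0 := pow_eq_zero_iff two_ne_zero |>.1 hy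
  have x0 : x = 0 := by linarith
  have z0 : z = 0 := by linarith
  refine comp_eq_zero_of_nine hT h1 h2 hΛ ?_ i j k
  rintro n (rfl | rfl | rfl)
  · exact ⟨a0, y0, d0⟩
  · exact ⟨b0, by rw [s3]; linarith, z0⟩
  · exact ⟨x0, by rw [s2]; exact a0, by rw [s1]; linarith⟩

end SpecialUnitary

end G2Torsion

end

noncomputable section

namespace G2Torsion

attribute [local instance 100] LieRing.ofAssociativeRing

/-! ### Elements of 𝔰𝔲(3) and 𝔰𝔲(2) and the vectors they annihilate. -/

section Membership

theorem wedge_apply (i j a : Fin 7) (u : E7) :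
    wedge i j u a = u i * (if a = j then 1 else 0) - u j * (if a = i then 1 else 0) := by
  simp [wedge, stdVec_apply]

theorem mem_su3_of {A : E7 →L[ℝ] E7} (h1 : ∀ u v, inner ℝ (A u) v = -inner ℝ u (A v))
    (h2 : ∀ u v w, phi0 (A u) v w + phi0 u (A v) w + phi0 u v (A w) = 0)
    (h3 : A (stdVec 6) = 0) : A ∈ su3 := ⟨⟨h1, h2⟩, h3⟩

theorem wedge_skew (i j : Fin 7) (u v : E7) :
    inner ℝ (wedge i j u) v = -inner ℝ u (wedge i j v) := by
  simp only [wedge, sub_apply, ContinuousLinearMap.smulRight_apply, inner_sub_left,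
    inner_sub_right, real_inner_smul_left, real_inner_smul_right]
  simp [stdVec, EuclideanSpace.inner_single_left, EuclideanSpace.inner_single_right]
  ring

theorem generators_mem_su3 :
    wedge 0 2 + wedge 1 3 ∈ su3 ∧ wedge 0 3 - wedge 1 2 ∈ su3 ∧ wedge 0 1 - wedge 4 5 ∈ su3 ∧
      wedge 2 4 + wedge 3 5 ∈ su3 := by
  refine ⟨mem_su3_of ?_ ?_ ?_, mem_su3_of ?_ ?_ ?_, mem_su3_of ?_ ?_ ?_, mem_su3_of ?_ ?_ ?_⟩
  iterate 4
    · intro u v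
      simp only [add_apply, sub_apply, inner_add_left, inner_add_right, inner_sub_left,
        inner_sub_right, wedge_skew]
      ring
    · intro u v w
      simp [phi0, elem3, Matrix.det_fin_three, wedge_apply]
      ring
    · simp [wedge_stdVec]

theorem generators_mem_su2 : wedge 0 2 + wedge 1 3 ∈ su2 ∧ wedge 0 3 - wedge 1 2 ∈ su2 :=
  ⟨LieSubalgebra.subset_lieSpan (by simp), LieSubalgebra.subset_lieSpan (by simp)⟩

/-- The annihilator of a vector is a Lie subalgebra, so it is enough to look at the generators. -/
theorem su2_stdVec {A : E7 →L[ℝ] E7} (hA : A ∈ su2) {m : Fin 7}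
    (hm : m = 4 ∨ m = 5 ∨ m = 6) : A (stdVec m) = 0 := by
  let K : LieSubalgebra ℝ (E7 →L[ℝ] E7) :=
    { carrier := {A | A (stdVec m) = 0}
      zero_mem' := rfl
      add_mem' := by
        rintro A B (hA : _ = _) (hB : _ = _)
        change (A + B) (stdVec m) = 0
        simp [hA, hB]
      smul_mem' := by
        rintro c A (hA : _ = _)
        change (c • A) (stdVec m) = 0
        simp [hA]
      lie_mem' := by
        rintro A B (hA : _ = _) (hB : _ = _)
        change ⁅A, B⁆ (stdVec m) = 0
        simp [Ring.lie_def, hA, hB] }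
  have h : su2 ≤ K := by
    refine LieSubalgebra.lieSpan_le.2 ?_
    rintro A (rfl | rfl | rfl)
    all_goals
      change (_ : E7 →L[ℝ] E7) (stdVec m) = 0
      rcases hm with rfl | rfl | rfl <;> simp [wedge_stdVec]
  exact h hA

end Membership

/-! ### Contraction with φ₀ and Schur's lemma for symmetric matrices. -/

section Irreducible

/-- The symmetrized contraction of two 3-forms over two indices, in components. -/
def contraction (t p : Fin 7 → Fin 7 → Fin 7 → ℝ) : Matrix (Fin 7) (Fin 7) ℝ :=
  .of fun u v => (Matrix.of (t u) * Matrix.of (p v)).trace +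
    (Matrix.of (t v) * Matrix.of (p u)).trace

variable {t p : Fin 7 → Fin 7 → Fin 7 → ℝ}

theorem contraction_apply (u v : Fin 7) : contraction t p u v =
    (Matrix.of (t u) * Matrix.of (p v)).trace + (Matrix.of (t v) * Matrix.of (p u)).trace := rfl

theorem contraction_isHermitian : (contraction t p).IsHermitian := by
  ext u v
  simp [contraction, add_comm]

/-- The infinitesimal action of a skew matrix on the slices of a form. -/
theorem sum_smul_slice {a : Matrix (Fin 7) (Fin 7) ℝ}
    (ha : ∀ i j, a i j = -a j i)
    (h : ∀ i j k, ∑ l, a l i * t l j k + ∑ l, a l j * t i l k + ∑ l, a l k * t i j l = 0)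
    (k : Fin 7) : ∑ l, a l k • Matrix.of (t l) = a * Matrix.of (t k) - Matrix.of (t k) * a := by
  ext i j
  have h1 := h k i j
  simp only [Matrix.sum_apply, Matrix.smul_apply, Matrix.of_apply, smul_eq_mul, Matrix.sub_apply,
    Matrix.mul_apply]
  have h2 : ∑ l, a i l * t k l j = -∑ l, a l i * t k l j := by
    rw [← Finset.sum_neg_distrib]
    exact Finset.sum_congr rfl fun l _ => by rw [ha i l]; ring
  have h3 : ∑ l, t k i l * a l j = ∑ l, a l j * t k i l :=
    Finset.sum_congr rfl fun l _ => mul_comm _ _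
  rw [h2, h3]
  linarith

/-- The action of a on slices is by commutators, and tr([a, P] Q) + tr(P [a, Q]) = 0 by cyclicity of
the trace. Thus a acts trivially on the contraction, and for skew a this is commutation. -/
theorem contraction_invariant {a : Matrix (Fin 7) (Fin 7) ℝ} (ha : ∀ i j, a i j = -a j i)
    (ht : ∀ k, ∑ l, a l k • Matrix.of (t l) = a * Matrix.of (t k) - Matrix.of (t k) * a)
    (hp : ∀ k, ∑ l, a l k • Matrix.of (p l) = a * Matrix.of (p k) - Matrix.of (p k) * a) :
    contraction t p * a = a * contraction t p := by
  ext u v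
  have h1 : ∀ k m, ∑ l, a l k * (Matrix.of (t l) * Matrix.of (p m)).trace =
      ((a * Matrix.of (t k) - Matrix.of (t k) * a) * Matrix.of (p m)).trace := fun k m => by
    rw [← ht, Finset.sum_mul, Matrix.trace_sum]
    simp only [Matrix.smul_mul, Matrix.trace_smul, smul_eq_mul]
  have h2 : ∀ k m, ∑ l, a l k * (Matrix.of (t m) * Matrix.of (p l)).trace =
      (Matrix.of (t m) * (a * Matrix.of (p k) - Matrix.of (p k) * a)).trace := fun k m => by
    rw [← hp, Finset.mul_sum, Matrix.trace_sum]
    simp only [Matrix.mul_smul, Matrix.trace_smul, smul_eq_mul]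
  have h3 : ∀ k m, ((a * Matrix.of (t k) - Matrix.of (t k) * a) * Matrix.of (p m)).trace +
      (Matrix.of (t k) * (a * Matrix.of (p m) - Matrix.of (p m) * a)).trace = 0 := fun k m => by
    simp only [sub_mul, mul_sub, Matrix.trace_sub]
    rw [Matrix.mul_assoc a, Matrix.trace_mul_comm a]
    simp only [Matrix.mul_assoc]
    ring
  have e1 : (contraction t p * a) u v = ∑ l, a l v * (Matrix.of (t u) * Matrix.of (p l)).trace +
      ∑ l, a l v * (Matrix.of (t l) * Matrix.of (p u)).trace := by
    rw [Matrix.mul_apply]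
    simp only [contraction_apply, add_mul, Finset.sum_add_distrib]
    congr 1 <;> exact Finset.sum_congr rfl fun l _ => mul_comm _ _
  have e2 : (a * contraction t p) u v = -(∑ l, a l u * (Matrix.of (t l) * Matrix.of (p v)).trace +
      ∑ l, a l u * (Matrix.of (t v) * Matrix.of (p l)).trace) := by
    rw [Matrix.mul_apply]
    simp only [contraction_apply, mul_add, Finset.sum_add_distrib, neg_add,
      ← Finset.sum_neg_distrib, ha u]
    congr 1 <;> exact Finset.sum_congr rfl fun l _ => neg_mul _ _
  rw [e1, e2, h1, h1, h2, h2]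
  linarith [h3 u v, h3 v u]

theorem apply_eq_toEuclideanLin (A : E7 →L[ℝ] E7) (w : E7) :
    A w = Matrix.toEuclideanLin (.of fun i j => A (stdVec j) i) w := by
  conv_lhs => rw [← sum_smul_stdVec w]
  ext i
  simp [Matrix.toLpLin_apply, Matrix.mulVec, dotProduct, mul_comm]

/-- A symmetric matrix commuting with an irreducible family of endomorphisms is scalar. -/
theorem isScalar_of_irreducible {h : Set (E7 →L[ℝ] E7)}
    (hirr : ∀ W : Submodule ℝ E7, (∀ A ∈ h, ∀ w ∈ W, A w ∈ W) → W = ⊥ ∨ W = ⊤)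
    {S : Matrix (Fin 7) (Fin 7) ℝ} (hS : S.IsHermitian)
    (hc : ∀ A ∈ h, S * (.of fun i j => A (stdVec j) i) = (.of fun i j => A (stdVec j) i) * S) :
    ∃ μ : ℝ, S = μ • 1 := by
  -- Any eigenvalue will do: a real symmetric matrix has one, and its nonzero eigenspace is
  -- preserved by everything that commutes with S.
  set μ := hS.eigenvalues 0
  set W := Module.End.eigenspace (Matrix.toEuclideanLin S) μ
  refine ⟨μ, ?_⟩
  have hW : W ≠ ⊥ := by
    intro h0
    have h1 : hS.eigenvectorBasis 0 ∈ W := by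
      rw [Module.End.mem_eigenspace_iff]
      ext i
      have := congrFun (hS.mulVec_eigenvectorBasis 0) i
      simpa [Matrix.toLpLin_apply] using this
    rw [h0, Submodule.mem_bot] at h1
    have h2 := hS.eigenvectorBasis.orthonormal.1 0
    rw [h1, norm_zero] at h2
    exact zero_ne_one h2
  have hW' : W = ⊤ := by
    refine (hirr W fun A hA w hw => ?_).resolve_left hW
    rw [Module.End.mem_eigenspace_iff] at hw ⊢
    have h1 := congrArg (fun R : Matrix (Fin 7) (Fin 7) ℝ => Matrix.toEuclideanLin R w) (hc A hA)
    simp only [Matrix.toLpLin_mul_same, LinearMap.comp_apply] at h1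
    rw [apply_eq_toEuclideanLin A w]
    refine h1.trans ?_
    rw [hw, map_smul]
  ext i j
  have h1 : stdVec j ∈ W := by rw [hW']; trivial
  rw [Module.End.mem_eigenspace_iff] at h1
  have h2 := congrFun (congrArg WithLp.ofLp h1) i
  simpa [Matrix.toLpLin_apply, stdVec, Matrix.one_apply, Pi.single_apply] using h2

theorem sum_mul_elem3_right (F : Fin 7 → Fin 7 → ℝ) (a b c : Fin 7) (v : E7) :
    ∑ i, ∑ j, F i j * elem3 a b c v (stdVec i) (stdVec j) =
      v a * (F b c - F c b) - v b * (F a c - F c a) + v c * (F a b - F b a) := by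
  simp only [elem3, Matrix.det_fin_three, stdVec_apply]
  simp [mul_add, mul_sub, Finset.sum_add_distrib, Finset.sum_sub_distrib]
  ring

theorem trace_mul_phi0 (ht : IsAlternating t) (u v : Fin 7) :
    (Matrix.of (t u) * Matrix.of (comp phi0 v)).trace = -2 * (
      (stdVec v 0 * t u 1 6 - stdVec v 1 * t u 0 6 + stdVec v 6 * t u 0 1) +
      (stdVec v 0 * t u 2 4 - stdVec v 2 * t u 0 4 + stdVec v 4 * t u 0 2) -
      (stdVec v 0 * t u 3 5 - stdVec v 3 * t u 0 5 + stdVec v 5 * t u 0 3) -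
      (stdVec v 1 * t u 2 5 - stdVec v 2 * t u 1 5 + stdVec v 5 * t u 1 2) -
      (stdVec v 1 * t u 3 4 - stdVec v 3 * t u 1 4 + stdVec v 4 * t u 1 3) +
      (stdVec v 2 * t u 3 6 - stdVec v 3 * t u 2 6 + stdVec v 6 * t u 2 3) +
      (stdVec v 4 * t u 5 6 - stdVec v 5 * t u 4 6 + stdVec v 6 * t u 4 5)) := by
  have h1 : (Matrix.of (t u) * Matrix.of (comp phi0 v)).trace =
      -∑ i, ∑ j, t u i j * phi0 (stdVec v) (stdVec i) (stdVec j) := by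
    simp only [Matrix.trace, Matrix.diag_apply, Matrix.mul_apply, Matrix.of_apply, comp,
      ← Finset.sum_neg_distrib]
    refine Finset.sum_congr rfl fun i _ => Finset.sum_congr rfl fun j _ => ?_
    rw [phi0_isThreeForm.swap_right]
    ring
  rw [h1]
  simp only [phi0, mul_add, mul_sub, Finset.sum_add_distrib, Finset.sum_sub_distrib,
    sum_mul_elem3_right]
  simp only [ht.swap_right u 6 1, ht.swap_right u 6 0, ht.swap_right u 1 0, ht.swap_right u 4 2,
    ht.swap_right u 4 0, ht.swap_right u 2 0, ht.swap_right u 5 3, ht.swap_right u 5 0,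
    ht.swap_right u 3 0, ht.swap_right u 5 2, ht.swap_right u 5 1, ht.swap_right u 2 1,
    ht.swap_right u 4 3, ht.swap_right u 4 1, ht.swap_right u 3 1, ht.swap_right u 6 3,
    ht.swap_right u 6 2, ht.swap_right u 3 2, ht.swap_right u 6 5, ht.swap_right u 6 4,
    ht.swap_right u 5 4]
  ring

/-- The trace is a multiple of the inner product of T with φ₀. -/
theorem trace_contraction_phi0 {T : E7 → E7 → E7 → ℝ} (hΛ : InLambda27 T) :
    (contraction (comp T) (comp phi0)).trace = 0 := by
  have h1 : (contraction (comp T) (comp phi0)).trace = -2 * ∑ u, ∑ i, ∑ j,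
      T (stdVec u) (stdVec i) (stdVec j) * phi0 (stdVec u) (stdVec i) (stdVec j) := by
    simp only [Matrix.trace, Matrix.diag_apply, contraction_apply, Matrix.mul_apply,
      Matrix.of_apply, comp, Finset.mul_sum, ← Finset.sum_add_distrib]
    refine Finset.sum_congr rfl fun u _ => Finset.sum_congr rfl fun i _ =>
      Finset.sum_congr rfl fun j _ => ?_
    rw [phi0_isThreeForm.swap_right _ (stdVec j)]
    ring
  rw [h1, hΛ.1, mul_zero]

end Irreducible

end G2Torsion

end

noncomputable section

namespace G2Torsion

/-! ### Injectivity of the contraction on Λ³₂₇. -/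

section Contraction

variable {T : E7 → E7 → E7 → ℝ} (hT : IsThreeForm T)
  (h : contraction (comp T) (comp phi0) = 0)
include hT h

/-- The seven triples in φ₀ are the lines of a Fano plane. The diagonal entry at u is a multiple of
the signed sum of the components of T over the three lines through u, and the incidence matrix of
points and lines is invertible. -/
theorem comp_eq_zero_of_contraction_diag :
    comp T 0 1 6 = 0 ∧ comp T 0 2 4 = 0 ∧ comp T 0 3 5 = 0 ∧ comp T 1 2 5 = 0 ∧
      comp T 1 3 4 = 0 ∧ comp T 2 3 6 = 0 ∧ comp T 4 5 6 = 0 := by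
  have ht := hT.isAlternating
  have e : ∀ u, contraction (comp T) (comp phi0) u u = 0 := fun u => by rw [h]; rfl
  simp only [contraction_apply, trace_mul_phi0 ht] at e
  have e0 := e 0
  have e1 := e 1
  have e2 := e 2
  have e3 := e 3
  have e4 := e 4
  have e5 := e 5
  have e6 := e 6
  simp [stdVec_apply] at e0 e1 e2 e3 e4 e5 e6
  simp (disch := decide) only [ht.sort_left, ht.sort_right] at e0 e1 e2 e3 e4 e5 e6
  exact ⟨by linarith, by linarith, by linarith, by linarith, by linarith, by linarith,
    by linarith⟩

/-- The 28 triples that are not lines split into seven groups of four, one for each point w. The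
off-diagonal entries at the three pairs completing w to a line, together with orthogonality to the
contraction of *φ₀ with e_w, are four independent equations for the group. -/
theorem comp_eq_zero_of_contraction (hΛ : InLambda27 T) (i j k : Fin 7) : comp T i j k = 0 := by
  have ht := hT.isAlternating
  obtain ⟨d1, d2, d3, d4, d5, d6, d7⟩ := comp_eq_zero_of_contraction_diag hT h
  have e : ∀ u v, contraction (comp T) (comp phi0) u v = 0 := fun u v => by rw [h]; rfl
  simp only [contraction_apply, trace_mul_phi0 ht] at e
  have ⟨r0a, r0b, r0c, r0d⟩ : comp T 3 4 6 = 0 ∧ comp T 2 5 6 = 0 ∧ comp T 1 4 5 = 0 ∧ comp T 1 2 3 = 0 := by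
    have e0 := e 1 6
    have e1 := e 2 4
    have e2 := e 3 5
    have s := sum_mul_starPhi0 hT hΛ (stdVec 0)
    simp [stdVec_apply] at e0 e1 e2 s
    simp (disch := decide) only [ht.sort_left, ht.sort_right, ht.diag_left, ht.diag_right]
      at e0 e1 e2
    exact ⟨by linarith, by linarith, by linarith, by linarith⟩
  have ⟨r1a, r1b, r1c, r1d⟩ : comp T 2 4 6 = 0 ∧ comp T 3 5 6 = 0 ∧ comp T 0 4 5 = 0 ∧ comp T 0 2 3 = 0 := by
    have e0 := e 0 6
    have e1 := e 2 5
    have e2 := e 3 4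
    have s := sum_mul_starPhi0 hT hΛ (stdVec 1)
    simp [stdVec_apply] at e0 e1 e2 s
    simp (disch := decide) only [ht.sort_left, ht.sort_right, ht.diag_left, ht.diag_right]
      at e0 e1 e2
    exact ⟨by linarith, by linarith, by linarith, by linarith⟩
  have ⟨r2a, r2b, r2c, r2d⟩ : comp T 3 4 5 = 0 ∧ comp T 1 4 6 = 0 ∧ comp T 0 5 6 = 0 ∧ comp T 0 1 3 = 0 := by
    have e0 := e 0 4
    have e1 := e 1 5
    have e2 := e 3 6
    have s := sum_mul_starPhi0 hT hΛ (stdVec 2)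
    simp [stdVec_apply] at e0 e1 e2 s
    simp (disch := decide) only [ht.sort_left, ht.sort_right, ht.diag_left, ht.diag_right]
      at e0 e1 e2
    exact ⟨by linarith, by linarith, by linarith, by linarith⟩
  have ⟨r3a, r3b, r3c, r3d⟩ : comp T 1 5 6 = 0 ∧ comp T 2 4 5 = 0 ∧ comp T 0 4 6 = 0 ∧ comp T 0 1 2 = 0 := by
    have e0 := e 0 5
    have e1 := e 1 4
    have e2 := e 2 6
    have s := sum_mul_starPhi0 hT hΛ (stdVec 3)
    simp [stdVec_apply] at e0 e1 e2 s
    simp (disch := decide) only [ht.sort_left, ht.sort_right, ht.diag_left, ht.diag_right]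
      at e0 e1 e2
    exact ⟨by linarith, by linarith, by linarith, by linarith⟩
  have ⟨r4a, r4b, r4c, r4d⟩ : comp T 2 3 5 = 0 ∧ comp T 1 2 6 = 0 ∧ comp T 0 3 6 = 0 ∧ comp T 0 1 5 = 0 := by
    have e0 := e 0 2
    have e1 := e 1 3
    have e2 := e 5 6
    have s := sum_mul_starPhi0 hT hΛ (stdVec 4)
    simp [stdVec_apply] at e0 e1 e2 s
    simp (disch := decide) only [ht.sort_left, ht.sort_right, ht.diag_left, ht.diag_right]
      at e0 e1 e2
    exact ⟨by linarith, by linarith, by linarith, by linarith⟩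
  have ⟨r5a, r5b, r5c, r5d⟩ : comp T 2 3 4 = 0 ∧ comp T 1 3 6 = 0 ∧ comp T 0 2 6 = 0 ∧ comp T 0 1 4 = 0 := by
    have e0 := e 0 3
    have e1 := e 1 2
    have e2 := e 4 6
    have s := sum_mul_starPhi0 hT hΛ (stdVec 5)
    simp [stdVec_apply] at e0 e1 e2 s
    simp (disch := decide) only [ht.sort_left, ht.sort_right, ht.diag_left, ht.diag_right]
      at e0 e1 e2
    exact ⟨by linarith, by linarith, by linarith, by linarith⟩
  have ⟨r6a, r6b, r6c, r6d⟩ : comp T 1 3 5 = 0 ∧ comp T 1 2 4 = 0 ∧ comp T 0 3 4 = 0 ∧ comp T 0 2 5 = 0 := by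
    have e0 := e 0 1
    have e1 := e 2 3
    have e2 := e 4 5
    have s := sum_mul_starPhi0 hT hΛ (stdVec 6)
    simp [stdVec_apply] at e0 e1 e2 s
    simp (disch := decide) only [ht.sort_left, ht.sort_right, ht.diag_left, ht.diag_right]
      at e0 e1 e2
    exact ⟨by linarith, by linarith, by linarith, by linarith⟩
  refine ht.eq_zero_of_sorted (fun i j k hij hjk => ?_) i j k
  fin_cases i <;> fin_cases j <;> first | (exfalso; revert hij; decide) | skip
  all_goals fin_cases k <;> first | (exfalso; revert hjk; decide) | assumption

omit h in
/-- A form in `Λ³₂₇` invariant under an irreducible subalgebra of `𝔤₂` vanishes. -/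
theorem comp_eq_zero_of_irreducible {𝔥 : Set (E7 →L[ℝ] E7)} (hg : ∀ A ∈ 𝔥, A ∈ g2)
    (hirr : ∀ W : Submodule ℝ E7, (∀ A ∈ 𝔥, ∀ w ∈ W, A w ∈ W) → W = ⊥ ∨ W = ⊤)
    (hinv : ∀ A ∈ 𝔥, IsInvariant T A) (hΛ : InLambda27 T) (i j k : Fin 7) : comp T i j k = 0 := by
  refine comp_eq_zero_of_contraction hT ?_ hΛ i j k
  obtain ⟨μ, hμ⟩ := isScalar_of_irreducible hirr
    (contraction_isHermitian (t := comp T) (p := comp phi0)) fun A hA => by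
      have ha : ∀ i j, (Matrix.of fun i j => A (stdVec j) i) i j =
          -(Matrix.of fun i j => A (stdVec j) i) j i := fun i j => by
        have h1 := (hg A hA).1 (stdVec j) (stdVec i)
        simpa [stdVec, EuclideanSpace.inner_single_left, EuclideanSpace.inner_single_right]
          using h1
      exact contraction_invariant ha (sum_smul_slice ha (hT.invariant_comp (hinv A hA)))
        (sum_smul_slice ha (phi0_isThreeForm.invariant_comp (hg A hA).2))
  have h1 := trace_contraction_phi0 hΛ
  rw [hμ, Matrix.trace_smul, Matrix.trace_one] at h1
  have h2 : μ = 0 := by simpa using h1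
  rw [hμ, h2, zero_smul]

end Contraction

end G2Torsion

end

noncomputable section

namespace G2Torsion

/-! ### Transfer of holonomy invariance and the Bianchi identity to an adapted frame. -/

section Holonomy

variable {M : Type*} [TopologicalSpace M] [ChartedSpace (EuclideanSpace ℝ (Fin 7)) M]
  [IsManifold (𝓡 7) ∞ M] [RiemannianBundle (fun x : M => TangentSpace (𝓡 7) x)]

/-- The torsion at a point in an orthonormal frame. -/
def frameTorsion (cov : Connection M) {p : M} (b : E7 ≃ₗᵢ[ℝ] TangentSpace (𝓡 7) p) :
    E7 → E7 → E7 → ℝ := fun u v w => torsionTensor cov p (b u) (b v) (b w)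

theorem torsion_frame_eq_sum (cov : Connection M) {p : M} (b : E7 ≃ₗᵢ[ℝ] TangentSpace (𝓡 7) p)
    (u v : E7) : cov.torsion p (b u) (b v) =
      ∑ l, frameTorsion cov b u v (stdVec l) • b (stdVec l) := by
  have h : b.symm (cov.torsion p (b u) (b v)) =
      ∑ l, frameTorsion cov b u v (stdVec l) • stdVec l := by
    conv_lhs => rw [← sum_smul_stdVec (b.symm (cov.torsion p (b u) (b v)))]
    refine Finset.sum_congr rfl fun l _ => congrArg (· • stdVec l) ?_
    rw [frameTorsion, torsionTensor]
    conv_rhs => rw [← b.apply_symm_apply (cov.torsion p (b u) (b v)), b.inner_map_map]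
    simp [stdVec, EuclideanSpace.inner_single_right]
  rw [← b.apply_symm_apply (cov.torsion p (b u) (b v)), h, map_sum]
  simp only [map_smul]

/-- An endomorphism of `ℝ⁷` transported to a tangent space by a frame. -/
def frameConj {p : M} (b : E7 ≃ₗᵢ[ℝ] TangentSpace (𝓡 7) p) (A : E7 →L[ℝ] E7) :
    TangentSpace (𝓡 7) p →L[ℝ] TangentSpace (𝓡 7) p :=
  (b.toContinuousLinearEquiv : E7 →L[ℝ] TangentSpace (𝓡 7) p) ∘L A ∘L
    (b.symm.toContinuousLinearEquiv : TangentSpace (𝓡 7) p →L[ℝ] E7)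

omit [IsManifold (𝓡 7) ∞ M] in
theorem frameConj_apply {p : M} (b : E7 ≃ₗᵢ[ℝ] TangentSpace (𝓡 7) p) (A : E7 →L[ℝ] E7) (u : E7) :
    frameConj b A (b u) = b (A u) := by
  change b (A (b.symm (b u))) = _
  rw [b.symm_apply_apply]

variable [IsContMDiffRiemannianBundle (𝓡 7) ∞ E7 (fun x : M => TangentSpace (𝓡 7) x)]
  {φ : ThreeFormField M} {cov : Connection M}

theorem IsCharacteristicConnection.isThreeForm (hcov : IsCharacteristicConnection φ cov) {p : M}
    (b : E7 ≃ₗᵢ[ℝ] TangentSpace (𝓡 7) p) : IsThreeForm (frameTorsion cov b) where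
  add_left u u' v w := by
    simp only [frameTorsion, torsionTensor, map_add, add_apply, inner_add_left]
  smul_left c u v w := by
    simp only [frameTorsion, torsionTensor, map_smul, smul_apply, real_inner_smul_left]
  swap_left u v w := (hcov.skew p _ _ _).1
  swap_right u v w := (hcov.skew p _ _ _).2

theorem isInvariant_frameTorsion [T2Space M] (hcov : IsCharacteristicConnection φ cov)
    (hpar : IsParallelTensor cov (torsionTensor cov)) {p : M}
    {b : E7 ≃ₗᵢ[ℝ] TangentSpace (𝓡 7) p} {A : E7 →L[ℝ] E7}
    (hA : frameConj b A ∈ holonomyAlgebra cov p) : IsInvariant (frameTorsion cov b) A := by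
  intro u v w
  have h := torsionTensor_holonomyAlgebra hcov.smooth hpar hA (b u) (b v) (b w)
  simp only [frameConj_apply] at h
  exact h

theorem isBianchi_frameTorsion [T2Space M] (hcov : IsCharacteristicConnection φ cov)
    (hpar : IsParallelTensor cov (torsionTensor cov)) {p : M}
    {b : E7 ≃ₗᵢ[ℝ] TangentSpace (𝓡 7) p} {m : Fin 7}
    (hm : ∀ A ∈ holonomyAlgebra cov p, A (b (stdVec m)) = 0) :
    IsBianchi (comp (frameTorsion cov b)) m := by
  intro i j k
  have h := bianchi hcov.smooth hcov.metric hpar (fun u v w => (hcov.skew p u v w).1) hm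
    (b (stdVec i)) (b (stdVec j)) (b (stdVec k))
  have e : ∀ i j k, torsionTensor cov p (cov.torsion p (b (stdVec i)) (b (stdVec j)))
      (b (stdVec k)) (b (stdVec m)) =
      ∑ l, comp (frameTorsion cov b) i j l * comp (frameTorsion cov b) l k m := by
    intro i j k
    rw [torsion_frame_eq_sum]
    simp only [torsionTensor, map_sum, map_smul, sum_apply, smul_apply, sum_inner,
      real_inner_smul_left]
    rfl
  rw [e, e, e] at h
  rw [← h]
  simp only [Finset.sum_add_distrib]

end Holonomy

section Algebra

variable {M : Type*} [TopologicalSpace M] [ChartedSpace (EuclideanSpace ℝ (Fin 7)) M]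
  [IsManifold (𝓡 7) ∞ M] [RiemannianBundle (fun x : M => TangentSpace (𝓡 7) x)]
  {cov : Connection M} {p : M} {b : E7 ≃ₗᵢ[ℝ] TangentSpace (𝓡 7) p}
  {𝔥 : Set (E7 →L[ℝ] E7)}
  (h : ∀ A : TangentSpace (𝓡 7) p →L[ℝ] TangentSpace (𝓡 7) p, A ∈ holonomyAlgebra cov p ↔
    (b.symm.toContinuousLinearEquiv : TangentSpace (𝓡 7) p →L[ℝ] E7) ∘L A ∘L
      (b.toContinuousLinearEquiv : E7 →L[ℝ] TangentSpace (𝓡 7) p) ∈ 𝔥)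
include h

theorem frameConj_mem_holonomyAlgebra {A : E7 →L[ℝ] E7} (hA : A ∈ 𝔥) :
    frameConj b A ∈ holonomyAlgebra cov p := by
  rw [h]
  convert hA using 1
  ext u : 1
  change b.symm (frameConj b A (b u)) = A u
  rw [frameConj_apply, b.symm_apply_apply]

theorem holonomyAlgebra_apply_eq_zero {e : E7} (he : ∀ A ∈ 𝔥, A e = 0)
    (A : TangentSpace (𝓡 7) p →L[ℝ] TangentSpace (𝓡 7) p) (hA : A ∈ holonomyAlgebra cov p) :
    A (b e) = 0 := by
  have h1 : b.symm (A (b e)) = 0 := he _ ((h A).1 hA)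
  rwa [LinearIsometryEquiv.map_eq_zero_iff] at h1

end Algebra

end G2Torsion

end

/-! ### Conclusion. -/

theorem mainTheorem2
    {M : Type*} [TopologicalSpace M] [T2Space M] [SecondCountableTopology M] [ConnectedSpace M]
    [ChartedSpace (EuclideanSpace ℝ (Fin 7)) M] [IsManifold (𝓡 7) ∞ M]
    [RiemannianBundle (fun x : M => TangentSpace (𝓡 7) x)]
    [IsContMDiffRiemannianBundle (𝓡 7) ∞ G2Torsion.E7 (fun x : M => TangentSpace (𝓡 7) x)]
    (φ : G2Torsion.ThreeFormField M) (hφ : G2Torsion.IsG2Structure φ)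
    (cov : G2Torsion.Connection M) (hcov : G2Torsion.IsCharacteristicConnection φ cov)
    (hW3 : G2Torsion.TorsionInLambda27 φ cov)
    (hpar : G2Torsion.IsParallelTensor cov (G2Torsion.torsionTensor cov))
    (hhol : G2Torsion.HasHolonomyAlgebra φ cov G2Torsion.su3 ∨
      G2Torsion.HasHolonomyAlgebra φ cov G2Torsion.su2 ∨
      ∃ h, G2Torsion.IsSoIr3 h ∧ G2Torsion.HasHolonomyAlgebra φ cov h) :
    (∀ (x : M) (u v w : TangentSpace (𝓡 7) x), G2Torsion.torsionTensor cov x u v w = 0) ∧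
      G2Torsion.IsParallelG2Structure φ := by
  open G2Torsion in
  have hpoint : ∃ (p : M) (b : E7 ≃ₗᵢ[ℝ] TangentSpace (𝓡 7) p),
      ∀ i j k, comp (frameTorsion cov b) i j k = 0 := by
    obtain ⟨g1, g2, g3, g4⟩ := generators_mem_su3
    rcases hhol with ⟨p, b, hb, h⟩ | ⟨p, b, hb, h⟩ | ⟨𝔥, h𝔥, p, b, hb, h⟩
    · have hi : ∀ A ∈ su3, IsInvariant (frameTorsion cov b) A := fun A hA =>
        isInvariant_frameTorsion hcov hpar (frameConj_mem_holonomyAlgebra h hA)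
      exact ⟨p, b, comp_eq_zero_of_su3 (hcov.isThreeForm b) (hi _ g1) (hi _ g2) (hi _ g3)
        (hi _ g4) (hW3 p b hb) (isBianchi_frameTorsion hcov hpar
          (holonomyAlgebra_apply_eq_zero h fun A hA => hA.2))⟩
    · have hi : ∀ A ∈ su2, IsInvariant (frameTorsion cov b) A := fun A hA =>
        isInvariant_frameTorsion hcov hpar (frameConj_mem_holonomyAlgebra h hA)
      exact ⟨p, b, comp_eq_zero_of_su2 (hcov.isThreeForm b)
        (hi _ generators_mem_su2.1) (hi _ generators_mem_su2.2) (hW3 p b hb) fun m hm =>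
          isBianchi_frameTorsion hcov hpar
            (holonomyAlgebra_apply_eq_zero h fun A hA => su2_stdVec hA hm)⟩
    · exact ⟨p, b, comp_eq_zero_of_irreducible (hcov.isThreeForm b) (fun A hA => h𝔥.le_g2 hA)
        h𝔥.irreducible (fun A hA => isInvariant_frameTorsion hcov hpar
          (frameConj_mem_holonomyAlgebra h hA)) (hW3 p b hb)⟩
  obtain ⟨p, b, h0⟩ := hpoint
  have hp : G2Torsion.torsionTensor cov p = 0 := by
    ext u v w
    have h1 := (hcov.isThreeForm b).eq_zero h0 (b.symm u) (b.symm v) (b.symm w)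
    simp only [G2Torsion.frameTorsion, b.apply_symm_apply] at h1
    exact h1
  have hT := G2Torsion.torsionTensor_eq_zero_of_point hcov.smooth hpar hp
  -- The characteristic connection itself serves as Levi-Civita connection; its torsion vector
  -- vanishes because its inner product with itself is a value of the torsion tensor.
  refine ⟨fun x u v w => by rw [hT x]; rfl, cov, ⟨hcov.smooth, hcov.metric, ?_⟩, hcov.parallel⟩
  ext x u v : 3
  have h1 : inner ℝ (cov.torsion x u v) (cov.torsion x u v) = 0 :=
    congrFun (congrFun (congrFun (hT x) u) v) (cov.torsion x u v)
  exact inner_self_eq_zero.1 h1
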